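/- **Setting.** Let $d\ge 2$, $n\ge 1$, $T\ge 3$, and let $D,G,G_g,F,b_{\min}>0$. Let $\mathcal X\subseteq\mathbb R^d$ be closed and convex with $0\in\mathcal X$ and $\|x\|\le D/2$ for all $x\in\mathcal X$. In each round $t\in\{1,\dots,T\}$ a player chooses $x_t\in\mathcal X$ and, simultaneously, an adversary chooses, depending on the past, a convex differentiable cost $f_t:\mathcal X\to\mathbb R$ with $\|\nabla f_t\|\le G$ on $\mathcal X$. The player then observes $f_t$ and the vector $g_t(x_t)$, where $g_t(x)=A_tx-b_t$ and the pairs $(A_t,b_t)\in\mathbb R^{n\times d}\times\mathbb R^n$ are i.i.d., $(A_t,b_t)$ being independent of the past and of the choices of round $t$. Almost surely every row of $A_t$ has norm at most $G_g$ and $\|g_t(0)\|=\|b_t\|\le F$. Write $\bar g(x)=\mathbb E[g_t(x)]$. The vector $b:=-\bar g(0)=\mathbb E[b_t]$ is known to the player and $\min_i b_i=b_{\min}$, so that $\bar g(0)<0$ componentwise. The regret is $$R_T=\sum_{t=1}^Tf_t(x_t)-\min_{x\in\mathcal X,\ \bar g(x)\le 0}\ \sum_{t=1}^Tf_t(x).$$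 **OSOCO.** Put $\rho=(G_gD+4F)/2$, $S=G_g$, $\lambda=\max(1,D^2)$, $\kappa=b_{\min}/T$, $\delta=\min\{1/2,\ b_{\min}/(2SDT)\}$ and $\beta_t=\rho\sqrt{d\log\frac{1+(t-1)D^2/\lambda}{\delta/n}}+\sqrt\lambda\,S$. With $y_t:=g_t(x_t)-\bar g(0)$ let $V_t=\lambda I+\sum_{s<t}x_sx_s^\top$ and $S_t=\sum_{s<t}y_sx_s^\top$. The algorithm proceeds in phases; the first one starts in round $1$. In a phase that starts in round $t_0$ let $\bar V=V_{t_0}$, $\hat A=S_{t_0}\bar V^{-1}$, $\bar\beta=\beta_{t_0}$, $\|x\|_{\bar V^{-1}}=\sqrt{x^\top\bar V^{-1}x}$ and $$\mathcal Y^{p}=\{x\in\mathcal X:\hat Ax+\bar\beta\|x\|_{\bar V^{-1}}\mathbf 1\le b-\kappa\mathbf 1\},\qquad \mathcal Y^{o}=\{x\in\mathcal X:\hat Ax-\bar\beta\|x\|_{\bar V^{-1}}\mathbf 1\le b-\kappa\mathbf 1\}.$$ A randomized online algorithm $\mathcal A$ is restarted with action set $\mathcal Y^o$; in every round $t$ of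 the phase it samples $\tilde x_t$, the player plays $x_t=\gamma_t\tilde x_t$ with $\gamma_t=\max\{\mu\in[0,1]:\mu\tilde x_t\in\mathcal Y^p\}$, and $f_t$ is sent to $\mathcal A$. A new phase starts in round $t+1$ iff $\det V_{t+1}>2\det\bar V$. **Regret constant.** $C_{\mathcal A}\ge 0$ is a regret constant of $\mathcal A$ up to horizon $T$ if, on every nonempty closed (possibly nonconvex) action set $Y\subseteq\mathcal X$, for all costs $f_t$ as above and all sampled actions, $\mathcal A$ samples from distributions $p_t$ on $Y$ with $\sum_{t\le\tau}\mathbb E_{x\sim p_t}[f_t(x)]-\min_{x\in Y}\sum_{t\le\tau}f_t(x)\le C_{\mathcal A}\sqrt\tau$ for all $\tau\le T$. It may depend on $T$. **Efficient variant.** $\mathcal Y^o$ is replaced by the $M=2d$ convex sets $\mathcal Y^o(k,\xi)=\{x\in\mathcal X:\hat Ax-\sqrt d\,\bar\beta\,\xi\,(\bar V^{-1/2}x)_k\mathbf 1\le b-\kappa\mathbf 1\}$, $k\in\{1,\dots,d\}$, $\xi\in\{-1,1\}$, and $\mathcal A$ is HedgeDescent, restarted in each phase: in the $s$-th round of the phase,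 expert $m=(k,\xi)$ is at $z_s(m)$, where $z_1(m)=0$ and $z_{s+1}(m)$ is the projection onto $\mathcal Y^o(k,\xi)$ of $z_s(m)-\eta_s\nabla f(z_s(m))$ with $f$ the cost of that round and $\eta_s=\frac{D}{G\sqrt s}$; an expert $m_s$ is drawn with probability $p_s(m)\propto\exp\big(-\zeta_s\sum_{r<s}\ell_r(m)\big)$, where $\ell_r(m)$ is the cost of $z_r(m)$ in the $r$-th round of the phase and $\zeta_s=\frac{\sqrt{4\log M}}{GD\sqrt s}$; and $\tilde x_t=z_s(m_s)$. **Statement.** There are constants $K$ and $k$ that depend only on $D,G,G_g,F,b_{\min}$ (not on $T,d,n,\mathcal A$ or anything else) such that the following hold. 1. If OSOCO is played with an online algorithm $\mathcal A$ with regret constant $C_{\mathcal A}$, then $\mathbb E[g_t(x_t)]\le 0$ for all $t\in\{1,\dots,T\}$, and $\mathbb E[R_T]\le K\,(d+C_{\mathcal A}\sqrt d)\,\sqrt T\,\log^k(nT)$. 2. If the efficient variant is played, then $\mathbb E[g_t(x_t)]\le 0$ for all $t\in\{1,\dots,T\}$, and $\mathbb E[R_T]\le K\,d^{3/2}\,\sqrt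 T\,\log^k(ndT)$. -/

import Mathlib

open MeasureTheory ProbabilityTheory

namespace OSOCO

noncomputable section

/-! Rounds are indexed from `0`: round `t` here is round `t + 1` in the usual numbering `1, …, T`,
and "`s < t`" means "before round `t`". -/

/-- `ℝᵈ` with the Euclidean norm. -/
abbrev Vec (d : ℕ) : Type := EuclideanSpace ℝ (Fin d)

/-! ### Costs and online algorithms -/

/-- Admissible costs: `f : X → ℝ` is convex and differentiable on `X` with gradients bounded by `G`
(values of `f` outside `X` are irrelevant; the gradient is taken within `X`). -/
def IsCost {d : ℕ} (X : Set (Vec d)) (G : ℝ) (f : Vec d → ℝ) : Prop :=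
  ConvexOn ℝ X f ∧ ∀ x ∈ X, ∃ v : Vec d, HasGradientWithinAt f v X x ∧ ‖v‖ ≤ G

/-- A randomized online algorithm: from its action set and the history of its own actions and of the
observed costs (oldest first), it returns the distribution from which it samples its next action. -/
abbrev OnlineAlg (d : ℕ) : Type :=
  Set (Vec d) → List (Vec d × (Vec d → ℝ)) → Measure (Vec d)

/-- The history of the first `t` rounds. -/
def history {d : ℕ} (z : ℕ → Vec d) (f : ℕ → Vec d → ℝ) (t : ℕ) :
    List (Vec d × (Vec d → ℝ)) :=
  (List.range t).map fun s => (z s, f s)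

/-- `C` is a regret constant of `𝒜` up to horizon `T`: on every nonempty closed, not necessarily
convex, action set `Y ⊆ X`, whatever the costs and the sampled actions, `𝒜` samples from probability
distributions on `Y`, and its regret is at most `C √τ` if the game is stopped after `τ ≤ T` rounds.
As `T` is fixed, `C` may depend on `T` (for instance polylogarithmically). -/
def HasRegretConstant {d : ℕ} (𝒜 : OnlineAlg d) (X : Set (Vec d)) (G : ℝ) (T : ℕ) (C : ℝ) : Prop :=
  ∀ Y : Set (Vec d), Y ⊆ X → IsClosed Y → Y.Nonempty →
    ∀ f : ℕ → Vec d → ℝ, (∀ t, IsCost X G (f t)) →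
      ∀ z : ℕ → Vec d, (∀ t, z t ∈ Y) →
        (∀ t < T, IsProbabilityMeasure (𝒜 Y (history z f t)) ∧ 𝒜 Y (history z f t) Yᶜ = 0) ∧
        ∀ τ ≤ T,
          ∑ t ∈ Finset.range τ, ∫ x, f t x ∂(𝒜 Y (history z f t)) -
            sInf ((fun x => ∑ t ∈ Finset.range τ, f t x) '' Y) ≤ C * √(τ : ℝ)

/-! ### The quantities maintained by OSOCO

`x` is the sequence of played actions and `y` the sequence of constraint feedbacks. -/

/-- `V_t = λ I + ∑_{s < t} x_s x_sᵀ`. -/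
def gram {d : ℕ} (lam : ℝ) (x : ℕ → Vec d) (t : ℕ) : Matrix (Fin d) (Fin d) ℝ :=
  lam • (1 : Matrix (Fin d) (Fin d) ℝ) +
    ∑ s ∈ Finset.range t, Matrix.vecMulVec (x s).ofLp (x s).ofLp

/-- `S_t = ∑_{s < t} y_s x_sᵀ`. -/
def cross {n d : ℕ} (x : ℕ → Vec d) (y : ℕ → Vec n) (t : ℕ) : Matrix (Fin n) (Fin d) ℝ :=
  ∑ s ∈ Finset.range t, Matrix.vecMulVec (y s).ofLp (x s).ofLp

/-- The first round of the phase to which round `t` belongs. A phase that started in round `t₀` goes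
on with round `t + 1` iff `det V_{t+1} ≤ 2 det V_{t₀}`; otherwise round `t + 1` starts a new one. -/
def phaseStart {d : ℕ} (lam : ℝ) (x : ℕ → Vec d) : ℕ → ℕ
  | 0 => 0
  | t + 1 =>
      if (gram lam x (t + 1)).det ≤ 2 * (gram lam x (phaseStart lam x t)).det then
        phaseStart lam x t
      else t + 1

/-- The least-squares estimate `Â = S V⁻¹` formed in round `t₀`. -/
def estimate {n d : ℕ} (lam : ℝ) (x : ℕ → Vec d) (y : ℕ → Vec n) (t₀ : ℕ) :
    Matrix (Fin n) (Fin d) ℝ :=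
  cross x y t₀ * (gram lam x t₀)⁻¹

/-- The norm `‖z‖_{V⁻¹} = √(zᵀ V⁻¹ z)`. -/
def invNorm {d : ℕ} (V : Matrix (Fin d) (Fin d) ℝ) (z : Vec d) : ℝ :=
  √(z.ofLp ⬝ᵥ (V⁻¹).mulVec z.ofLp)

open scoped MatrixOrder in
/-- The positive semidefinite square root `V^{-1/2}` of `V⁻¹`. -/
def invSqrt {d : ℕ} (V : Matrix (Fin d) (Fin d) ℝ) : Matrix (Fin d) (Fin d) ℝ :=
  CFC.sqrt V⁻¹

/-- The inputs of OSOCO: action set `X`, constraint limit `b`, regularization `λ`, tightening `κ`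
and confidence radii `β_t`. -/
structure Input (n d : ℕ) where
  X : Set (Vec d)
  b : Fin n → ℝ
  lam : ℝ
  kappa : ℝ
  beta : ℕ → ℝ

variable {n d : ℕ}

/-- The pessimistic set `{z ∈ X : Â z + β ‖z‖_{V⁻¹} 1 ≤ b - κ 1}` of the phase that starts in round
`t₀`. -/
def pessSet (I : Input n d) (x : ℕ → Vec d) (y : ℕ → Vec n) (t₀ : ℕ) : Set (Vec d) :=
  {z ∈ I.X | ∀ i : Fin n, (estimate I.lam x y t₀).mulVec z.ofLp i +
    I.beta t₀ * invNorm (gram I.lam x t₀) z ≤ I.b i - I.kappa}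

/-- The optimistic set `{z ∈ X : Â z - β ‖z‖_{V⁻¹} 1 ≤ b - κ 1}` of the phase that starts in round
`t₀`. -/
def optSet (I : Input n d) (x : ℕ → Vec d) (y : ℕ → Vec n) (t₀ : ℕ) : Set (Vec d) :=
  {z ∈ I.X | ∀ i : Fin n, (estimate I.lam x y t₀).mulVec z.ofLp i -
    I.beta t₀ * invNorm (gram I.lam x t₀) z ≤ I.b i - I.kappa}

/-- Labels `(k, ξ)` with `k ∈ [d]` and a sign `ξ`. -/
abbrev Label (d : ℕ) : Type := Fin d × Bool

/-- The sign `ξ ∈ {-1, 1}` of a label. -/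
def Label.sign (m : Label d) : ℝ := if m.2 then 1 else -1

/-- The convex piece `{z ∈ X : Â z - √d β ξ (V^{-1/2})_k z 1 ≤ b - κ 1}` of the relaxed optimistic
set of the phase that starts in round `t₀`. -/
def optPiece (I : Input n d) (x : ℕ → Vec d) (y : ℕ → Vec n) (t₀ : ℕ) (m : Label d) :
    Set (Vec d) :=
  {z ∈ I.X | ∀ i : Fin n, (estimate I.lam x y t₀).mulVec z.ofLp i -
    √(d : ℝ) * I.beta t₀ * m.sign * (invSqrt (gram I.lam x t₀)).mulVec z.ofLp m.1 ≤
      I.b i - I.kappa}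

/-- The largest `μ ∈ [0, 1]` with `μ z ∈ P`. -/
def safeScale (P : Set (Vec d)) (z : Vec d) : ℝ :=
  sSup {μ : ℝ | μ ∈ Set.Icc (0 : ℝ) 1 ∧ μ • z ∈ P}

/-! ### HedgeDescent -/

/-- A nearest point of `K` to `z` (the Euclidean projection if `K` is nonempty, closed, convex). -/
def proj (K : Set (Vec d)) (z : Vec d) : Vec d :=
  Classical.epsilon fun w => w ∈ K ∧ ∀ v ∈ K, ‖z - w‖ ≤ ‖z - v‖

/-- Projected online gradient descent on `K` from `0`: the position in the `s`-th round (from `0`)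
of a game with gradient fields `gf 0, gf 1, …` and step sizes `eta 0, eta 1, …`. -/
def ogd (K : Set (Vec d)) (eta : ℕ → ℝ) (gf : ℕ → Vec d → Vec d) : ℕ → Vec d
  | 0 => 0
  | s + 1 => proj K (ogd K eta gf s - eta s • gf s (ogd K eta gf s))

/-- The Hedge distribution over experts in the `s`-th round, with learning rates `zeta` and with
`loss r m` the loss of expert `m` in round `r`:
`p_s(m) ∝ exp (- zeta_s ∑_{r < s} loss_r(m))`. -/
def hedge {M : Type} [Fintype M] (zeta : ℕ → ℝ) (loss : ℕ → M → ℝ) (s : ℕ) (m : M) : ℝ :=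
  Real.exp (-zeta s * ∑ r ∈ Finset.range s, loss r m) /
    ∑ m' : M, Real.exp (-zeta s * ∑ r ∈ Finset.range s, loss r m')

/-- The step size `D / (G √s)` of gradient descent in the `s`-th round counted from `1`. -/
def etaStep (D G : ℝ) (s : ℕ) : ℝ := D / (G * √((s : ℝ) + 1))

/-- The learning rate `√(4 log M) / (G D √s)` of Hedge in the `s`-th round counted from `1`. -/
def zetaStep (D G : ℝ) (M : ℕ) (s : ℕ) : ℝ := √(4 * Real.log M) / (G * D * √((s : ℝ) + 1))

/-- Position in round `t` of HedgeDescent's expert `m` (restarted at the start of the phase). -/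
def expertPos (I : Input n d) (D G : ℝ) (gf : ℕ → Vec d → Vec d) (x : ℕ → Vec d) (y : ℕ → Vec n)
    (t : ℕ) (m : Label d) : Vec d :=
  let t₀ := phaseStart I.lam x t
  ogd (optPiece I x y t₀ m) (etaStep D G) (fun s => gf (t₀ + s)) (t - t₀)

/-- Distribution in round `t` of HedgeDescent over its `M = 2d` experts (restarted at the start of
the phase). -/
def expertProb (I : Input n d) (D G : ℝ) (f : ℕ → Vec d → ℝ) (gf : ℕ → Vec d → Vec d)
    (x : ℕ → Vec d) (y : ℕ → Vec n) (t : ℕ) (m : Label d) : ℝ :=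
  let t₀ := phaseStart I.lam x t
  hedge (zetaStep D G (2 * d))
    (fun s m' => f (t₀ + s)
      (ogd (optPiece I x y t₀ m') (etaStep D G) (fun r => gf (t₀ + r)) s)) (t - t₀) m

/-! ### Stochastic linear constraints -/

/-- `g(x) = A x - b`, where `a i` is the `i`-th row of `A`. -/
def constr (a : Fin n → Vec d) (b : Vec n) (x : Vec d) : Vec n :=
  WithLp.toLp 2 fun i => inner ℝ (a i) x - b i

variable {Ω : Type*} [mΩ : MeasurableSpace Ω]

/-- The mean constraint function `ḡ(x) = 𝔼[g_t(x)]` (the same for all rounds `t`). -/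
def meanConstr (μ : Measure Ω) (a : ℕ → Ω → Fin n → Vec d) (b : ℕ → Ω → Vec n) (x : Vec d)
    (i : Fin n) : ℝ :=
  ∫ ω, constr (a 0 ω) (b 0 ω) x i ∂μ

/-- The problem: convex compact action set of radius `D / 2` containing the origin, adaptively
chosen costs with gradients bounded by `G`, and i.i.d. stochastic linear constraints.

`ℱ t` is the information available before round `t`: it contains the past constraints and the past
random draws `draw s` of the player. The adversary chooses `f t` from `ℱ t`, simultaneously with the
player's draw in round `t`; the constraint of round `t` is independent of both. -/
structure IsProblem {Z : Type*} [MeasurableSpace Z] (μ : Measure Ω) (ℱ : Filtration ℕ mΩ) (T : ℕ)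
    (D G Gg F : ℝ) (X : Set (Vec d)) (f : ℕ → Ω → Vec d → ℝ)
    (a : ℕ → Ω → Fin n → Vec d) (b : ℕ → Ω → Vec n) (draw : ℕ → Ω → Z) : Prop where
  convex : Convex ℝ X
  closed : IsClosed X
  norm_le : ∀ x ∈ X, ‖x‖ ≤ D / 2
  zero_mem : (0 : Vec d) ∈ X
  cost : ∀ t < T, ∀ ω, IsCost X G (f t ω)
  cost_measurable : ∀ t < T,
    @Measurable (Ω × X) ℝ ((ℱ t).prod inferInstance) _ fun p => f t p.1 p.2
  constr_past : ∀ t < T, Measurable[ℱ (t + 1)] fun ω => (a t ω, b t ω)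
  draw_past : ∀ t < T, Measurable[ℱ (t + 1)] (draw t)
  indep : ∀ t < T, Indep (MeasurableSpace.comap (fun ω => (a t ω, b t ω)) inferInstance)
    (ℱ t ⊔ MeasurableSpace.comap (draw t) inferInstance) μ
  identDistrib : ∀ t < T,
    IdentDistrib (fun ω => (a t ω, b t ω)) (fun ω => (a 0 ω, b 0 ω)) μ μ
  /-- the `i`-th row of `A_t` is the gradient of the `i`-th component of `g_t` -/
  grad_le : ∀ t < T, ∀ᵐ ω ∂μ, ∀ i, ‖a t ω i‖ ≤ Gg
  value_le : ∀ t < T, ∀ᵐ ω ∂μ, ‖constr (a t ω) (b t ω) 0‖ ≤ F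
  slater : ∀ i, meanConstr μ a b 0 i < 0

/-- The constraint limit `b = 𝔼[b_t] = -ḡ(0)`, known to the player. -/
def limit (μ : Measure Ω) (a : ℕ → Ω → Fin n → Vec d) (b : ℕ → Ω → Vec n) (i : Fin n) : ℝ :=
  -meanConstr μ a b 0 i

/-- The bandit feedback given to OSOCO: the observed value `g_t(x_t)`, shifted by the known value
`ḡ(0)`, that is `y_t = g_t(x_t) - ḡ(0) = A x_t + noise` with `A = 𝔼[A_t]`. -/
def feedback (μ : Measure Ω) (a : ℕ → Ω → Fin n → Vec d) (b : ℕ → Ω → Vec n) (x : ℕ → Ω → Vec d)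
    (t : ℕ) (ω : Ω) : Vec n :=
  constr (a t ω) (b t ω) (x t ω) + WithLp.toLp 2 (limit μ a b)

/-- The inputs given to OSOCO, with `S = G_g`, `ρ = (G_g D + 4 F) / 2`, `b_min = min_i b_i`,
`λ = max(1, D²)`, `κ = b_min / T`, `δ = min(1/2, b_min / (2 S D T))` and
`β_t = ρ √(d log ((1 + (t - 1) D² / λ) / (δ / n))) + √λ S` in the `t`-th round counted from `1`. -/
def params (X : Set (Vec d)) (b : Fin n → ℝ) (D Gg F : ℝ) (T : ℕ) : Input n d where
  X := X
  b := b
  lam := max 1 (D ^ 2)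
  kappa := (⨅ i, b i) / T
  beta t :=
    let lam : ℝ := max 1 (D ^ 2)
    let δ : ℝ := min (1 / 2) ((⨅ i, b i) / (2 * Gg * D * T))
    let ρ : ℝ := (Gg * D + 4 * F) / 2
    ρ * √(d * Real.log ((1 + t * D ^ 2 / lam) / (δ / n))) + √lam * Gg

/-- `x` is the sequence of actions played by OSOCO with online algorithm `𝒜`, the actions `xt t`
being those sampled by `𝒜`: given the past, `xt t` has the distribution that `𝒜`, restarted at the
start of the phase with the optimistic set of the phase as action set, returns from its history in
the phase; and `x t` is `xt t` scaled into the pessimistic set of the phase. -/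
structure IsRun (μ : Measure Ω) (ℱ : Filtration ℕ mΩ) (T : ℕ) (I : Input n d) (𝒜 : OnlineAlg d)
    (f : ℕ → Ω → Vec d → ℝ) (xt x : ℕ → Ω → Vec d) (y : ℕ → Ω → Vec n) : Prop where
  sample : ∀ t < T, ∀ B : Set (Vec d), MeasurableSet B →
    μ[(xt t ⁻¹' B).indicator (fun _ => (1 : ℝ)) | ℱ t] =ᵐ[μ] fun ω =>
      let t₀ := phaseStart I.lam (fun s => x s ω) t
      (𝒜 (optSet I (fun s => x s ω) (fun s => y s ω) t₀)
        (history (fun s => xt (t₀ + s) ω) (fun s => f (t₀ + s) ω) (t - t₀))).real B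
  play : ∀ t < T, ∀ ω,
    x t ω = safeScale (pessSet I (fun s => x s ω) (fun s => y s ω)
      (phaseStart I.lam (fun s => x s ω) t)) (xt t ω) • xt t ω
  x_measurable : ∀ t < T, Measurable[ℱ t ⊔ MeasurableSpace.comap (xt t) inferInstance] (x t)

/-- `x` is the sequence of actions played by the efficient variant of OSOCO, in which the optimistic
set is relaxed to a union of `2d` convex pieces and HedgeDescent is the online algorithm: given the
past, the expert `idx t` is drawn from the Hedge distribution, and `x t` is the position of this
expert scaled into the pessimistic set. `gf t` is the gradient of `f t`. -/
structure IsEfficientRun (μ : Measure Ω) (ℱ : Filtration ℕ mΩ) (T : ℕ) (I : Input n d) (D G : ℝ)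
    (f : ℕ → Ω → Vec d → ℝ) (gf : ℕ → Ω → Vec d → Vec d) (idx : ℕ → Ω → Label d)
    (x : ℕ → Ω → Vec d) (y : ℕ → Ω → Vec n) : Prop where
  grad : ∀ t < T, ∀ ω, ∀ z ∈ I.X,
    HasGradientWithinAt (f t ω) (gf t ω z) I.X z ∧ ‖gf t ω z‖ ≤ G
  expert_measurable : ∀ t < T, ∀ m : Label d, Measurable[ℱ t] fun ω =>
    expertPos I D G (fun s => gf s ω) (fun s => x s ω) (fun s => y s ω) t m
  sample : ∀ t < T, ∀ m : Label d,
    μ[(idx t ⁻¹' {m}).indicator (fun _ => (1 : ℝ)) | ℱ t] =ᵐ[μ] fun ω =>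
      expertProb I D G (fun s => f s ω) (fun s => gf s ω) (fun s => x s ω) (fun s => y s ω) t m
  play : ∀ t < T, ∀ ω,
    let xt : Vec d :=
      expertPos I D G (fun s => gf s ω) (fun s => x s ω) (fun s => y s ω) t (idx t ω)
    x t ω = safeScale (pessSet I (fun s => x s ω) (fun s => y s ω)
      (phaseStart I.lam (fun s => x s ω) t)) xt • xt
  x_measurable : ∀ t < T, Measurable[ℱ t ⊔ MeasurableSpace.comap (idx t) inferInstance] (x t)

/-- The regret `∑_t f_t(x_t) - min {∑_t f_t(z) : z ∈ X, ḡ(z) ≤ 0}` over `T` rounds. -/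
def regret (μ : Measure Ω) (T : ℕ) (X : Set (Vec d)) (f : ℕ → Ω → Vec d → ℝ)
    (a : ℕ → Ω → Fin n → Vec d) (b : ℕ → Ω → Vec n) (x : ℕ → Ω → Vec d) (ω : Ω) : ℝ :=
  ∑ t ∈ Finset.range T, f t ω (x t ω) -
    sInf ((fun z => ∑ t ∈ Finset.range T, f t ω z) '' {z ∈ X | ∀ i, meanConstr μ a b z i ≤ 0})

/-- No expected violation: `𝔼[g_t(x_t)] ≤ 0`, componentwise, in all rounds. -/
def NoExpectedViolation (μ : Measure Ω) (T : ℕ) (a : ℕ → Ω → Fin n → Vec d) (b : ℕ → Ω → Vec n)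
    (x : ℕ → Ω → Vec d) : Prop :=
  ∀ t < T, ∀ i, Integrable (fun ω => constr (a t ω) (b t ω) (x t ω) i) μ ∧
    ∫ ω, constr (a t ω) (b t ω) (x t ω) i ∂μ ≤ 0

end

end OSOCO

namespace OSOCO

open Matrix MeasureTheory ProbabilityTheory

variable {n d : ℕ}

/-! ### Inverse quadratic forms and rank-one updates -/

/-! The shifted feedback is a linear regression: each coordinate of `y_s` is `⟨θ, x_s⟩` plus
bounded, hence sub-Gaussian, noise, where `θ` is a row of the mean matrix. For every row, `exp(‖∑
e_s x_s‖²_{V⁻¹} / 2) / √(det V / λ^d)` with normalized noise `e_s` is a supermartingale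
(`setLIntegral_mixture_le`). Its one-step factor is a one-dimensional Gaussian average of `exp (e g
- g² / 2)`, so no integral over `ℝᵈ` is needed. Ville's inequality and a union bound over the rows
give `exists_confidence`: outside an event of probability at most `δ`, every estimate is within `β_t
‖z‖_{V_t⁻¹}` of the truth, for all rounds and all `z`.

Safety. The played point is in the pessimistic set, so its mean constraint value is at most `-κ` on
the good event. On the failure event it exceeds `-κ` by at most `G_g D / 2`, and `δ` is small enough
for `κ` to pay for this. Independence of the round's constraint from the action replaces `g_t(x_t)`
by its mean function at `x_t` (`noExpectedViolation`).

Regret. With `x̃_t` the proposal and `ℓ_t` its conditional expected cost relative to `f_t(0)`, the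
regret against `u` is the sum of `f_t(x_t) - f_t(x̃_t)`, of `f_t(x̃_t) - f_t(0) - ℓ_t`, and of `ℓ_t
- (f_t(u) - f_t(0))`. Subtracting `f_t(0)` matters because only differences of costs are bounded.
The three sums are treated as follows. The first is the price of scaling. By `one_sub_safeScale_le`
it is at most a multiple of `β ‖x_t‖_{V̄⁻¹}`, with the norm of the played point; within a phase the
determinant at most doubles, so the frozen norm is comparable to the current one and the elliptic
potential lemma bounds the sum (`sum_cost_play_sub_le`). The second has mean zero. The third is the
regret of the online algorithm (`sum_loss_sub_le`). On the good event `(1 - 1/T) u` lies in all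
optimistic sets, since shrinking by `1/T` makes up for the tightening `κ`. The number of phases is
logarithmic in the determinant, and Cauchy–Schwarz adds up the phase regrets (`sum_le_of_phase_le`).

In the efficient variant the Euclidean norm of `V^{-1/2} z` is at most `√d` times its largest
coordinate in absolute value. Hence the convex pieces cover the optimistic set, while each satisfies
the optimistic constraints relaxed by the factor `θ = √d`. Regret against the union of the pieces is
Hedge regret against one expert plus gradient descent regret of that expert (`hedgeDescent_regret`).
-/

/-- The bilinear form `uᵀ V⁻¹ v`. -/
noncomputable def invForm (V : Matrix (Fin d) (Fin d) ℝ) (u v : Fin d → ℝ) : ℝ := u ⬝ᵥ V⁻¹ *ᵥ v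

lemma invForm_add_left (V : Matrix (Fin d) (Fin d) ℝ) (u u' v : Fin d → ℝ) :
    invForm V (u + u') v = invForm V u v + invForm V u' v := by
  simp [invForm, add_dotProduct]

lemma invForm_add_right (V : Matrix (Fin d) (Fin d) ℝ) (u v v' : Fin d → ℝ) :
    invForm V u (v + v') = invForm V u v + invForm V u v' := by
  simp [invForm, mulVec_add, dotProduct_add]

lemma invForm_smul_left (V : Matrix (Fin d) (Fin d) ℝ) (c : ℝ) (u v : Fin d → ℝ) :
    invForm V (c • u) v = c * invForm V u v := by
  simp [invForm]

lemma invForm_smul_right (V : Matrix (Fin d) (Fin d) ℝ) (c : ℝ) (u v : Fin d → ℝ) :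
    invForm V u (c • v) = c * invForm V u v := by
  simp [invForm, mulVec_smul]

lemma _root_.Matrix.PosDef.transpose_inv_eq {V : Matrix (Fin d) (Fin d) ℝ} (hV : V.PosDef) :
    (V⁻¹)ᵀ = V⁻¹ := by
  have h := hV.inv.isHermitian.eq
  rwa [conjTranspose_eq_transpose_of_trivial] at h

lemma invForm_comm {V : Matrix (Fin d) (Fin d) ℝ} (hV : V.PosDef) (u v : Fin d → ℝ) :
    invForm V u v = invForm V v u := by
  unfold invForm
  rw [dotProduct_mulVec, ← mulVec_transpose, hV.transpose_inv_eq, dotProduct_comm]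

lemma invForm_self_nonneg {V : Matrix (Fin d) (Fin d) ℝ} (hV : V.PosDef) (u : Fin d → ℝ) :
    0 ≤ invForm V u u := by
  simpa [invForm] using hV.inv.posSemidef.dotProduct_mulVec_nonneg u

lemma invForm_self_pos {V : Matrix (Fin d) (Fin d) ℝ} (hV : V.PosDef) {u : Fin d → ℝ}
    (hu : u ≠ 0) : 0 < invForm V u u := by
  simpa [invForm] using hV.inv.dotProduct_mulVec_pos hu

/-- Cauchy–Schwarz, from the discriminant of the nonnegative quadratic `c ↦ invForm V (u + c • v) (u
+ c • v)`. -/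
lemma invForm_sq_le {V : Matrix (Fin d) (Fin d) ℝ} (hV : V.PosDef) (u v : Fin d → ℝ) :
    invForm V u v ^ 2 ≤ invForm V u u * invForm V v v := by
  have key : ∀ c : ℝ, 0 ≤ invForm V v v * (c * c) + 2 * invForm V u v * c + invForm V u u := by
    intro c
    have h := invForm_self_nonneg hV (u + c • v)
    simp only [invForm_add_left, invForm_add_right, invForm_smul_left, invForm_smul_right] at h
    rw [invForm_comm hV v u] at h
    linarith
  have := discrim_le_zero key
  unfold discrim at this
  nlinarith

lemma det_ne_zero_of_posDef {V : Matrix (Fin d) (Fin d) ℝ} (hV : V.PosDef) : IsUnit V.det :=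
  hV.det_pos.ne'.isUnit

lemma posDef_add_vecMulVec {V : Matrix (Fin d) (Fin d) ℝ} (hV : V.PosDef) (x : Fin d → ℝ) :
    (V + vecMulVec x x).PosDef := by
  have h := posSemidef_vecMulVec_self_star x
  simp only [star_trivial] at h
  exact hV.add_posSemidef h

/-- The matrix determinant lemma. -/
lemma det_add_vecMulVec {V : Matrix (Fin d) (Fin d) ℝ} (hV : V.PosDef) (x : Fin d → ℝ) :
    (V + vecMulVec x x).det = V.det * (1 + invForm V x x) := by
  rw [vecMulVec_eq Unit, det_add_replicateCol_mul_replicateRow (det_ne_zero_of_posDef hV)]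
  rw [det_unique (n := Unit)]
  congr 1
  rw [Matrix.add_apply, Matrix.one_apply_eq, Matrix.mul_assoc]
  congr 1

/-- The Sherman–Morrison formula, checked by multiplying out. -/
lemma inv_add_vecMulVec {V : Matrix (Fin d) (Fin d) ℝ} (hV : V.PosDef) (x : Fin d → ℝ) :
    (V + vecMulVec x x)⁻¹ =
      V⁻¹ - (1 + invForm V x x)⁻¹ • vecMulVec (V⁻¹ *ᵥ x) (V⁻¹ *ᵥ x) := by
  have hq : 1 + invForm V x x ≠ 0 := by linarith [invForm_self_nonneg hV x] |> ne_of_gt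
  apply Matrix.inv_eq_right_inv
  rw [Matrix.mul_sub, Matrix.add_mul, Matrix.mul_smul, Matrix.add_mul, mul_vecMulVec, mulVec_mulVec,
    mul_nonsing_inv _ (det_ne_zero_of_posDef hV), one_mulVec, vecMulVec_mul, ← mulVec_transpose,
    hV.transpose_inv_eq, vecMulVec_mul_vecMulVec, vecMulVec_smul]
  have : x ⬝ᵥ V⁻¹ *ᵥ x = invForm V x x := rfl
  have h2 (A : Matrix (Fin d) (Fin d) ℝ) : A + invForm V x x • A = (1 + invForm V x x) • A := by
    rw [add_smul, one_smul]
  rw [this, h2, smul_smul, inv_mul_cancel₀ hq, one_smul, add_sub_cancel_right]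

lemma invForm_add_vecMulVec {V : Matrix (Fin d) (Fin d) ℝ} (hV : V.PosDef) (x u v : Fin d → ℝ) :
    invForm (V + vecMulVec x x) u v =
      invForm V u v - invForm V u x * invForm V x v / (1 + invForm V x x) := by
  rw [invForm, inv_add_vecMulVec hV, sub_mulVec, dotProduct_sub, smul_mulVec,
    vecMulVec_mulVec, dotProduct_smul, op_smul_eq_smul, dotProduct_smul]
  have h : V⁻¹ *ᵥ x ⬝ᵥ v = invForm V x v := by
    rw [invForm_comm hV x v, invForm, dotProduct_comm]
  rw [h]
  simp only [invForm, smul_eq_mul]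
  ring

/-! ### The regularized Gram matrices -/

section Gram

variable {lam : ℝ} {x : ℕ → Vec d}

lemma gram_zero : gram lam x 0 = lam • 1 := by simp [gram]

lemma gram_succ (t : ℕ) :
    gram lam x (t + 1) = gram lam x t + vecMulVec (x t).ofLp (x t).ofLp := by
  simp [gram, Finset.sum_range_succ, add_assoc]

lemma gram_posDef (hlam : 0 < lam) (t : ℕ) : (gram lam x t).PosDef := by
  induction t with
  | zero => rw [gram_zero]; exact Matrix.PosDef.one.smul hlam
  | succ t ih => rw [gram_succ]; exact posDef_add_vecMulVec ih _

lemma det_gram_zero : (gram lam x 0).det = lam ^ d := by simp [gram_zero]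

lemma det_gram_succ (hlam : 0 < lam) (t : ℕ) :
    (gram lam x (t + 1)).det =
      (gram lam x t).det * (1 + invForm (gram lam x t) (x t).ofLp (x t).ofLp) := by
  rw [gram_succ, det_add_vecMulVec (gram_posDef hlam t)]

lemma det_gram_mono (hlam : 0 < lam) : Monotone fun t => (gram lam x t).det := by
  refine monotone_nat_of_le_succ fun t => ?_
  rw [det_gram_succ hlam]
  exact le_mul_of_one_le_right (gram_posDef hlam t).det_pos.le
    (by linarith [invForm_self_nonneg (gram_posDef (x := x) hlam t) (x t).ofLp])

/-- A rank-one update by `x` multiplies the determinant by `1 + q` and lowers the form by `r² / (1 +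
q)`, where `q = ‖x‖²_{V⁻¹}` and `r = zᵀ V⁻¹ x`. The product therefore changes by `det V · (q
‖z‖²_{V⁻¹} - r²)`, which is nonnegative by Cauchy–Schwarz. Hence the form can shrink only by the
factor by which the determinant grows. -/
lemma det_mul_invForm_mono (hlam : 0 < lam) (z : Fin d → ℝ) :
    Monotone fun t => (gram lam x t).det * invForm (gram lam x t) z z := by
  refine monotone_nat_of_le_succ fun t => ?_
  have hV := gram_posDef (x := x) hlam t
  have h1 := invForm_self_nonneg hV (x t).ofLp
  have h2 := invForm_sq_le hV z (x t).ofLp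
  rw [det_gram_succ hlam, gram_succ, invForm_add_vecMulVec hV, invForm_comm hV (x t).ofLp z,
    mul_assoc]
  refine mul_le_mul_of_nonneg_left ?_ hV.det_pos.le
  have h3 : (0 : ℝ) < 1 + invForm (gram lam x t) (x t).ofLp (x t).ofLp := by linarith
  rw [mul_sub, mul_div_cancel₀ _ h3.ne']
  nlinarith

lemma invForm_gram_anti (hlam : 0 < lam) (z : Fin d → ℝ) :
    Antitone fun t => invForm (gram lam x t) z z := by
  refine antitone_nat_of_succ_le fun t => ?_
  have hV := gram_posDef (x := x) hlam t
  have h1 := invForm_self_nonneg hV (x t).ofLp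
  rw [gram_succ, invForm_add_vecMulVec hV, invForm_comm hV (x t).ofLp z]
  have : 0 ≤ invForm (gram lam x t) z (x t).ofLp * invForm (gram lam x t) z (x t).ofLp /
      (1 + invForm (gram lam x t) (x t).ofLp (x t).ofLp) := by
    apply div_nonneg (mul_self_nonneg _); linarith
  linarith

lemma ofLp_dotProduct_self (z : Vec d) : z.ofLp ⬝ᵥ z.ofLp = ‖z‖ ^ 2 := by
  rw [EuclideanSpace.norm_sq_eq]; simp [dotProduct, sq]

lemma ofLp_dotProduct (z w : Vec d) : z.ofLp ⬝ᵥ w.ofLp = inner ℝ z w := by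
  simp [PiLp.inner_apply, dotProduct, mul_comm]

lemma invForm_gram_le (hlam : 0 < lam) (t : ℕ) (z : Vec d) :
    invForm (gram lam x t) z.ofLp z.ofLp ≤ ‖z‖ ^ 2 / lam := by
  refine (invForm_gram_anti hlam _ (Nat.zero_le t)).trans (le_of_eq ?_)
  have : (lam • (1 : Matrix (Fin d) (Fin d) ℝ))⁻¹ = lam⁻¹ • 1 := by
    apply Matrix.inv_eq_right_inv
    rw [smul_mul_smul_comm, mul_inv_cancel₀ hlam.ne', one_smul, Matrix.one_mul]
  simp only [gram_zero, invForm, this, smul_mulVec, one_mulVec, dotProduct_smul,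
    ofLp_dotProduct_self, smul_eq_mul]
  ring

lemma invNorm_eq (V : Matrix (Fin d) (Fin d) ℝ) (z : Vec d) :
    invNorm V z = √(invForm V z.ofLp z.ofLp) := rfl

lemma invNorm_nonneg (V : Matrix (Fin d) (Fin d) ℝ) (z : Vec d) : 0 ≤ invNorm V z :=
  Real.sqrt_nonneg _

lemma invNorm_smul (V : Matrix (Fin d) (Fin d) ℝ) {c : ℝ} (hc : 0 ≤ c) (z : Vec d) :
    invNorm V (c • z) = c * invNorm V z := by
  rw [invNorm_eq, invNorm_eq, WithLp.ofLp_smul, invForm_smul_left, invForm_smul_right, ← mul_assoc,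
    Real.sqrt_mul (mul_self_nonneg c), Real.sqrt_mul_self hc]

/-- The elliptic potential lemma. -/
lemma sum_invForm_le (hlam : 0 < lam) {T : ℕ} (hx : ∀ t < T, ‖x t‖ ^ 2 ≤ lam) :
    ∑ t ∈ Finset.range T, invForm (gram lam x t) (x t).ofLp (x t).ofLp ≤
      2 * Real.log ((gram lam x T).det / lam ^ d) := by
  induction T with
  | zero => simp [det_gram_zero, div_self (pow_pos hlam d).ne']
  | succ T ih =>
    rw [Finset.sum_range_succ, det_gram_succ hlam]
    have hV := gram_posDef (x := x) hlam T
    set q := invForm (gram lam x T) (x T).ofLp (x T).ofLp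
    have hq0 : 0 ≤ q := invForm_self_nonneg hV _
    -- The norm bound serves to make `q ≤ 1`, the range in which `q ≤ 2 log (1 + q)` is proved
    -- below; the logarithms telescope to that of the determinant.
    have hq1 : q ≤ 1 := (invForm_gram_le hlam T (x T)).trans
      ((div_le_one hlam).2 (hx T (Nat.lt_succ_self T)))
    have hlog : q ≤ 2 * Real.log (1 + q) := by
      have h := Real.one_sub_inv_le_log_of_pos (show (0 : ℝ) < 1 + q by linarith)
      have h2 : q / 2 ≤ 1 - (1 + q)⁻¹ := by
        have h3 : 1 - (1 + q)⁻¹ = q / (1 + q) := by field_simp; ring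
        rw [h3]
        exact div_le_div_of_nonneg_left hq0 (by linarith) (by linarith)
      linarith
    have h := ih fun t ht => hx t (ht.trans (Nat.lt_succ_self T))
    rw [mul_div_right_comm, Real.log_mul (div_pos hV.det_pos (pow_pos hlam d)).ne' (by linarith)]
    linarith

lemma dotProduct_gram_mulVec (t : ℕ) (z : Vec d) :
    z.ofLp ⬝ᵥ gram lam x t *ᵥ z.ofLp =
      lam * ‖z‖ ^ 2 + ∑ s ∈ Finset.range t, inner ℝ (x s) z ^ 2 := by
  induction t with
  | zero => simp [gram_zero, smul_mulVec, ofLp_dotProduct_self]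
  | succ t ih =>
    rw [gram_succ, add_mulVec, dotProduct_add, ih, Finset.sum_range_succ, vecMulVec_mulVec,
      op_smul_eq_smul, dotProduct_smul, ofLp_dotProduct, ofLp_dotProduct, real_inner_comm,
      smul_eq_mul]
    ring

/-- Each eigenvalue is the quadratic form at a unit eigenvector, which is at most `λ + t R²`. -/
lemma det_gram_le (hlam : 0 < lam) {R : ℝ} {t : ℕ} (hx : ∀ s < t, ‖x s‖ ≤ R) :
    (gram lam x t).det ≤ (lam + t * R ^ 2) ^ d := by
  have hV := gram_posDef (x := x) hlam t
  rw [hV.isHermitian.det_eq_prod_eigenvalues]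
  calc ∏ i, (hV.isHermitian.eigenvalues i : ℝ) ≤ ∏ _i : Fin d, (lam + t * R ^ 2) := by
        refine Finset.prod_le_prod (fun i _ => (hV.eigenvalues_pos i).le) fun i _ => ?_
        rw [hV.isHermitian.eigenvalues_eq]
        simp only [star_trivial, RCLike.re_to_real]
        rw [dotProduct_gram_mulVec, OrthonormalBasis.norm_eq_one]
        have : ∑ s ∈ Finset.range t, inner ℝ (x s) (hV.isHermitian.eigenvectorBasis i) ^ 2 ≤
            ∑ s ∈ Finset.range t, R ^ 2 := by
          refine Finset.sum_le_sum fun s hs => ?_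
          have h1 := abs_real_inner_le_norm (x s) (hV.isHermitian.eigenvectorBasis i)
          rw [OrthonormalBasis.norm_eq_one, mul_one] at h1
          exact sq_le_sq' (by linarith [neg_abs_le (inner ℝ (x s) (hV.isHermitian.eigenvectorBasis i)), hx s (Finset.mem_range.1 hs)]) (by linarith [le_abs_self (inner ℝ (x s) (hV.isHermitian.eigenvectorBasis i)), hx s (Finset.mem_range.1 hs)])
        simp only [Finset.sum_const, Finset.card_range, nsmul_eq_mul] at this
        linarith
    _ = _ := by simp

end Gram

/-! ### Phases -/

section Phases

variable {lam : ℝ} {x : ℕ → Vec d}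

lemma phaseStart_le (t : ℕ) : phaseStart lam x t ≤ t := by
  induction t with
  | zero => simp [phaseStart]
  | succ t ih =>
    rw [phaseStart]
    split_ifs
    · omega
    · exact le_rfl

lemma phaseStart_eq_of_mem {s t : ℕ} (h1 : phaseStart lam x t ≤ s) (h2 : s ≤ t) :
    phaseStart lam x s = phaseStart lam x t := by
  induction t with
  | zero => rw [Nat.le_zero.1 h2]
  | succ t ih =>
    rcases h2.lt_or_eq with h2 | rfl
    · by_cases h : (gram lam x (t + 1)).det ≤ 2 * (gram lam x (phaseStart lam x t)).det
      · rw [phaseStart, if_pos h] at h1 ⊢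
        exact ih h1 (by omega)
      · rw [phaseStart, if_neg h] at h1
        omega
    · rfl

lemma det_gram_le_two_mul (hlam : 0 < lam) (t : ℕ) :
    (gram lam x t).det ≤ 2 * (gram lam x (phaseStart lam x t)).det := by
  induction t with
  | zero => simp [phaseStart]; linarith [(gram_posDef (x := x) hlam 0).det_pos]
  | succ t ih =>
    rw [phaseStart]
    split_ifs with h
    · exact h
    · linarith [(gram_posDef (x := x) hlam (t + 1)).det_pos]

/-- The determinant more than doubles from one phase start to the next; this limits the number of
phases. -/
lemma two_mul_det_gram_lt {k t : ℕ} (h : phaseStart lam x t = k + 1) :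
    2 * (gram lam x (phaseStart lam x k)).det < (gram lam x (k + 1)).det := by
  have h1 : phaseStart lam x (k + 1) = k + 1 := by
    rw [phaseStart_eq_of_mem (t := t) h.le (h ▸ phaseStart_le t), h]
  by_contra! h2
  rw [phaseStart, if_pos h2] at h1
  have := phaseStart_le (lam := lam) (x := x) k
  omega

/-- By `det_mul_invForm_mono` the price of freezing `V` at the start of the phase is the growth of
the determinant since then, at most a factor `2`. -/
lemma invForm_phase_le (hlam : 0 < lam) (t : ℕ) (z : Fin d → ℝ) :
    invForm (gram lam x (phaseStart lam x t)) z z ≤ 2 * invForm (gram lam x t) z z := by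
  have h1 := det_mul_invForm_mono (x := x) hlam z (phaseStart_le (lam := lam) (x := x) t)
  have h2 := det_gram_le_two_mul (x := x) hlam t
  have h3 := invForm_self_nonneg (gram_posDef (x := x) hlam t) z
  have h4 := (gram_posDef (x := x) hlam (phaseStart lam x t)).det_pos
  have h5 : (gram lam x (phaseStart lam x t)).det * invForm (gram lam x (phaseStart lam x t)) z z ≤
      (gram lam x (phaseStart lam x t)).det * (2 * invForm (gram lam x t) z z) :=
    h1.trans (by nlinarith)
  exact le_of_mul_le_mul_left h5 h4

/-- The logarithm of the relative determinant of the Gram matrix. -/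
noncomputable def logDet (lam : ℝ) (x : ℕ → Vec d) (t : ℕ) : ℝ :=
  Real.log ((gram lam x t).det / lam ^ d)

lemma one_le_det_div (hlam : 0 < lam) (t : ℕ) : 1 ≤ (gram lam x t).det / lam ^ d := by
  rw [le_div_iff₀ (pow_pos hlam d), one_mul, ← det_gram_zero (x := x)]
  exact det_gram_mono hlam (Nat.zero_le t)

lemma logDet_nonneg (hlam : 0 < lam) (t : ℕ) : 0 ≤ logDet lam x t :=
  Real.log_nonneg (one_le_det_div hlam t)

lemma logDet_mono (hlam : 0 < lam) : Monotone (logDet lam x) := fun s t hst =>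
  Real.log_le_log (by linarith [one_le_det_div (x := x) hlam s])
    (div_le_div_of_nonneg_right (det_gram_mono hlam hst) (pow_pos hlam d).le)

lemma logDet_le (hlam : 0 < lam) {R : ℝ} {t : ℕ} (hx : ∀ s < t, ‖x s‖ ≤ R) :
    logDet lam x t ≤ d * Real.log (1 + t * R ^ 2 / lam) := by
  rw [← Real.log_pow, logDet]
  refine Real.log_le_log (by linarith [one_le_det_div (x := x) hlam t]) ?_
  have : 1 + t * R ^ 2 / lam = (lam + t * R ^ 2) / lam := by field_simp
  rw [this, div_pow]
  exact div_le_div_of_nonneg_right (det_gram_le hlam hx) (pow_pos hlam d).le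

/-- Cauchy–Schwarz over the rounds. The constant `4` is a factor `2` for the frozen matrices times a
factor `2` from the elliptic potential lemma. -/
lemma sum_invNorm_phase_le (hlam : 0 < lam) {T : ℕ} (hx : ∀ t < T, ‖x t‖ ^ 2 ≤ lam) :
    ∑ t ∈ Finset.range T, invNorm (gram lam x (phaseStart lam x t)) (x t) ≤
      √(T * (4 * logDet lam x T)) := by
  refine Real.le_sqrt_of_sq_le ?_
  calc (∑ t ∈ Finset.range T, invNorm (gram lam x (phaseStart lam x t)) (x t)) ^ 2
      ≤ T * ∑ t ∈ Finset.range T, invNorm (gram lam x (phaseStart lam x t)) (x t) ^ 2 := by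
        simpa using sq_sum_le_card_mul_sum_sq (s := Finset.range T)
          (f := fun t => invNorm (gram lam x (phaseStart lam x t)) (x t))
    _ ≤ T * ∑ t ∈ Finset.range T, 2 * invForm (gram lam x t) (x t).ofLp (x t).ofLp := by
        gcongr with t
        rw [invNorm_eq, Real.sq_sqrt (invForm_self_nonneg (gram_posDef hlam _) _)]
        exact invForm_phase_le hlam t _
    _ ≤ T * (4 * logDet lam x T) := by
        rw [← Finset.mul_sum]
        have := sum_invForm_le hlam hx
        refine mul_le_mul_of_nonneg_left ?_ (Nat.cast_nonneg T)
        unfold logDet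
        linarith

/-- If the regret within every phase is at most `C` times the square root of the number of rounds,
then the total regret is at most `C` times the square root of the number of phases times the number
of rounds. -/
lemma sum_le_of_phase_le (hlam : 0 < lam) {C : ℝ} (hC : 0 ≤ C) {T : ℕ} {r : ℕ → ℝ}
    (hr : ∀ t < T, ∑ s ∈ Finset.Ico (phaseStart lam x t) (t + 1), r s ≤
      C * √((t + 1 - phaseStart lam x t : ℕ) : ℝ)) :
    ∑ s ∈ Finset.range T, r s ≤ C * √((1 + logDet lam x T / Real.log 2) * T) := by
  have hlog2 : 0 < Real.log 2 := Real.log_pos (by norm_num)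
  -- At the start of a phase, `P` bounds the number of phases so far: every restart raises `logDet /
  -- log 2` by at least one.
  set P : ℕ → ℝ := fun t => 1 + logDet lam x t / Real.log 2 with hP
  have hP1 : ∀ t, 1 ≤ P t := fun t => by
    have := div_nonneg (logDet_nonneg (x := x) hlam t) hlog2.le
    simp only [hP]; linarith
  -- Strong induction that jumps from `t` to `k`, the last round of the preceding phase.
  have key : ∀ t < T, ∑ s ∈ Finset.range (t + 1), r s ≤
      C * √(P (phaseStart lam x t) * ((t + 1 : ℕ) : ℝ)) := by
    intro t
    induction t using Nat.strong_induction_on with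
    | _ t ih =>
      intro ht
      have hph := hr t ht
      have hle := phaseStart_le (lam := lam) (x := x) t
      rcases h0 : phaseStart lam x t with _ | k
      · rw [h0] at hph
        rw [Finset.range_eq_Ico]
        refine hph.trans ?_
        gcongr
        simp only [Nat.sub_zero]
        exact le_mul_of_one_le_left (Nat.cast_nonneg _) (hP1 _)
      · have hk : k < t := by omega
        have h1 := ih k hk (hk.trans ht)
        have hstep : P (phaseStart lam x k) + 1 ≤ P (k + 1) := by
          have h2 := two_mul_det_gram_lt h0
          have h3 : logDet lam x (phaseStart lam x k) + Real.log 2 ≤ logDet lam x (k + 1) := by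
            unfold logDet
            rw [← Real.log_mul (by linarith [one_le_det_div (x := x) hlam (phaseStart lam x k)])
              (by norm_num)]
            refine Real.log_le_log
              (by linarith [one_le_det_div (x := x) hlam (phaseStart lam x k)]) ?_
            rw [div_mul_eq_mul_div]
            gcongr
            linarith
          have h4 := div_le_div_of_nonneg_right h3 hlog2.le
          rw [add_div, div_self hlog2.ne'] at h4
          simp only [hP]; linarith
        rw [h0] at hph hle
        rw [← Finset.sum_range_add_sum_Ico _ (show k + 1 ≤ t + 1 by omega)]
        calc _ ≤ C * √(P (phaseStart lam x k) * ((k + 1 : ℕ) : ℝ)) +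
              C * √((t + 1 - (k + 1) : ℕ) : ℝ) := add_le_add h1 hph
          _ = C * (√(P (phaseStart lam x k) * ((k + 1 : ℕ) : ℝ)) +
              √((t + 1 - (k + 1) : ℕ) : ℝ)) := by ring
          _ ≤ _ := by
            gcongr
            set p := P (phaseStart lam x k)
            have hp : 1 ≤ p := hP1 _
            set u : ℝ := ((k + 1 : ℕ) : ℝ) with hu
            set v : ℝ := ((t + 1 - (k + 1) : ℕ) : ℝ) with hv
            have hu0 : 0 ≤ u := Nat.cast_nonneg _
            have hv0 : 0 ≤ v := Nat.cast_nonneg _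
            have huv : ((t + 1 : ℕ) : ℝ) = u + v := by
              rw [hu, hv, ← Nat.cast_add]; congr 1; omega
            rw [huv]
            -- This is `√(p u) + √v ≤ √((p + 1) (u + v))`; the cross term is regrouped as `√(p v)
            -- √u` and bounded by the arithmetic mean.
            refine Real.le_sqrt_of_sq_le ?_
            have e1 := Real.sq_sqrt (show 0 ≤ p * u by positivity)
            have e2 := Real.sq_sqrt hv0
            have e3 : √(p * u) * √v ≤ (p * v + u) / 2 := by
              have e4 : √(p * u) * √v = √(p * v) * √u := by
                rw [← Real.sqrt_mul (by positivity), ← Real.sqrt_mul (by positivity)]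
                congr 1; ring
              have e5 := Real.sq_sqrt (show 0 ≤ p * v by positivity)
              have e6 := Real.sq_sqrt hu0
              nlinarith [sq_nonneg (√(p * v) - √u)]
            have e7 : (p + 1) * (u + v) ≤ P (k + 1) * (u + v) := by gcongr
            nlinarith
  rcases T with _ | T
  · simp
  · refine (key T (Nat.lt_succ_self T)).trans ?_
    gcongr
    simp only [hP]
    gcongr
    exact logDet_mono hlam ((phaseStart_le T).trans (Nat.le_succ T))

end Phases

/-! ### Scaling into the pessimistic set -/

section Scale

lemma safeScale_mem {P : Set (Vec d)} (hP : IsClosed P) (h0 : (0 : Vec d) ∈ P) (z : Vec d) :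
    safeScale P z ∈ Set.Icc (0 : ℝ) 1 ∧ safeScale P z • z ∈ P := by
  have hc : IsCompact {μ : ℝ | μ ∈ Set.Icc (0 : ℝ) 1 ∧ μ • z ∈ P} :=
    isCompact_Icc.inter_right (hP.preimage (by fun_prop : Continuous fun μ : ℝ => μ • z))
  exact hc.sSup_mem ⟨0, ⟨by simp, by simpa using h0⟩⟩

lemma le_safeScale {P : Set (Vec d)} {z : Vec d} {c : ℝ} (hc : c ∈ Set.Icc (0 : ℝ) 1)
    (hz : c • z ∈ P) : c ≤ safeScale P z :=
  le_csSup ⟨1, fun _ h => h.1.2⟩ ⟨hc, hz⟩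

variable {I : Input n d} {x : ℕ → Vec d} {y : ℕ → Vec n} {t₀ : ℕ}

lemma continuous_invNorm (V : Matrix (Fin d) (Fin d) ℝ) : Continuous (invNorm V) := by
  unfold invNorm
  have : Continuous fun z : Vec d => z.ofLp ⬝ᵥ V⁻¹ *ᵥ z.ofLp :=
    (PiLp.continuous_ofLp 2 _).dotProduct
      (continuous_const.matrix_mulVec (PiLp.continuous_ofLp 2 _))
  exact this.sqrt

lemma continuous_mulVec_ofLp (A : Matrix (Fin n) (Fin d) ℝ) (i : Fin n) :
    Continuous fun z : Vec d => (A *ᵥ z.ofLp) i :=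
  (continuous_apply i).comp (continuous_const.matrix_mulVec (PiLp.continuous_ofLp 2 _))

lemma isClosed_sep_forall_le {X : Set (Vec d)} (hX : IsClosed X) {φ : Fin n → Vec d → ℝ}
    {c : Fin n → ℝ} (hφ : ∀ i, Continuous (φ i)) : IsClosed {z ∈ X | ∀ i, φ i z ≤ c i} := by
  have h : {z ∈ X | ∀ i, φ i z ≤ c i} = X ∩ ⋂ i, {z | φ i z ≤ c i} := by
    ext z; simp
  rw [h]
  exact hX.inter (isClosed_iInter fun i => isClosed_le (hφ i) continuous_const)

lemma isClosed_pessSet (hX : IsClosed I.X) : IsClosed (pessSet I x y t₀) :=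
  isClosed_sep_forall_le hX fun i => (continuous_mulVec_ofLp _ i).add
    (continuous_const.mul (continuous_invNorm _))

lemma isClosed_optSet (hX : IsClosed I.X) : IsClosed (optSet I x y t₀) :=
  isClosed_sep_forall_le hX fun i => (continuous_mulVec_ofLp _ i).sub
    (continuous_const.mul (continuous_invNorm _))

lemma isClosed_optPiece (hX : IsClosed I.X) (m : Label d) : IsClosed (optPiece I x y t₀ m) :=
  isClosed_sep_forall_le hX fun i => (continuous_mulVec_ofLp _ i).sub
    (continuous_const.mul (continuous_mulVec_ofLp _ m.1))

lemma convex_optPiece (hX : Convex ℝ I.X) (m : Label d) : Convex ℝ (optPiece I x y t₀ m) := by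
  rintro z ⟨hz, hz'⟩ w ⟨hw, hw'⟩ p q hp hq hpq
  refine ⟨hX hz hw hp hq hpq, fun i => ?_⟩
  have h1 := mul_le_mul_of_nonneg_left (hz' i) hp
  have h2 := mul_le_mul_of_nonneg_left (hw' i) hq
  simp only [WithLp.ofLp_add, WithLp.ofLp_smul, mulVec_add, mulVec_smul, Pi.add_apply,
    Pi.smul_apply, smul_eq_mul]
  have h3 : p * (I.b i - I.kappa) + q * (I.b i - I.kappa) = I.b i - I.kappa := by
    rw [← add_mul, hpq, one_mul]
  linarith

lemma invNorm_zero (V : Matrix (Fin d) (Fin d) ℝ) : invNorm V 0 = 0 := by simp [invNorm]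

lemma zero_mem_pessSet (hX : (0 : Vec d) ∈ I.X) (hb : ∀ i, I.kappa ≤ I.b i) :
    (0 : Vec d) ∈ pessSet I x y t₀ :=
  ⟨hX, fun i => by simpa [invNorm_zero] using hb i⟩

lemma zero_mem_optSet (hX : (0 : Vec d) ∈ I.X) (hb : ∀ i, I.kappa ≤ I.b i) :
    (0 : Vec d) ∈ optSet I x y t₀ :=
  ⟨hX, fun i => by simpa [invNorm_zero] using hb i⟩

lemma zero_mem_optPiece (hX : (0 : Vec d) ∈ I.X) (hb : ∀ i, I.kappa ≤ I.b i) (m : Label d) :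
    (0 : Vec d) ∈ optPiece I x y t₀ m :=
  ⟨hX, fun i => by simpa using hb i⟩

/-- A point that satisfies the optimistic constraints relaxed by a factor `θ` has to be scaled down
by little to satisfy the pessimistic constraints. -/
lemma one_sub_safeScale_le (hXc : Convex ℝ I.X) (hX0 : (0 : Vec d) ∈ I.X) (hXcl : IsClosed I.X)
    {θ c : ℝ} (hθ : 0 ≤ θ) (hβ : 0 ≤ I.beta t₀) (hc : 0 < c) (hb : ∀ i, c ≤ I.b i - I.kappa)
    {z : Vec d} (hz : z ∈ I.X)
    (hz' : ∀ i, (estimate I.lam x y t₀ *ᵥ z.ofLp) i -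
      θ * (I.beta t₀ * invNorm (gram I.lam x t₀) z) ≤ I.b i - I.kappa) :
    1 - safeScale (pessSet I x y t₀) z ≤ (1 + θ) * I.beta t₀ / c *
      invNorm (gram I.lam x t₀) (safeScale (pessSet I x y t₀) z • z) := by
  have hmem := safeScale_mem (isClosed_pessSet (x := x) (y := y) (t₀ := t₀) hXcl)
    (zero_mem_pessSet hX0 fun i => by linarith [hb i]) z
  rw [invNorm_smul _ hmem.1.1]
  set w := invNorm (gram I.lam x t₀) z
  have hw : 0 ≤ w := invNorm_nonneg _ _
  set γ := safeScale (pessSet I x y t₀) z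
  set k := (1 + θ) * I.beta t₀ * w with hk
  have hk0 : 0 ≤ k := by positivity
  have hck : 0 < c + k := by linarith
  -- Going from the relaxed optimistic constraint to the pessimistic one raises the left-hand side
  -- by at most `k`. Scaling by `c / (c + k)` repairs this, because `c (B + k) ≤ (c + k) B` for
  -- every slack `B ≥ c`.
  have hge : c / (c + k) ≤ γ := by
    have h01 : c / (c + k) ∈ Set.Icc (0 : ℝ) 1 :=
      ⟨by positivity, (div_le_one hck).2 (by linarith)⟩
    refine le_safeScale h01 ⟨?_, fun i => ?_⟩
    · have := hXc hX0 hz (show 0 ≤ 1 - c / (c + k) by linarith [h01.2]) h01.1 (by ring)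
      simpa using this
    · rw [invNorm_smul _ h01.1, WithLp.ofLp_smul, mulVec_smul, Pi.smul_apply, smul_eq_mul]
      have h1 : (estimate I.lam x y t₀ *ᵥ z.ofLp) i + I.beta t₀ * w ≤ (I.b i - I.kappa) + k := by
        have := hz' i
        rw [hk]; linarith
      calc _ = c / (c + k) * ((estimate I.lam x y t₀ *ᵥ z.ofLp) i + I.beta t₀ * w) := by ring
        _ ≤ c / (c + k) * ((I.b i - I.kappa) + k) := by gcongr
        _ ≤ I.b i - I.kappa := by
          rw [div_mul_eq_mul_div, div_le_iff₀ hck]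
          nlinarith [hb i]
  -- The bound `c / (c + k) ≤ γ` is the same as `1 - γ ≤ γ k / c`. The factor `γ` on the right turns
  -- the norm of the proposal into that of the scaled point, which is the one that enters the Gram
  -- matrix.
  have h2 : (1 + θ) * I.beta t₀ / c * (γ * w) = γ * k / c := by rw [hk]; ring
  rw [h2, le_div_iff₀ hc]
  rw [div_le_iff₀ hck] at hge
  nlinarith

end Scale

/-! ### Costs -/

section Costs

/-- The gradient inequality of a convex function. -/
lemma _root_.ConvexOn.inner_gradientWithin_le {X : Set (Vec d)} {f : Vec d → ℝ}
    (hf : ConvexOn ℝ X f) {v z u : Vec d} (hz : z ∈ X) (hu : u ∈ X)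
    (hv : HasGradientWithinAt f v X z) : inner ℝ v (u - z) ≤ f u - f z := by
  -- The directional derivative is the limit of difference quotients at `z + (u - z) / (k + 1)`.
  -- These points stay in `X`, and by convexity each quotient is at most `f u - f z`.
  have hlim := hv.hasFDerivWithinAt.lim (α := ℕ) (l := Filter.atTop)
    (c := fun k => (k : ℝ) + 1) (d := fun k => (((k : ℝ) + 1)⁻¹) • (u - z)) (v := u - z)
  have hpos : ∀ k : ℕ, (0 : ℝ) < (k : ℝ) + 1 := fun k => by positivity
  have hmem : ∀ k : ℕ, (((k : ℝ) + 1)⁻¹) ∈ Set.Icc (0 : ℝ) 1 := fun k =>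
    ⟨(inv_pos.2 (hpos k)).le, inv_le_one_of_one_le₀ (by linarith [(Nat.cast_nonneg k : (0:ℝ) ≤ k)])⟩
  have heq : ∀ k : ℕ, z + (((k : ℝ) + 1)⁻¹) • (u - z) =
      (1 - ((k : ℝ) + 1)⁻¹) • z + (((k : ℝ) + 1)⁻¹) • u := fun k => by module
  have h := hlim ?_ ?_ ?_
  · refine le_of_tendsto h (Filter.Eventually.of_forall fun k => ?_)
    have h1 := hf.2 hz hu (show 0 ≤ 1 - ((k : ℝ) + 1)⁻¹ by linarith [(hmem k).2]) (hmem k).1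
      (by ring)
    rw [← heq] at h1
    simp only [smul_eq_mul] at h1 ⊢
    calc ((k : ℝ) + 1) * (f (z + (((k : ℝ) + 1)⁻¹) • (u - z)) - f z)
        ≤ ((k : ℝ) + 1) * (((k : ℝ) + 1)⁻¹ * (f u - f z)) := by
          have := hpos k
          gcongr
          linarith
      _ = _ := by rw [← mul_assoc, mul_inv_cancel₀ (hpos k).ne', one_mul]
  · have := (tendsto_one_div_add_atTop_nhds_zero_nat (𝕜 := ℝ)).smul_const (u - z)
    simpa using this
  · refine Filter.Eventually.of_forall fun k => ?_
    rw [heq]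
    exact hf.1 hz hu (by linarith [(hmem k).2]) (hmem k).1 (by ring)
  · refine tendsto_const_nhds.congr fun k => ?_
    rw [smul_smul, mul_inv_cancel₀ (hpos k).ne', one_smul]

variable {X : Set (Vec d)} {G : ℝ} {f : Vec d → ℝ}

lemma IsCost.sub_le (hf : IsCost X G f) {z u : Vec d} (hz : z ∈ X) (hu : u ∈ X) :
    f z - f u ≤ G * ‖z - u‖ := by
  obtain ⟨v, hv, hvG⟩ := hf.2 z hz
  have h1 := hf.1.inner_gradientWithin_le hz hu hv
  have h2 := abs_le.1 (abs_real_inner_le_norm v (u - z))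
  have h3 : ‖v‖ * ‖u - z‖ ≤ G * ‖u - z‖ := by gcongr
  rw [norm_sub_rev]
  linarith [h2.1]

lemma IsCost.abs_sub_le (hf : IsCost X G f) {z u : Vec d} (hz : z ∈ X) (hu : u ∈ X) :
    |f z - f u| ≤ G * ‖z - u‖ :=
  abs_sub_le_iff.2 ⟨hf.sub_le hz hu, by rw [norm_sub_rev]; exact hf.sub_le hu hz⟩

lemma IsCost.continuousOn (hf : IsCost X G f) : ContinuousOn f X := fun z hz => by
  obtain ⟨v, hv, -⟩ := hf.2 z hz
  exact hv.hasFDerivWithinAt.continuousWithinAt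

end Costs

/-! ### Projected online gradient descent -/

section OGD

lemma proj_spec {K : Set (Vec d)} (hK : IsClosed K) (hne : K.Nonempty) (z : Vec d) :
    proj K z ∈ K ∧ ∀ v ∈ K, ‖z - proj K z‖ ≤ ‖z - v‖ := by
  refine Classical.epsilon_spec (p := fun w => w ∈ K ∧ ∀ v ∈ K, ‖z - w‖ ≤ ‖z - v‖) ?_
  obtain ⟨w, hw, h⟩ := hK.exists_infDist_eq_dist hne z
  refine ⟨w, hw, fun v hv => ?_⟩
  rw [← dist_eq_norm, ← dist_eq_norm, ← h]
  exact Metric.infDist_le_dist_of_mem hv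

/-- At the nearest point, `z - proj K z` and `u - proj K z` have nonpositive inner product; expand
the square of `z - u` around it. -/
lemma norm_proj_sub_le {K : Set (Vec d)} (hK : IsClosed K) (hc : Convex ℝ K) (z : Vec d)
    {u : Vec d} (hu : u ∈ K) : ‖proj K z - u‖ ^ 2 ≤ ‖z - u‖ ^ 2 := by
  obtain ⟨hw, hmin⟩ := proj_spec hK ⟨u, hu⟩ z
  have : Nonempty K := ⟨⟨u, hu⟩⟩
  have h1 : ‖z - proj K z‖ = ⨅ w : K, ‖z - w‖ :=
    le_antisymm (le_ciInf fun w => hmin w w.2)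
      (ciInf_le ⟨0, fun _ ⟨w, hw⟩ => hw ▸ norm_nonneg _⟩ (⟨_, hw⟩ : K))
  have h2 := (norm_eq_iInf_iff_real_inner_le_zero hc hw).1 h1 u hu
  have h3 : z - u = (z - proj K z) - (u - proj K z) := by abel
  rw [h3, norm_sub_sq_real (z - proj K z), norm_sub_rev (proj K z) u]
  nlinarith [sq_nonneg ‖z - proj K z‖]

lemma ogd_mem {K : Set (Vec d)} (hK : IsClosed K) (h0 : (0 : Vec d) ∈ K) (eta : ℕ → ℝ)
    (gf : ℕ → Vec d → Vec d) (s : ℕ) : ogd K eta gf s ∈ K := by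
  cases s with
  | zero => exact h0
  | succ s => exact (proj_spec hK ⟨0, h0⟩ _).1

lemma inv_sqrt_succ_le (t : ℕ) : 1 / √((t : ℝ) + 1) ≤ 2 * (√((t : ℝ) + 1) - √(t : ℝ)) := by
  have h0 : (0 : ℝ) ≤ t := Nat.cast_nonneg t
  have h1 : 0 < √((t : ℝ) + 1) := Real.sqrt_pos.2 (by linarith)
  rw [div_le_iff₀ h1]
  have h2 := Real.sq_sqrt (show (0 : ℝ) ≤ (t : ℝ) + 1 by linarith)
  have h3 := Real.sq_sqrt h0
  nlinarith [sq_nonneg (√((t : ℝ) + 1) - √(t : ℝ))]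

lemma sum_inv_sqrt_succ_le (t : ℕ) : ∑ s ∈ Finset.range t, 1 / √((s : ℝ) + 1) ≤ 2 * √(t : ℝ) := by
  induction t with
  | zero => simp
  | succ t ih =>
    rw [Finset.sum_range_succ, Nat.cast_succ]
    linarith [inv_sqrt_succ_le t]

variable {X K : Set (Vec d)} {D G : ℝ} {f : ℕ → Vec d → ℝ} {gf : ℕ → Vec d → Vec d}

/-- The regret of projected online gradient descent with step sizes `D / (G √s)`. -/
lemma ogd_regret (hD : 0 < D) (hG : 0 < G) (hKX : K ⊆ X) (hX : ∀ z ∈ X, ‖z‖ ≤ D / 2)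
    (hK : IsClosed K) (hKc : Convex ℝ K) (h0 : (0 : Vec d) ∈ K) {t : ℕ}
    (hf : ∀ s < t, ConvexOn ℝ X (f s))
    (hgf : ∀ s < t, ∀ z ∈ X, HasGradientWithinAt (f s) (gf s z) X z ∧ ‖gf s z‖ ≤ G)
    {u : Vec d} (hu : u ∈ K) :
    ∑ s ∈ Finset.range t, (f s (ogd K (etaStep D G) gf s) - f s u) ≤ 3 / 2 * (G * D) * √(t : ℝ) := by
  have hmem := ogd_mem hK h0 (etaStep D G) gf
  have hdist : ∀ s, ‖ogd K (etaStep D G) gf s - u‖ ^ 2 ≤ D ^ 2 := fun s => by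
    have h1 := norm_sub_le (ogd K (etaStep D G) gf s) u
    have h2 := hX _ (hKX (hmem s))
    have h3 := hX _ (hKX hu)
    exact pow_le_pow_left₀ (norm_nonneg _) (by linarith) 2
  -- The induction carries the squared distance to `u` with coefficient `1 / (2 η)`, where `η` is
  -- the step size just used. At `t = 0` the coefficient vanishes with `√0`.
  suffices h : ∑ s ∈ Finset.range t, (f s (ogd K (etaStep D G) gf s) - f s u) ≤
      3 / 2 * (G * D) * √(t : ℝ) - G * √(t : ℝ) / (2 * D) * ‖ogd K (etaStep D G) gf t - u‖ ^ 2 by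
    have : 0 ≤ G * √(t : ℝ) / (2 * D) * ‖ogd K (etaStep D G) gf t - u‖ ^ 2 := by positivity
    linarith
  induction t with
  | zero => simp
  | succ t ih =>
    have ih := ih (fun s hs => hf s (hs.trans (Nat.lt_succ_self t)))
      (fun s hs => hgf s (hs.trans (Nat.lt_succ_self t)))
    rw [Finset.sum_range_succ, Nat.cast_succ]
    set z := ogd K (etaStep D G) gf t with hz
    obtain ⟨hg, hgG⟩ := hgf t (Nat.lt_succ_self t) z (hKX (hmem t))
    have h1 := (hf t (Nat.lt_succ_self t)).inner_gradientWithin_le (hKX (hmem t)) (hKX hu) hg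
    have h2 : ‖ogd K (etaStep D G) gf (t + 1) - u‖ ^ 2 ≤
        ‖(z - etaStep D G t • gf t z) - u‖ ^ 2 := norm_proj_sub_le hK hKc _ hu
    have h3 : (z - etaStep D G t • gf t z) - u = (z - u) - etaStep D G t • gf t z := by abel
    rw [h3, norm_sub_sq_real (z - u), inner_smul_right, norm_smul, mul_pow, Real.norm_eq_abs, sq_abs] at h2
    have h4 : inner ℝ (gf t z) (u - z) = -inner ℝ (z - u) (gf t z) := by
      rw [real_inner_comm, ← inner_neg_left, neg_sub]
    rw [h4] at h1
    have h5 : ‖gf t z‖ ^ 2 ≤ G ^ 2 := pow_le_pow_left₀ (norm_nonneg _) hgG 2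
    have h0t : (0 : ℝ) ≤ t := Nat.cast_nonneg t
    have hr : 0 < √((t : ℝ) + 1) := Real.sqrt_pos.2 (by linarith)
    set r := √((t : ℝ) + 1) with hrdef
    set q := √(t : ℝ)
    set ip := inner ℝ (z - u) (gf t z)
    set a := ‖z - u‖ ^ 2
    set a' := ‖ogd K (etaStep D G) gf (t + 1) - u‖ ^ 2
    have hη : etaStep D G t = D / (G * r) := rfl
    rw [hη] at h2
    have h6 : ip ≤ G * r / (2 * D) * (a - a') + G * D / 2 * (1 / r) := by
      have h7 : G * r / (2 * D) * a' ≤ G * r / (2 * D) *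
          (a - 2 * (D / (G * r) * ip) + (D / (G * r)) ^ 2 * G ^ 2) := by
        refine mul_le_mul_of_nonneg_left (h2.trans ?_) (by positivity)
        have := mul_le_mul_of_nonneg_left h5 (sq_nonneg (D / (G * r)))
        linarith
      have h8 : G * r / (2 * D) * (a - 2 * (D / (G * r) * ip) + (D / (G * r)) ^ 2 * G ^ 2) =
          G * r / (2 * D) * a - ip + G * D / 2 * (1 / r) := by
        field_simp
      rw [h8] at h7
      linarith
    have h9 := inv_sqrt_succ_le t
    have h10 : G * D / 2 * (1 / r) ≤ G * D * (r - q) := by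
      have := mul_le_mul_of_nonneg_left h9 (show 0 ≤ G * D / 2 by positivity)
      linarith
    have hqr : q ≤ r := Real.sqrt_le_sqrt (by linarith)
    -- When the coefficient grows from that of `√t` to that of `√(t + 1)`, the distance is bounded
    -- by `D`. This costs `G D / 2 · (r - q)`; with `G D (r - q)` from the gradient norm it makes
    -- the constant `3 / 2`.
    have h11 : G * (r - q) / (2 * D) * a ≤ G * (r - q) / (2 * D) * D ^ 2 :=
      mul_le_mul_of_nonneg_left (hdist t) (by
        have : 0 ≤ r - q := by linarith
        positivity)
    have h12 : G * (r - q) / (2 * D) * D ^ 2 = G * D / 2 * (r - q) := by field_simp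
    have h13 : G * (r - q) / (2 * D) * a = G * r / (2 * D) * a - G * q / (2 * D) * a := by ring
    have h14 : G * r / (2 * D) * (a - a') = G * r / (2 * D) * a - G * r / (2 * D) * a' := by ring
    linarith

end OGD

/-! ### Hedge with decreasing learning rates -/

section Hedge

/-- Hoeffding's lemma for a finitely supported distribution. -/
lemma sum_mul_exp_le {M : Type} [Fintype M] {p l : M → ℝ} (hp : ∀ m, 0 ≤ p m)
    (hp1 : ∑ m, p m = 1) {a b : ℝ} (hl : ∀ m, l m ∈ Set.Icc a b) (t : ℝ) :
    ∑ m, p m * Real.exp (t * (l m - ∑ m', p m' * l m')) ≤ Real.exp (t ^ 2 * (b - a) ^ 2 / 8) := by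
  let _ : MeasurableSpace M := ⊤
  let μ : Measure M := ∑ m, ENNReal.ofReal (p m) • Measure.dirac m
  have hint : ∀ g : M → ℝ, ∫ m, g m ∂μ = ∑ m, p m * g m := fun g => by
    simp only [μ]
    rw [integral_finsetSum_measure fun m _ =>
      (integrable_dirac (by simp [enorm_lt_top])).smul_measure ENNReal.ofReal_ne_top]
    simp [integral_smul_measure, hp]
  have : IsProbabilityMeasure μ := ⟨by
    simp only [μ, Measure.coe_finsetSum, Finset.sum_apply, Measure.smul_apply, measure_univ,
      smul_eq_mul, mul_one]
    rw [← ENNReal.ofReal_sum_of_nonneg fun m _ => hp m, hp1, ENNReal.ofReal_one]⟩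
  have h := (hasSubgaussianMGF_of_mem_Icc (μ := μ) (X := l) (measurable_from_top.aemeasurable)
    (Filter.Eventually.of_forall hl)).mgf_le t
  rw [mgf, hint, hint] at h
  refine h.trans (le_of_eq ?_)
  congr 1
  simp only [NNReal.coe_pow, NNReal.coe_div, coe_nnnorm, NNReal.coe_ofNat, Real.norm_eq_abs, div_pow,
    sq_abs]
  ring

variable {M : Type} [Fintype M]

/-- The logarithmic mean `log (M⁻¹ ∑ exp (- z L)) / z`. -/
noncomputable def logMeanExp (z : ℝ) (L : M → ℝ) : ℝ :=
  Real.log ((Fintype.card M : ℝ)⁻¹ * ∑ m, Real.exp (-z * L m)) / z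

variable [Nonempty M]

lemma sum_exp_pos (g : M → ℝ) : 0 < ∑ m, Real.exp (g m) :=
  Finset.sum_pos (fun _ _ => Real.exp_pos _) Finset.univ_nonempty

lemma card_pos_real : (0 : ℝ) < Fintype.card M := by exact_mod_cast Fintype.card_pos

/-- The power mean inequality with exponent `z' / z ≥ 1`. It lets the Hedge potential pass to a
smaller learning rate without loss; the normalization by the number of experts is essential for
this. -/
lemma logMeanExp_mono {z z' : ℝ} (hz : 0 < z) (hzz : z ≤ z') (L : M → ℝ) :
    logMeanExp z L ≤ logMeanExp z' L := by
  have hM := card_pos_real (M := M)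
  have hz' : 0 < z' := hz.trans_le hzz
  have h := Real.rpow_arith_mean_le_arith_mean_rpow (Finset.univ : Finset M)
    (fun _ => (Fintype.card M : ℝ)⁻¹) (fun m => Real.exp (-z * L m)) (fun _ _ => by positivity)
    (by simp [hM.ne']) (fun _ _ => (Real.exp_pos _).le) (p := z' / z) ((one_le_div hz).2 hzz)
  have h2 : ∀ m, Real.exp (-z * L m) ^ (z' / z) = Real.exp (-z' * L m) := fun m => by
    rw [← Real.exp_mul]; congr 1; field_simp
  simp only [h2, ← Finset.mul_sum] at h
  have hpos : 0 < (Fintype.card M : ℝ)⁻¹ * ∑ m, Real.exp (-z * L m) :=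
    mul_pos (inv_pos.2 hM) (sum_exp_pos _)
  have h3 := Real.log_le_log (Real.rpow_pos_of_pos hpos _) h
  rw [Real.log_rpow hpos] at h3
  unfold logMeanExp
  rw [div_le_div_iff₀ hz hz']
  rw [div_mul_eq_mul_div, div_le_iff₀ hz] at h3
  linarith

lemma neg_logMeanExp_le {z : ℝ} (hz : 0 < z) (L : M → ℝ) (m : M) :
    -logMeanExp z L ≤ L m + Real.log (Fintype.card M) / z := by
  have hM := card_pos_real (M := M)
  have h1 : Real.log ((Fintype.card M : ℝ)⁻¹ * Real.exp (-z * L m)) ≤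
      Real.log ((Fintype.card M : ℝ)⁻¹ * ∑ m, Real.exp (-z * L m)) := by
    refine Real.log_le_log (by positivity) ?_
    gcongr
    exact Finset.single_le_sum (f := fun m => Real.exp (-z * L m))
      (fun _ _ => (Real.exp_pos _).le) (Finset.mem_univ m)
  rw [Real.log_mul (inv_pos.2 hM).ne' (Real.exp_pos _).ne', Real.log_exp, Real.log_inv] at h1
  unfold logMeanExp
  rw [← neg_div, div_le_iff₀ hz, add_mul, div_mul_cancel₀ _ hz.ne']
  linarith

lemma hedge_nonneg (zeta : ℕ → ℝ) (loss : ℕ → M → ℝ) (s : ℕ) (m : M) :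
    0 ≤ hedge zeta loss s m :=
  div_nonneg (Real.exp_pos _).le (sum_exp_pos _).le

lemma sum_hedge (zeta : ℕ → ℝ) (loss : ℕ → M → ℝ) (s : ℕ) : ∑ m, hedge zeta loss s m = 1 := by
  unfold hedge
  rw [← Finset.sum_div, div_self (sum_exp_pos _).ne']

/-- At a fixed rate, the ratio of consecutive exponential sums is the moment generating function of
the loss under the Hedge distribution. Hoeffding's lemma bounds its logarithm. -/
lemma hedge_mix_le {zeta : ℕ → ℝ} {loss : ℕ → M → ℝ} {s : ℕ} (hz : 0 < zeta s) {a B : ℝ}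
    (hl : ∀ m, loss s m ∈ Set.Icc a (a + B)) :
    ∑ m, hedge zeta loss s m * loss s m ≤
      logMeanExp (zeta s) (fun m => ∑ r ∈ Finset.range s, loss r m) -
        logMeanExp (zeta s) (fun m => ∑ r ∈ Finset.range (s + 1), loss r m) +
        B ^ 2 / 8 * zeta s := by
  have hM := card_pos_real (M := M)
  set z := zeta s
  set L : M → ℝ := fun m => ∑ r ∈ Finset.range s, loss r m with hL
  have hH := sum_mul_exp_le (hedge_nonneg zeta loss s) (sum_hedge zeta loss s) hl (-z)
  set e := ∑ m, hedge zeta loss s m * loss s m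
  have h1 : ∑ m, hedge zeta loss s m * Real.exp (-z * (loss s m - e)) =
      Real.exp (z * e) * ((∑ m, Real.exp (-z * ∑ r ∈ Finset.range (s + 1), loss r m)) /
        ∑ m, Real.exp (-z * L m)) := by
    rw [Finset.sum_div, Finset.mul_sum]
    refine Finset.sum_congr rfl fun m _ => ?_
    have : Real.exp (-z * ∑ r ∈ Finset.range (s + 1), loss r m) =
        Real.exp (-z * L m) * Real.exp (-z * loss s m) := by
      rw [← Real.exp_add, Finset.sum_range_succ]; congr 1; ring
    have h2 : Real.exp (-z * (loss s m - e)) = Real.exp (z * e) * Real.exp (-z * loss s m) := by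
      rw [← Real.exp_add]; congr 1; ring
    rw [this, h2]
    simp only [hedge]
    ring
  rw [h1] at hH
  have hA := sum_exp_pos (M := M) fun m => -z * ∑ r ∈ Finset.range (s + 1), loss r m
  have hB := sum_exp_pos (M := M) fun m => -z * L m
  have h3 := Real.log_le_log (mul_pos (Real.exp_pos _) (div_pos hA hB)) hH
  rw [Real.log_mul (Real.exp_pos _).ne' (div_pos hA hB).ne', Real.log_exp, Real.log_exp,
    Real.log_div hA.ne' hB.ne'] at h3
  unfold logMeanExp
  rw [← sub_div, Real.log_mul (inv_pos.2 hM).ne' hA.ne', Real.log_mul (inv_pos.2 hM).ne' hB.ne']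
  rw [← sub_le_iff_le_add, le_div_iff₀ hz]
  nlinarith

/-- The potential `-logMeanExp` is zero without losses. Each round is charged at its own rate by
`hedge_mix_le`, and the rate is then changed by `logMeanExp_mono`. Keeping only the term of `m₀` in
the final exponential sum yields the comparison with that expert. -/
lemma hedge_regret {zeta : ℕ → ℝ} {loss : ℕ → M → ℝ} (hz : ∀ s, 0 < zeta s) (hzm : Antitone zeta)
    {B : ℝ} {t : ℕ} (hl : ∀ s < t, ∃ a, ∀ m, loss s m ∈ Set.Icc a (a + B)) (m₀ : M) :
    ∑ s ∈ Finset.range t, (∑ m, hedge zeta loss s m * loss s m - loss s m₀) ≤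
      Real.log (Fintype.card M) / zeta t + B ^ 2 / 8 * ∑ s ∈ Finset.range t, zeta s := by
  have key : ∑ s ∈ Finset.range t, ∑ m, hedge zeta loss s m * loss s m ≤
      -logMeanExp (zeta t) (fun m => ∑ r ∈ Finset.range t, loss r m) +
        B ^ 2 / 8 * ∑ s ∈ Finset.range t, zeta s := by
    induction t with
    | zero => simp [logMeanExp, (card_pos_real (M := M)).ne']
    | succ t ih =>
      have ih := ih fun s hs => hl s (hs.trans (Nat.lt_succ_self t))
      obtain ⟨a, ha⟩ := hl t (Nat.lt_succ_self t)
      have h1 := hedge_mix_le (hz t) ha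
      have h2 := logMeanExp_mono (hz (t + 1)) (hzm (Nat.le_succ t))
        (fun m => ∑ r ∈ Finset.range (t + 1), loss r m)
      rw [Finset.sum_range_succ, Finset.sum_range_succ (fun s => zeta s), mul_add]
      linarith
  have h := neg_logMeanExp_le (hz t) (fun m => ∑ r ∈ Finset.range t, loss r m) m₀
  rw [Finset.sum_sub_distrib]
  linarith

lemma hedge_regret_zetaStep {D G : ℝ} (hD : 0 < D) (hG : 0 < G) (hM : 2 ≤ Fintype.card M)
    {loss : ℕ → M → ℝ} {t : ℕ}
    (hl : ∀ s < t, ∃ a, ∀ m, loss s m ∈ Set.Icc a (a + G * D)) (m₀ : M) :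
    ∑ s ∈ Finset.range t, (∑ m, hedge (zetaStep D G (Fintype.card M)) loss s m * loss s m -
        loss s m₀) ≤
      3 / 2 * (G * D) * √(Real.log (Fintype.card M)) * √(t : ℝ) := by
  rcases Nat.eq_zero_or_pos t with rfl | ht
  · simp
  have hlog : 0 < Real.log (Fintype.card M) := Real.log_pos (by exact_mod_cast hM)
  set w := Real.log (Fintype.card M)
  have hw : 0 < √w := Real.sqrt_pos.2 hlog
  have h4 : √(4 * w) = 2 * √w := by
    rw [Real.sqrt_mul (by norm_num), show (4 : ℝ) = 2 ^ 2 by norm_num,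
      Real.sqrt_sq (by norm_num)]
  have hr : ∀ s : ℕ, 0 < √((s : ℝ) + 1) := fun s => Real.sqrt_pos.2 (by positivity)
  have hzeta : ∀ s, zetaStep D G (Fintype.card M) s = 2 * √w / (G * D) * (1 / √((s : ℝ) + 1)) :=
    fun s => by
      have : zetaStep D G (Fintype.card M) s = √(4 * w) / (G * D * √((s : ℝ) + 1)) := rfl
      rw [this, h4]; field_simp
  have hz : ∀ s, 0 < zetaStep D G (Fintype.card M) s := fun s => by
    rw [hzeta]; have := hr s; positivity
  have hzm : Antitone (zetaStep D G (Fintype.card M)) := fun s t hst => by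
    rw [hzeta, hzeta]
    have := hr s
    gcongr
  refine (hedge_regret hz hzm hl m₀).trans ?_
  have h5 : Real.log (Fintype.card M) / zetaStep D G (Fintype.card M) t =
      G * D / 2 * √w * √((t : ℝ) + 1) := by
    rw [hzeta]
    have h6 : Real.log (Fintype.card M) = √w * √w := (Real.mul_self_sqrt hlog.le).symm
    rw [h6]
    have := hr t
    field_simp
  have h7 : ∑ s ∈ Finset.range t, zetaStep D G (Fintype.card M) s ≤
      2 * √w / (G * D) * (2 * √(t : ℝ)) := by
    simp only [hzeta, ← Finset.mul_sum]
    gcongr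
    exact sum_inv_sqrt_succ_le t
  -- The final potential uses the rate of the round after the last one, hence `√(t + 1)`; the
  -- comparison with `√t` needs `t ≥ 1`.
  have h8 : √((t : ℝ) + 1) ≤ 2 * √(t : ℝ) := by
    rw [show (2 : ℝ) = √4 by rw [show (4 : ℝ) = 2 ^ 2 by norm_num, Real.sqrt_sq (by norm_num)],
      ← Real.sqrt_mul (by norm_num)]
    refine Real.sqrt_le_sqrt ?_
    have : (1 : ℝ) ≤ t := by exact_mod_cast ht
    linarith
  rw [h5]
  -- The potential contributes `1` and the Hoeffding terms contribute `1 / 2` to the factor of `G D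
  -- √w √t`.
  calc _ ≤ G * D / 2 * √w * (2 * √(t : ℝ)) +
        (G * D) ^ 2 / 8 * (2 * √w / (G * D) * (2 * √(t : ℝ))) := by gcongr
    _ = _ := by field_simp; ring

end Hedge

/-! ### One step of the method of mixtures -/

section Mixture

/-- Completing the square in `g`: the product is a Gaussian density of variance `q / (1 + q)`, up to
a constant. That constant is the one-step factor in `mixture_succ`. -/
lemma gaussianPDFReal_mul_exp {q : ℝ} (hq : 0 < q) (r e g : ℝ) :
    gaussianPDFReal r q.toNNReal g * Real.exp (e * g - g ^ 2 / 2) =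
      Real.exp ((2 * e * r + e ^ 2 * q - r ^ 2) / (2 * (1 + q))) / √(1 + q) *
        gaussianPDFReal ((r + e * q) / (1 + q)) (q / (1 + q)).toNNReal g := by
  have h1 : 0 < 1 + q := by linarith
  have hq' : 0 < q / (1 + q) := by positivity
  simp only [gaussianPDFReal, Real.coe_toNNReal q hq.le, Real.coe_toNNReal _ hq'.le]
  have h2 : √(2 * Real.pi * (q / (1 + q))) = √(2 * Real.pi * q) / √(1 + q) := by
    rw [← mul_div_assoc, Real.sqrt_div (by positivity)]
  have h3 : Real.exp (-(g - r) ^ 2 / (2 * q)) * Real.exp (e * g - g ^ 2 / 2) =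
      Real.exp ((2 * e * r + e ^ 2 * q - r ^ 2) / (2 * (1 + q))) *
        Real.exp (-(g - (r + e * q) / (1 + q)) ^ 2 / (2 * (q / (1 + q)))) := by
    rw [← Real.exp_add, ← Real.exp_add]
    congr 1
    field_simp
    ring
  rw [h2, mul_assoc, h3]
  have h4 : 0 < √(1 + q) := Real.sqrt_pos.2 h1
  have h5 : 0 < √(2 * Real.pi * q) := Real.sqrt_pos.2 (by positivity)
  field_simp

variable {E : Type*} [MeasurableSpace E]

/-- By `gaussianPDFReal_mul_exp` the integrand is the average of `exp (e g - g² / 2)` over `g` with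
mean `r` and variance `q`. After exchanging the integrals, sub-Gaussianity bounds the inner one by
`1` for every `g`. -/
lemma lintegral_exp_quadratic_le {ν : Measure E} [SFinite ν] {e : E → ℝ} (he : Measurable e)
    (hsub : ∀ g : ℝ, ∫⁻ a, ENNReal.ofReal (Real.exp (e a * g)) ∂ν ≤
      ENNReal.ofReal (Real.exp (g ^ 2 / 2))) {q : ℝ} (hq : 0 < q) (r : ℝ) :
    ∫⁻ a, ENNReal.ofReal
      (Real.exp ((2 * e a * r + e a ^ 2 * q - r ^ 2) / (2 * (1 + q))) / √(1 + q)) ∂ν ≤ 1 := by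
  have hq' : 0 < q / (1 + q) := by positivity
  have hv : q.toNNReal ≠ 0 := (Real.toNNReal_pos.2 hq).ne'
  have hv' : (q / (1 + q)).toNNReal ≠ 0 := (Real.toNNReal_pos.2 hq').ne'
  have h1 : ∀ a, ENNReal.ofReal
      (Real.exp ((2 * e a * r + e a ^ 2 * q - r ^ 2) / (2 * (1 + q))) / √(1 + q)) =
      ∫⁻ g, ENNReal.ofReal (gaussianPDFReal r q.toNNReal g *
        Real.exp (e a * g - g ^ 2 / 2)) := fun a => by
    simp only [gaussianPDFReal_mul_exp hq]
    simp only [ENNReal.ofReal_mul (show 0 ≤ Real.exp ((2 * e a * r + e a ^ 2 * q - r ^ 2) /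
      (2 * (1 + q))) / √(1 + q) by positivity)]
    rw [lintegral_const_mul _ (measurable_gaussianPDFReal _ _).ennreal_ofReal,
      lintegral_gaussianPDFReal_eq_one _ hv', mul_one]
  simp only [h1]
  rw [lintegral_lintegral_swap]
  · rw [← lintegral_gaussianPDFReal_eq_one r hv]
    refine lintegral_mono fun g => ?_
    have h2 : ∀ a, ENNReal.ofReal (gaussianPDFReal r q.toNNReal g *
        Real.exp (e a * g - g ^ 2 / 2)) = ENNReal.ofReal (gaussianPDFReal r q.toNNReal g *
        Real.exp (-(g ^ 2 / 2))) * ENNReal.ofReal (Real.exp (e a * g)) := fun a => by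
      rw [← ENNReal.ofReal_mul (mul_nonneg (gaussianPDFReal_nonneg _ _ _) (Real.exp_pos _).le),
        mul_assoc, ← Real.exp_add]
      congr 3; ring
    simp only [h2]
    rw [lintegral_const_mul _ (he.mul_const g).exp.ennreal_ofReal]
    calc _ ≤ ENNReal.ofReal (gaussianPDFReal r q.toNNReal g * Real.exp (-(g ^ 2 / 2))) *
          ENNReal.ofReal (Real.exp (g ^ 2 / 2)) := by gcongr; exact hsub g
      _ = _ := by
        rw [← ENNReal.ofReal_mul (mul_nonneg (gaussianPDFReal_nonneg _ _ _) (Real.exp_pos _).le),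
          mul_assoc, ← Real.exp_add]
        simp
  · refine Measurable.aemeasurable (Measurable.ennreal_ofReal ?_)
    refine ((measurable_gaussianPDFReal _ _).comp measurable_snd).mul (Measurable.exp ?_)
    exact ((he.comp measurable_fst).mul measurable_snd).sub
      ((measurable_snd.pow_const 2).div_const 2)

end Mixture

/-! ### Independence and maximal inequality -/

section Independence

variable {Ω α β : Type*} {𝒢 : MeasurableSpace Ω} [mΩ : MeasurableSpace Ω] [MeasurableSpace α]
  [MeasurableSpace β] {μ : Measure Ω} {W : Ω → α} {N : Ω → β}

lemma indepFun_of_indep_comap (hW : Measurable[𝒢] W)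
    (hind : Indep (MeasurableSpace.comap N inferInstance) 𝒢 μ) : IndepFun W N μ := by
  rw [IndepFun_iff_Indep]
  exact indep_of_indep_of_le_left hind.symm (measurable_iff_comap_le.1 hW)

/-- The joint law is a product, so the fresh variable `N` can be integrated out with the known `W`
held fixed. This stands in for conditioning on `𝒢`. -/
lemma lintegral_le_of_indep [IsFiniteMeasure μ] (h𝒢 : 𝒢 ≤ mΩ) (hW : Measurable[𝒢] W)
    (hN : Measurable N) (hind : Indep (MeasurableSpace.comap N inferInstance) 𝒢 μ)
    {h : α → β → ENNReal} (hh : Measurable (Function.uncurry h)) {g : Ω → ENNReal}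
    (hle : ∀ ω, ∫⁻ b, h (W ω) b ∂(μ.map N) ≤ g ω) :
    ∫⁻ ω, h (W ω) (N ω) ∂μ ≤ ∫⁻ ω, g ω ∂μ := by
  have hW' : Measurable W := hW.mono h𝒢 le_rfl
  have hprod := (indepFun_iff_map_prod_eq_prod_map_map hW'.aemeasurable hN.aemeasurable).1
    (indepFun_of_indep_comap hW hind)
  have h1 : ∫⁻ ω, h (W ω) (N ω) ∂μ =
      ∫⁻ p, Function.uncurry h p ∂(μ.map fun ω => (W ω, N ω)) := by
    rw [lintegral_map hh (hW'.prodMk hN)]; rfl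
  rw [h1, hprod, lintegral_prod _ hh.aemeasurable, lintegral_map _ hW']
  · exact lintegral_mono hle
  · exact hh.lintegral_prod_right'

lemma integral_eq_of_indep [IsFiniteMeasure μ] (h𝒢 : 𝒢 ≤ mΩ) (hW : Measurable[𝒢] W)
    (hN : Measurable N) (hind : Indep (MeasurableSpace.comap N inferInstance) 𝒢 μ)
    {h : α → β → ℝ} (hh : Measurable (Function.uncurry h))
    (hint : Integrable (fun ω => h (W ω) (N ω)) μ) :
    ∫ ω, h (W ω) (N ω) ∂μ = ∫ ω, ∫ b, h (W ω) b ∂(μ.map N) ∂μ := by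
  have hW' : Measurable W := hW.mono h𝒢 le_rfl
  have hprod := (indepFun_iff_map_prod_eq_prod_map_map hW'.aemeasurable hN.aemeasurable).1
    (indepFun_of_indep_comap hW hind)
  have hWN := hW'.prodMk hN
  have h1 : ∫ ω, h (W ω) (N ω) ∂μ =
      ∫ p, Function.uncurry h p ∂(μ.map fun ω => (W ω, N ω)) := by
    rw [integral_map hWN.aemeasurable hh.aestronglyMeasurable]; rfl
  have h2 : Integrable (Function.uncurry h) (μ.map fun ω => (W ω, N ω)) := by
    rw [integrable_map_measure hh.aestronglyMeasurable hWN.aemeasurable]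
    exact hint
  rw [h1, hprod, integral_prod _ (hprod ▸ h2), integral_map hW'.aemeasurable]
  · rfl
  · exact (hh.stronglyMeasurable.integral_prod_right').aestronglyMeasurable

/-- Ville's maximal inequality for a nonnegative supermartingale up to time `T`. -/
lemma measure_exists_le_of_supermartingale {ℱ : Filtration ℕ mΩ} {M : ℕ → Ω → ENNReal} {T : ℕ}
    (hM : ∀ t ≤ T, Measurable[ℱ t] (M t))
    (hstep : ∀ t < T, ∀ B, MeasurableSet[ℱ t] B → ∫⁻ ω in B, M (t + 1) ω ∂μ ≤ ∫⁻ ω in B, M t ω ∂μ)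
    (h0 : ∫⁻ ω, M 0 ω ∂μ ≤ 1) (c : ENNReal) :
    c * μ {ω | ∃ s ≤ T, c ≤ M s ω} ≤ 1 := by
  classical
  let A : ℕ → Set Ω := fun t => {ω | ∃ s ≤ t, c ≤ M s ω}
  have hA : ∀ t ≤ T, MeasurableSet[ℱ t] (A t) := fun t ht => by
    have : A t = ⋃ s ∈ Set.Iic t, {ω | c ≤ M s ω} := by ext ω; simp [A]
    rw [this]
    refine MeasurableSet.biUnion (Set.to_countable _) fun s hs => ?_
    exact ℱ.mono hs _ ((hM s (le_trans hs ht)) measurableSet_Ici)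
  -- `W` is `M` stopped when it first reaches `c`, and `A t` is the event that this has happened by
  -- time `t`. On `A t` nothing changes any more; off `A t`, an event of `ℱ t`, the supermartingale
  -- inequality applies.
  let W : ℕ → Ω → ENNReal := fun t => Nat.rec (M 0) (fun t w => (A t).piecewise w (M (t + 1))) t
  have hW0 : W 0 = M 0 := rfl
  have hWs : ∀ t, W (t + 1) = (A t).piecewise (W t) (M (t + 1)) := fun t => rfl
  have hWM : ∀ t, ∀ ω ∉ A t, W t ω = M t ω := by
    intro t ω hω
    cases t with
    | zero => rfl
    | succ t =>
      rw [hWs, Set.piecewise_eq_of_notMem]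
      exact fun ⟨s, hs, h⟩ => hω ⟨s, by omega, h⟩
  have hWA : ∀ t, ∀ ω ∈ A t, c ≤ W t ω := by
    intro t
    induction t with
    | zero => rintro ω ⟨s, hs, h⟩; rw [Nat.le_zero.1 hs] at h; exact h
    | succ t ih =>
      rintro ω ⟨s, hs, h⟩
      by_cases hω : ω ∈ A t
      · rw [hWs, Set.piecewise_eq_of_mem _ _ _ hω]; exact ih ω hω
      · rw [hWs, Set.piecewise_eq_of_notMem _ _ _ hω]
        have : s = t + 1 := by
          by_contra hne
          exact hω ⟨s, by omega, h⟩
        rwa [← this]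
  have hWm : ∀ t ≤ T, Measurable (W t) := by
    intro t
    induction t with
    | zero => intro _; exact (hM 0 (Nat.zero_le _)).mono (ℱ.le _) le_rfl
    | succ t ih =>
      intro ht
      rw [hWs]
      exact (ih (by omega)).piecewise (ℱ.le _ _ (hA t (by omega)))
        ((hM _ ht).mono (ℱ.le _) le_rfl)
  have hWint : ∀ t ≤ T, ∫⁻ ω, W t ω ∂μ ≤ 1 := by
    intro t
    induction t with
    | zero => intro _; exact h0
    | succ t ih =>
      intro ht
      refine le_trans ?_ (ih (by omega))
      have hAt := ℱ.le _ _ (hA t (by omega))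
      rw [← lintegral_add_compl (W (t + 1)) hAt, ← lintegral_add_compl (W t) hAt]
      gcongr ?_ + ?_
      · refine (setLIntegral_congr_fun hAt fun ω hω => ?_).le
        rw [hWs, Set.piecewise_eq_of_mem _ _ _ hω]
      · calc ∫⁻ ω in (A t)ᶜ, W (t + 1) ω ∂μ = ∫⁻ ω in (A t)ᶜ, M (t + 1) ω ∂μ :=
              setLIntegral_congr_fun hAt.compl fun ω hω => by
                rw [hWs, Set.piecewise_eq_of_notMem _ _ _ hω]
          _ ≤ ∫⁻ ω in (A t)ᶜ, M t ω ∂μ := hstep t (by omega) _ (hA t (by omega)).compl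
          _ = ∫⁻ ω in (A t)ᶜ, W t ω ∂μ :=
              setLIntegral_congr_fun hAt.compl fun ω hω => (hWM t ω hω).symm
  calc c * μ (A T) ≤ c * μ {ω | c ≤ W T ω} := by
        gcongr
        exact fun ω hω => hWA T ω hω
    _ ≤ _ := (mul_meas_ge_le_lintegral (hWm T le_rfl) c).trans (hWint T le_rfl)

end Independence

/-! ### Deviation of the least-squares estimate -/

section Deviation

lemma abs_invForm_le {V : Matrix (Fin d) (Fin d) ℝ} (hV : V.PosDef) (u v : Fin d → ℝ) :
    |invForm V u v| ≤ √(invForm V u u) * √(invForm V v v) := by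
  rw [← Real.sqrt_mul (invForm_self_nonneg hV u)]
  exact Real.abs_le_sqrt (invForm_sq_le hV u v)

/-- The sum `∑_{s < t} e_s x_s`. -/
noncomputable def noiseSum (x : ℕ → Vec d) (e : ℕ → ℝ) (t : ℕ) : Fin d → ℝ :=
  ∑ s ∈ Finset.range t, e s • (x s).ofLp

lemma noiseSum_const_mul (x : ℕ → Vec d) (e : ℕ → ℝ) (c : ℝ) (t : ℕ) :
    noiseSum x (fun s => c * e s) t = c • noiseSum x e t := by
  simp [noiseSum, Finset.smul_sum, mul_smul]

variable {lam : ℝ} {x : ℕ → Vec d} {y : ℕ → Vec n}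

/-- Insert the linear model and use `∑ x_s x_sᵀ = V_t - λ I`. -/
lemma cross_row {i : Fin n} {θ : Vec d} {e : ℕ → ℝ} {t : ℕ}
    (hy : ∀ s < t, y s i = inner ℝ θ (x s) + e s) :
    (fun j => cross x y t i j) =
      gram lam x t *ᵥ θ.ofLp - lam • θ.ofLp + noiseSum x e t := by
  induction t with
  | zero =>
    ext j
    simp [cross, gram_zero, noiseSum, smul_mulVec]
  | succ t ih =>
    have ih := ih fun s hs => hy s (hs.trans (Nat.lt_succ_self t))
    have h1 : (fun j => cross x y (t + 1) i j) =
        (fun j => cross x y t i j) + y t i • (x t).ofLp := by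
      ext j
      simp [cross, Finset.sum_range_succ, vecMulVec_apply]
    rw [h1, ih, hy t (Nat.lt_succ_self t), gram_succ, add_mulVec, vecMulVec_mulVec,
      op_smul_eq_smul, ofLp_dotProduct, real_inner_comm, noiseSum, noiseSum,
      Finset.sum_range_succ, add_smul]
    abel

lemma estimate_mulVec_apply (t : ℕ) (z : Vec d) (i : Fin n) :
    (estimate lam x y t *ᵥ z.ofLp) i =
      invForm (gram lam x t) (fun j => cross x y t i j) z.ofLp := by
  rw [estimate, ← mulVec_mulVec]; rfl

/-- The error is a noise term minus the bias `λ θᵀ V⁻¹ z` of the regularization. Both are bounded by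
Cauchy–Schwarz, the bias also by `‖θ‖²_{V⁻¹} ≤ ‖θ‖² / λ`. -/
lemma abs_estimate_sub_le (hlam : 0 < lam) {i : Fin n} {θ : Vec d} {e : ℕ → ℝ} {t : ℕ}
    (hy : ∀ s < t, y s i = inner ℝ θ (x s) + e s) (z : Vec d) :
    |(estimate lam x y t *ᵥ z.ofLp) i - inner ℝ θ z| ≤
      (√(invForm (gram lam x t) (noiseSum x e t) (noiseSum x e t)) + √lam * ‖θ‖) *
        invNorm (gram lam x t) z := by
  have hV := gram_posDef (x := x) hlam t
  have h1 : invForm (gram lam x t) (gram lam x t *ᵥ θ.ofLp) z.ofLp = inner ℝ θ z := by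
    rw [invForm_comm hV, invForm, mulVec_mulVec, nonsing_inv_mul _ (det_ne_zero_of_posDef hV),
      one_mulVec, ofLp_dotProduct, real_inner_comm]
  have h2 : (estimate lam x y t *ᵥ z.ofLp) i - inner ℝ θ z =
      invForm (gram lam x t) (noiseSum x e t) z.ofLp -
        lam * invForm (gram lam x t) θ.ofLp z.ofLp := by
    rw [estimate_mulVec_apply, cross_row (lam := lam) hy, invForm_add_left,
      sub_eq_add_neg (gram lam x t *ᵥ θ.ofLp), invForm_add_left, h1, ← neg_smul, invForm_smul_left]
    ring
  have h3 : lam * √(invForm (gram lam x t) θ.ofLp θ.ofLp) ≤ √lam * ‖θ‖ := by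
    calc _ ≤ lam * √(‖θ‖ ^ 2 / lam) := by gcongr; exact invForm_gram_le hlam t θ
      _ = √lam * ‖θ‖ := by
        rw [Real.sqrt_div (sq_nonneg _), Real.sqrt_sq (norm_nonneg _)]
        have h4 : 0 < √lam := Real.sqrt_pos.2 hlam
        have h5 := Real.mul_self_sqrt hlam.le
        nth_rewrite 1 [← h5]
        field_simp
  rw [h2]
  calc _ ≤ |invForm (gram lam x t) (noiseSum x e t) z.ofLp| +
        lam * |invForm (gram lam x t) θ.ofLp z.ofLp| := by
        refine (abs_sub _ _).trans ?_
        rw [abs_mul, abs_of_pos hlam]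
    _ ≤ √(invForm (gram lam x t) (noiseSum x e t) (noiseSum x e t)) * invNorm (gram lam x t) z +
        lam * (√(invForm (gram lam x t) θ.ofLp θ.ofLp) * invNorm (gram lam x t) z) := by
        gcongr
        · exact abs_invForm_le hV _ _
        · exact abs_invForm_le hV _ _
    _ ≤ _ := by
        rw [← mul_assoc, ← add_mul]
        gcongr
        exact invNorm_nonneg _ _

/-- The mixture supermartingale of the noise `e`. -/
noncomputable def mixture (lam : ℝ) (x : ℕ → Vec d) (e : ℕ → ℝ) (t : ℕ) : ℝ :=
  Real.exp (invForm (gram lam x t) (noiseSum x e t) (noiseSum x e t) / 2) /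
    √((gram lam x t).det / lam ^ d)

lemma mixture_zero (hlam : 0 < lam) (e : ℕ → ℝ) : mixture lam x e 0 = 1 := by
  simp [mixture, noiseSum, invForm, det_gram_zero, div_self (pow_pos hlam d).ne']

lemma mixture_nonneg (e : ℕ → ℝ) (t : ℕ) : 0 ≤ mixture lam x e t := by
  unfold mixture; positivity

/-- Sherman–Morrison updates the exponent and the determinant lemma the denominator. Besides the new
noise, the factor involves only two scalars known before it, so its mean is controlled by a
one-dimensional Gaussian. -/
lemma mixture_succ (hlam : 0 < lam) (e : ℕ → ℝ) (t : ℕ) :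
    mixture lam x e (t + 1) = mixture lam x e t *
      (Real.exp ((2 * e t * invForm (gram lam x t) (x t).ofLp (noiseSum x e t) +
        e t ^ 2 * invForm (gram lam x t) (x t).ofLp (x t).ofLp -
        invForm (gram lam x t) (x t).ofLp (noiseSum x e t) ^ 2) /
        (2 * (1 + invForm (gram lam x t) (x t).ofLp (x t).ofLp))) /
        √(1 + invForm (gram lam x t) (x t).ofLp (x t).ofLp)) := by
  have hV := gram_posDef (x := x) hlam t
  have hS : noiseSum x e (t + 1) = noiseSum x e t + e t • (x t).ofLp := by
    simp [noiseSum, Finset.sum_range_succ]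
  have hq := invForm_self_nonneg hV (x t).ofLp
  unfold mixture
  rw [det_gram_succ hlam, gram_succ, invForm_add_vecMulVec hV, hS]
  simp only [invForm_add_left, invForm_add_right, invForm_smul_left, invForm_smul_right]
  rw [invForm_comm hV (noiseSum x e t) (x t).ofLp]
  set q := invForm (gram lam x t) (x t).ofLp (x t).ofLp
  set r := invForm (gram lam x t) (x t).ofLp (noiseSum x e t)
  set Q := invForm (gram lam x t) (noiseSum x e t) (noiseSum x e t)
  rw [mul_div_right_comm _ (1 + q), Real.sqrt_mul (div_pos hV.det_pos (pow_pos hlam d)).le, div_mul_div_comm,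
    ← Real.exp_add]
  congr 2
  have : 1 + q ≠ 0 := by linarith
  field_simp
  ring

lemma invForm_noiseSum_le_of_mixture_lt (hlam : 0 < lam) {e : ℕ → ℝ} {t : ℕ} {c : ℝ}
    (h : mixture lam x e t < c) :
    invForm (gram lam x t) (noiseSum x e t) (noiseSum x e t) ≤
      2 * Real.log c + logDet lam x t := by
  have h1 := one_le_det_div (x := x) hlam t
  have h2 : 0 < mixture lam x e t := by unfold mixture; positivity
  have h3 := Real.log_le_log h2 h.le
  rw [mixture, Real.log_div (Real.exp_pos _).ne' (by positivity), Real.log_exp,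
    Real.log_sqrt (by linarith)] at h3
  unfold logDet
  linarith

end Deviation

/-! ### Measurability of matrix operations -/

section MatrixMeasurability

variable {Ω : Type*} {m : MeasurableSpace Ω}

lemma measurable_det {V : Ω → Matrix (Fin d) (Fin d) ℝ}
    (hV : ∀ i j, Measurable[m] fun ω => V ω i j) : Measurable[m] fun ω => (V ω).det := by
  simp only [Matrix.det_apply]
  refine Finset.measurable_sum _ fun σ _ => Measurable.const_smul ?_ _
  exact Finset.measurable_prod _ fun i _ => hV _ _

/-- By Cramer's rule the entries of the inverse are quotients of determinants. -/
lemma measurable_inv_apply {V : Ω → Matrix (Fin d) (Fin d) ℝ}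
    (hV : ∀ i j, Measurable[m] fun ω => V ω i j) (i j : Fin d) :
    Measurable[m] fun ω => (V ω)⁻¹ i j := by
  simp only [Matrix.inv_def, Ring.inverse_eq_inv', Matrix.smul_apply, smul_eq_mul,
    Matrix.adjugate_apply]
  refine (measurable_det hV).inv.mul (measurable_det fun k l => ?_)
  by_cases hk : k = j
  · subst hk; simp only [Matrix.updateRow_self]; exact measurable_const
  · simp only [Matrix.updateRow_ne hk]; exact hV k l

lemma measurable_dotProduct {u v : Ω → Fin d → ℝ} (hu : ∀ i, Measurable[m] fun ω => u ω i)
    (hv : ∀ i, Measurable[m] fun ω => v ω i) : Measurable[m] fun ω => u ω ⬝ᵥ v ω := by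
  simp only [dotProduct]
  exact Finset.measurable_sum _ fun i _ => (hu i).mul (hv i)

lemma measurable_mulVec_apply {A : Ω → Matrix (Fin n) (Fin d) ℝ} {u : Ω → Fin d → ℝ}
    (hA : ∀ i j, Measurable[m] fun ω => A ω i j) (hu : ∀ i, Measurable[m] fun ω => u ω i)
    (i : Fin n) : Measurable[m] fun ω => (A ω *ᵥ u ω) i :=
  measurable_dotProduct (hA i) hu

lemma measurable_invForm {V : Ω → Matrix (Fin d) (Fin d) ℝ} {u v : Ω → Fin d → ℝ}
    (hV : ∀ i j, Measurable[m] fun ω => V ω i j) (hu : ∀ i, Measurable[m] fun ω => u ω i)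
    (hv : ∀ i, Measurable[m] fun ω => v ω i) : Measurable[m] fun ω => invForm (V ω) (u ω) (v ω) :=
  measurable_dotProduct hu (measurable_mulVec_apply (measurable_inv_apply hV) hv)

lemma measurable_ofLp_apply {u : Ω → Vec d} (hu : Measurable[m] u) (i : Fin d) :
    Measurable[m] fun ω => (u ω).ofLp i :=
  (PiLp.continuous_apply 2 _ i).measurable.comp hu

lemma measurable_toLp {u : Ω → Fin d → ℝ} (hu : ∀ i, Measurable[m] fun ω => u ω i) :
    Measurable[m] fun ω => (WithLp.toLp 2 (u ω) : Vec d) :=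
  (PiLp.continuous_toLp 2 _).measurable.comp (measurable_pi_iff.2 hu)

variable {x : ℕ → Ω → Vec d} {y : ℕ → Ω → Vec n} {lam : ℝ} {t : ℕ}

lemma measurable_gram (hx : ∀ s < t, Measurable[m] (x s)) (i j : Fin d) :
    Measurable[m] fun ω => gram lam (fun s => x s ω) t i j := by
  simp only [gram, Matrix.add_apply, Matrix.sum_apply, vecMulVec_apply]
  refine measurable_const.add (Finset.measurable_sum _ fun s hs => ?_)
  have h := hx s (Finset.mem_range.1 hs)
  exact (measurable_ofLp_apply h i).mul (measurable_ofLp_apply h j)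

lemma measurable_cross (hx : ∀ s < t, Measurable[m] (x s)) (hy : ∀ s < t, Measurable[m] (y s))
    (i : Fin n) (j : Fin d) :
    Measurable[m] fun ω => cross (fun s => x s ω) (fun s => y s ω) t i j := by
  simp only [cross, Matrix.sum_apply, vecMulVec_apply]
  exact Finset.measurable_sum _ fun s hs =>
    (measurable_ofLp_apply (hy s (Finset.mem_range.1 hs)) i).mul
      (measurable_ofLp_apply (hx s (Finset.mem_range.1 hs)) j)

lemma measurable_estimate (hx : ∀ s < t, Measurable[m] (x s))
    (hy : ∀ s < t, Measurable[m] (y s)) (i : Fin n) (j : Fin d) :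
    Measurable[m] fun ω => estimate lam (fun s => x s ω) (fun s => y s ω) t i j := by
  simp only [estimate, Matrix.mul_apply]
  exact Finset.measurable_sum _ fun k _ =>
    (measurable_cross hx hy i k).mul (measurable_inv_apply (measurable_gram hx) k j)

lemma measurable_noiseSum {e : ℕ → Ω → ℝ} (hx : ∀ s < t, Measurable[m] (x s))
    (he : ∀ s < t, Measurable[m] (e s)) (j : Fin d) :
    Measurable[m] fun ω => noiseSum (fun s => x s ω) (fun s => e s ω) t j := by
  simp only [noiseSum, Finset.sum_apply, Pi.smul_apply, smul_eq_mul]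
  exact Finset.measurable_sum _ fun s hs => (he s (Finset.mem_range.1 hs)).mul
    (measurable_ofLp_apply (hx s (Finset.mem_range.1 hs)) j)

lemma measurable_mixture {e : ℕ → Ω → ℝ} (hx : ∀ s < t, Measurable[m] (x s))
    (he : ∀ s < t, Measurable[m] (e s)) :
    Measurable[m] fun ω => mixture lam (fun s => x s ω) (fun s => e s ω) t := by
  unfold mixture
  exact (((measurable_invForm (measurable_gram hx) (measurable_noiseSum hx he)
    (measurable_noiseSum hx he)).div_const 2).exp).div
      ((measurable_det (measurable_gram hx)).div_const _).sqrt

lemma measurable_phaseStart (hx : ∀ s < t, Measurable[m] (x s)) :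
    Measurable[m] fun ω => phaseStart lam (fun s => x s ω) t := by
  induction t with
  | zero => exact measurable_const
  | succ t ih =>
    have ih := ih fun s hs => hx s (hs.trans (Nat.lt_succ_self t))
    simp only [phaseStart]
    refine Measurable.ite ?_ ih measurable_const
    -- The Gram matrix is evaluated at a random index; the event is split according to the finitely
    -- many values of that index.
    have h : {ω | (gram lam (fun s => x s ω) (t + 1)).det ≤
        2 * (gram lam (fun s => x s ω) (phaseStart lam (fun s => x s ω) t)).det} =
        ⋃ k ∈ Set.Iic t, ({ω | phaseStart lam (fun s => x s ω) t = k} ∩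
          {ω | (gram lam (fun s => x s ω) (t + 1)).det ≤
            2 * (gram lam (fun s => x s ω) k).det}) := by
      ext ω
      simp [phaseStart_le]
    rw [h]
    refine MeasurableSet.biUnion (Set.to_countable _) fun k hk => ?_
    refine (ih (measurableSet_singleton k)).inter
      (measurableSet_le (measurable_det (measurable_gram hx))
        ((measurable_det (measurable_gram fun s hs => hx s ?_)).const_mul 2))
    have : k ≤ t := hk
    omega

end MatrixMeasurability

/-! ### The stochastic constraints -/

section Problem

set_option linter.unusedSectionVars false

variable {Ω Z : Type*} [mΩ : MeasurableSpace Ω] [MeasurableSpace Z] {μ : Measure Ω}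
  {ℱ : Filtration ℕ mΩ} {T : ℕ} {D G Gg F : ℝ} {X : Set (Vec d)}
  {f : ℕ → Ω → Vec d → ℝ} {a : ℕ → Ω → Fin n → Vec d} {b : ℕ → Ω → Vec n} {draw : ℕ → Ω → Z}
  {x : ℕ → Ω → Vec d}

lemma constr_apply (a : Fin n → Vec d) (b : Vec n) (z : Vec d) (i : Fin n) :
    constr a b z i = inner ℝ (a i) z - b i := rfl

/-- The mean gradient of the `i`-th constraint. -/
noncomputable def meanGrad (μ : Measure Ω) (a : ℕ → Ω → Fin n → Vec d) (i : Fin n) : Vec d :=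
  ∫ ω, a 0 ω i ∂μ

namespace IsProblem

variable (hP : IsProblem μ ℱ T D G Gg F X f a b draw)
include hP

lemma sup_comap_le {t : ℕ} (ht : t < T) :
    ℱ t ⊔ MeasurableSpace.comap (draw t) inferInstance ≤ ℱ (t + 1) :=
  sup_le (ℱ.mono (Nat.le_succ t)) (measurable_iff_comap_le.1 (hP.draw_past t ht))

lemma constr_measurable {t : ℕ} (ht : t < T) : Measurable fun ω => (a t ω, b t ω) :=
  (hP.constr_past t ht).mono (ℱ.le _) le_rfl

lemma map_constr_eq {t : ℕ} (ht : t < T) :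
    μ.map (fun ω => (a t ω, b t ω)) = μ.map (fun ω => (a 0 ω, b 0 ω)) :=
  (hP.identDistrib t ht).map_eq

lemma norm_le_of_ae {t : ℕ} (ht : t < T) : ∀ᵐ ω ∂μ, ‖b t ω‖ ≤ F := by
  filter_upwards [hP.value_le t ht] with ω h
  have : constr (a t ω) (b t ω) 0 = -b t ω := by
    ext i; simp [constr_apply]
  rwa [this, norm_neg] at h

variable [IsProbabilityMeasure μ]

lemma F_nonneg (hT : 0 < T) : 0 ≤ F := by
  obtain ⟨ω, h⟩ := (hP.norm_le_of_ae hT).exists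
  exact (norm_nonneg _).trans h

lemma abs_constr_le {t : ℕ} (ht : t < T) :
    ∀ᵐ ω ∂μ, ∀ z ∈ X, ∀ i, |constr (a t ω) (b t ω) z i| ≤ Gg * (D / 2) + F := by
  filter_upwards [hP.norm_le_of_ae ht, hP.grad_le t ht] with ω h1 h2 z hz i
  rw [constr_apply]
  refine (abs_sub _ _).trans (add_le_add ?_ ?_)
  · exact (abs_real_inner_le_norm _ _).trans (mul_le_mul (h2 i) (hP.norm_le z hz) (norm_nonneg _)
      ((norm_nonneg _).trans (h2 i)))
  · exact (PiLp.norm_apply_le (b t ω) i).trans h1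

lemma measurable_a {t : ℕ} (ht : t < T) (i : Fin n) : Measurable fun ω => a t ω i :=
  (measurable_pi_apply i).comp (measurable_fst.comp (hP.constr_measurable ht))

lemma measurable_b {t : ℕ} (ht : t < T) (i : Fin n) : Measurable fun ω => b t ω i :=
  measurable_ofLp_apply (measurable_snd.comp (hP.constr_measurable ht)) i

lemma integrable_a {t : ℕ} (ht : t < T) (i : Fin n) : Integrable (fun ω => a t ω i) μ :=
  Integrable.of_bound (hP.measurable_a ht i).aestronglyMeasurable Gg
    ((hP.grad_le t ht).mono fun _ h => h i)

lemma integrable_b {t : ℕ} (ht : t < T) (i : Fin n) : Integrable (fun ω => b t ω i) μ :=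
  Integrable.of_bound (hP.measurable_b ht i).aestronglyMeasurable F
    ((hP.norm_le_of_ae ht).mono fun _ h => (PiLp.norm_apply_le _ i).trans h)

lemma norm_meanGrad_le (hT : 0 < T) (i : Fin n) : ‖meanGrad μ a i‖ ≤ Gg := by
  have h := norm_integral_le_of_norm_le_const (μ := μ)
    ((hP.grad_le 0 hT).mono fun ω h => h i)
  simpa [meanGrad] using h

lemma meanConstr_eq (hT : 0 < T) (z : Vec d) (i : Fin n) :
    meanConstr μ a b z i = inner ℝ (meanGrad μ a i) z - limit μ a b i := by
  have h : ∀ z : Vec d, meanConstr μ a b z i =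
      inner ℝ (meanGrad μ a i) z - ∫ ω, b 0 ω i ∂μ := fun z => by
    have h1 := integral_inner (𝕜 := ℝ) (hP.integrable_a hT i) z
    simp only [meanConstr, constr_apply]
    rw [integral_sub, meanGrad, real_inner_comm, ← h1]
    · simp only [real_inner_comm]
    · simp only [real_inner_comm z]
      exact (hP.integrable_a hT i).const_inner z
    · exact hP.integrable_b hT i
  rw [limit, h z, h 0]
  simp

lemma meanConstr_eq_integral_map (hT : 0 < T) {t : ℕ} (ht : t < T) (z : Vec d) (i : Fin n) :
    ∫ p, constr p.1 p.2 z i ∂(μ.map fun ω => (a t ω, b t ω)) = meanConstr μ a b z i := by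
  rw [hP.map_constr_eq ht, integral_map (hP.constr_measurable hT).aemeasurable]
  · rfl
  · refine Measurable.aestronglyMeasurable ?_
    simp only [constr_apply]
    exact (((measurable_pi_apply i).comp measurable_fst).inner_const).sub
      (measurable_ofLp_apply measurable_snd i)

/-- The centred constraint values are sub-Gaussian. -/
lemma lintegral_exp_le (hD : 0 < D) (hGg : 0 < Gg) {t : ℕ} (ht : t < T) {z : Vec d}
    (hz : z ∈ X) (i : Fin n) (g : ℝ) :
    ∫⁻ p, ENNReal.ofReal (Real.exp ((constr p.1 p.2 z i - meanConstr μ a b z i) /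
      ((Gg * D + 4 * F) / 2) * g)) ∂(μ.map fun ω => (a t ω, b t ω)) ≤
      ENNReal.ofReal (Real.exp (g ^ 2 / 2)) := by
  have hT : 0 < T := by omega
  have hF := hP.F_nonneg hT
  have hρ : 0 < (Gg * D + 4 * F) / 2 := by positivity
  set ρ := (Gg * D + 4 * F) / 2 with hρdef
  have hm : Measurable fun p : (Fin n → Vec d) × Vec n => constr p.1 p.2 z i := by
    simp only [constr_apply]
    exact (((measurable_pi_apply i).comp measurable_fst).inner_const).sub
      (measurable_ofLp_apply measurable_snd i)
  rw [hP.map_constr_eq ht, lintegral_map _ (hP.constr_measurable hT)]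
  swap
  · exact (((hm.sub_const _).div_const _).mul_const _).exp.ennreal_ofReal
  have hR : ∀ᵐ ω ∂μ, constr (a 0 ω) (b 0 ω) z i ∈
      Set.Icc (-(Gg * (D / 2) + F)) (Gg * (D / 2) + F) := by
    filter_upwards [hP.abs_constr_le hT] with ω h
    exact abs_le.1 (h z hz i)
  have hs := hasSubgaussianMGF_of_mem_Icc (μ := μ)
    (X := fun ω => constr (a 0 ω) (b 0 ω) z i)
    (hm.comp (hP.constr_measurable hT)).aemeasurable hR
  have h1 := hs.mgf_le (g / ρ)
  have h2 := hs.integrable_exp_mul (g / ρ)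
  have h3 : ∀ ω, Real.exp ((constr (a 0 ω) (b 0 ω) z i - meanConstr μ a b z i) / ρ * g) =
      Real.exp (g / ρ * (constr (a 0 ω) (b 0 ω) z i -
        ∫ ω, constr (a 0 ω) (b 0 ω) z i ∂μ)) := fun ω => by
    congr 1; rw [meanConstr]; ring
  simp only [h3]
  rw [← ofReal_integral_eq_lintegral_ofReal h2
    (Filter.Eventually.of_forall fun _ => (Real.exp_pos _).le)]
  refine ENNReal.ofReal_le_ofReal (h1.trans (Real.exp_le_exp.2 ?_))
  have h4 : (((‖Gg * (D / 2) + F - -(Gg * (D / 2) + F)‖₊ / 2) ^ 2 : NNReal) : ℝ) =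
      (Gg * (D / 2) + F) ^ 2 := by
    simp only [NNReal.coe_pow, NNReal.coe_div, coe_nnnorm, NNReal.coe_ofNat]
    have : 0 ≤ Gg * (D / 2) + F := by positivity
    rw [Real.norm_of_nonneg (by linarith)]
    ring
  rw [h4, div_pow]
  -- Hoeffding's lemma gives the variance proxy `(G_g D / 2 + F)²`, and `ρ = G_g D / 2 + 2 F` is at
  -- least its root.
  have h5 : (Gg * (D / 2) + F) ^ 2 ≤ ρ ^ 2 :=
    pow_le_pow_left₀ (by positivity) (by rw [hρdef]; linarith) 2
  have h6 : (Gg * (D / 2) + F) ^ 2 * (g ^ 2 / ρ ^ 2) ≤ g ^ 2 := by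
    rw [mul_div_assoc', div_le_iff₀ (by positivity)]
    nlinarith [sq_nonneg g]
  linarith

end IsProblem

end Problem

/-! ### Confidence ellipsoids -/

section Confidence

set_option linter.unusedSectionVars false

variable {Ω Z : Type*} [mΩ : MeasurableSpace Ω] [MeasurableSpace Z] {μ : Measure Ω}
  [IsProbabilityMeasure μ] {ℱ : Filtration ℕ mΩ} {T : ℕ} {D G Gg F : ℝ} {X : Set (Vec d)}
  {f : ℕ → Ω → Vec d → ℝ} {a : ℕ → Ω → Fin n → Vec d} {b : ℕ → Ω → Vec n} {draw : ℕ → Ω → Z}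
  {x : ℕ → Ω → Vec d}

/-- The deviation of the `i`-th constraint value from its mean. -/
noncomputable def noise (μ : Measure Ω) (a : ℕ → Ω → Fin n → Vec d) (b : ℕ → Ω → Vec n)
    (x : ℕ → Ω → Vec d) (i : Fin n) (t : ℕ) (ω : Ω) : ℝ :=
  constr (a t ω) (b t ω) (x t ω) i - meanConstr μ a b (x t ω) i

/-- The failure probability used by OSOCO. -/
noncomputable def failProb (D Gg bmin : ℝ) (T : ℕ) : ℝ := min (1 / 2) (bmin / (2 * Gg * D * T))

lemma failProb_pos {bmin : ℝ} (hD : 0 < D) (hGg : 0 < Gg) (hb : 0 < bmin) (hT : 0 < T) :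
    0 < failProb D Gg bmin T := by
  have : (0 : ℝ) < T := by exact_mod_cast hT
  unfold failProb; positivity

lemma measurable_mixture_factor {A E : Type*} [MeasurableSpace A] [MeasurableSpace E]
    {e : A → E → ℝ} (he : Measurable (Function.uncurry e)) :
    Measurable (Function.uncurry fun (w : ENNReal × ℝ × ℝ × A) (p : E) =>
      w.1 * ENNReal.ofReal (Real.exp ((2 * e w.2.2.2 p * w.2.1 + e w.2.2.2 p ^ 2 * w.2.2.1 -
        w.2.1 ^ 2) / (2 * (1 + w.2.2.1))) / √(1 + w.2.2.1))) := by
  have he' : Measurable fun p : (ENNReal × ℝ × ℝ × A) × E => Function.uncurry e (p.1.2.2.2, p.2) :=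
    he.comp (by fun_prop)
  simp only [Function.uncurry] at he' ⊢
  fun_prop

namespace IsProblem

variable (hP : IsProblem μ ℱ T D G Gg F X f a b draw)
include hP

lemma measurable_play (hxm : ∀ t < T,
      Measurable[ℱ t ⊔ MeasurableSpace.comap (draw t) inferInstance] (x t))
    {s t : ℕ} (hst : s < t) (ht : t ≤ T) : Measurable[ℱ t] (x s) :=
  (hxm s (by omega)).mono ((hP.sup_comap_le (by omega)).trans (ℱ.mono hst)) le_rfl

lemma measurable_constr_play (hxm : ∀ t < T,
      Measurable[ℱ t ⊔ MeasurableSpace.comap (draw t) inferInstance] (x t))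
    {s t : ℕ} (hst : s < t) (ht : t ≤ T) (i : Fin n) :
    Measurable[ℱ t] fun ω => constr (a s ω) (b s ω) (x s ω) i := by
  have h1 := hP.measurable_play hxm hst ht
  have h2 : Measurable[ℱ t] fun ω => (a s ω, b s ω) :=
    (hP.constr_past s (by omega)).mono (ℱ.mono hst) le_rfl
  simp only [constr_apply]
  exact (((measurable_pi_apply i).comp (measurable_fst.comp h2)).inner h1).sub
    (measurable_ofLp_apply (measurable_snd.comp h2) i)

lemma measurable_feedback (hxm : ∀ t < T,
      Measurable[ℱ t ⊔ MeasurableSpace.comap (draw t) inferInstance] (x t))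
    {s t : ℕ} (hst : s < t) (ht : t ≤ T) :
    Measurable[ℱ t] (feedback μ a b x s) := by
  have h : feedback μ a b x s = fun ω => WithLp.toLp 2 fun i =>
      constr (a s ω) (b s ω) (x s ω) i + limit μ a b i := by
    ext ω i; simp [feedback]
  rw [h]
  exact measurable_toLp fun i => (hP.measurable_constr_play hxm hst ht i).add_const _

lemma measurable_meanConstr (hT : 0 < T) (i : Fin n) :
    Measurable fun z : Vec d => meanConstr μ a b z i := by
  simp only [hP.meanConstr_eq hT]
  exact measurable_id.const_inner.sub_const _

lemma measurable_noise (hxm : ∀ t < T,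
      Measurable[ℱ t ⊔ MeasurableSpace.comap (draw t) inferInstance] (x t))
    {s t : ℕ} (hst : s < t) (ht : t ≤ T) (i : Fin n) :
    Measurable[ℱ t] (noise μ a b x i s) :=
  (hP.measurable_constr_play hxm hst ht i).sub
    ((hP.measurable_meanConstr (by omega) i).comp (hP.measurable_play hxm hst ht))

lemma feedback_apply (hT : 0 < T) (t : ℕ) (ω : Ω) (i : Fin n) :
    feedback μ a b x t ω i = inner ℝ (meanGrad μ a i) (x t ω) + noise μ a b x i t ω := by
  have h : feedback μ a b x t ω i = constr (a t ω) (b t ω) (x t ω) i + limit μ a b i := rfl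
  rw [h, noise, hP.meanConstr_eq hT]
  ring

/-- The supermartingale property of the mixture of the normalized noise. -/
lemma setLIntegral_mixture_le (hD : 0 < D) (hGg : 0 < Gg) {lam : ℝ} (hlam : 0 < lam)
    (hxm : ∀ t < T, Measurable[ℱ t ⊔ MeasurableSpace.comap (draw t) inferInstance] (x t))
    (hxX : ∀ t < T, ∀ ω, x t ω ∈ X) (i : Fin n) {t : ℕ} (ht : t < T) {B : Set Ω}
    (hB : MeasurableSet[ℱ t] B) :
    ∫⁻ ω in B, ENNReal.ofReal (mixture lam (fun s => x s ω)
        (fun s => noise μ a b x i s ω / ((Gg * D + 4 * F) / 2)) (t + 1)) ∂μ ≤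
      ∫⁻ ω in B, ENNReal.ofReal (mixture lam (fun s => x s ω)
        (fun s => noise μ a b x i s ω / ((Gg * D + 4 * F) / 2)) t) ∂μ := by
  classical
  set ρ := (Gg * D + 4 * F) / 2 with hρ
  have h𝒢le : ℱ t ⊔ MeasurableSpace.comap (draw t) inferInstance ≤ mΩ := (hP.sup_comap_le ht).trans (ℱ.le _)
  have hB' : MeasurableSet B := ℱ.le _ _ hB
  have hxt : ∀ s < t, Measurable[ℱ t] (x s) := fun s hs => hP.measurable_play hxm hs ht.le
  have het : ∀ s < t, Measurable[ℱ t] (fun ω => noise μ a b x i s ω / ρ) := fun s hs =>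
    (hP.measurable_noise hxm hs ht.le i).div_const _
  rw [← lintegral_indicator hB', ← lintegral_indicator hB']
  let S : Ω → Fin d → ℝ := fun ω => noiseSum (fun s => x s ω) (fun s => noise μ a b x i s ω / ρ) t
  let V : Ω → Matrix (Fin d) (Fin d) ℝ := fun ω => gram lam (fun s => x s ω) t
  let W₁ : Ω → ENNReal := B.indicator fun ω => ENNReal.ofReal (mixture lam (fun s => x s ω)
        (fun s => noise μ a b x i s ω / ρ) t)
  let r : Ω → ℝ := fun ω => invForm (V ω) (x t ω).ofLp (S ω)
  let q : Ω → ℝ := fun ω => invForm (V ω) (x t ω).ofLp (x t ω).ofLp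
  -- `W` collects what is known before the constraint of round `t` is revealed: the mixture on `B`,
  -- the two scalars of `mixture_succ` and the action.
  let W : Ω → ENNReal × ℝ × ℝ × Vec d := fun ω => (W₁ ω, r ω, q ω, x t ω)
  have hle : ℱ t ≤ ℱ t ⊔ MeasurableSpace.comap (draw t) inferInstance := le_sup_left
  have hVm : ∀ k l, Measurable[ℱ t ⊔ MeasurableSpace.comap (draw t) inferInstance] fun ω => V ω k l := fun k l =>
    (measurable_gram hxt k l).mono hle le_rfl
  have hSm : ∀ k, Measurable[ℱ t ⊔ MeasurableSpace.comap (draw t) inferInstance] fun ω => S ω k := fun k =>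
    (measurable_noiseSum hxt het k).mono hle le_rfl
  have hx𝒢 : ∀ k, Measurable[ℱ t ⊔ MeasurableSpace.comap (draw t) inferInstance] fun ω => (x t ω).ofLp k := measurable_ofLp_apply (hxm t ht)
  have hW₁ : Measurable[ℱ t ⊔ MeasurableSpace.comap (draw t) inferInstance] W₁ :=
    (((measurable_mixture hxt het).ennreal_ofReal).indicator hB).mono hle le_rfl
  have hW : Measurable[ℱ t ⊔ MeasurableSpace.comap (draw t) inferInstance] W := hW₁.prodMk ((measurable_invForm hVm hx𝒢 hSm).prodMk
    ((measurable_invForm hVm hx𝒢 hx𝒢).prodMk (hxm t ht)))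
  let e : Vec d → (Fin n → Vec d) × Vec n → ℝ := fun z p =>
    (constr p.1 p.2 z i - meanConstr μ a b z i) / ρ
  have he : Measurable (Function.uncurry e) := by
    simp only [e, constr_apply]
    refine Measurable.div_const (Measurable.sub (Measurable.sub (Measurable.inner ?_ measurable_fst)
      ?_) ?_) _
    · exact (measurable_pi_apply i).comp (measurable_fst.comp measurable_snd)
    · exact measurable_ofLp_apply (measurable_snd.comp measurable_snd) i
    · exact (hP.measurable_meanConstr (by omega) i).comp measurable_fst
  let h : ENNReal × ℝ × ℝ × Vec d → (Fin n → Vec d) × Vec n → ENNReal := fun w p =>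
    w.1 * ENNReal.ofReal (Real.exp ((2 * e w.2.2.2 p * w.2.1 + e w.2.2.2 p ^ 2 * w.2.2.1 -
      w.2.1 ^ 2) / (2 * (1 + w.2.2.1))) / √(1 + w.2.2.1))
  have hh : Measurable (Function.uncurry h) := measurable_mixture_factor he
  have key := lintegral_le_of_indep (μ := μ) h𝒢le hW (hP.constr_measurable ht) (hP.indep t ht) hh
    (g := W₁) ?_
  · refine le_trans (lintegral_mono fun ω => ?_) key
    by_cases hω : ω ∈ B
    · simp only [Set.indicator_of_mem hω, h, W, W₁]
      rw [mixture_succ hlam, ENNReal.ofReal_mul (mixture_nonneg _ _)]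
      rfl
    · simp [Set.indicator_of_notMem hω]
  · intro ω
    have hq0 : 0 ≤ q ω := invForm_self_nonneg (gram_posDef hlam t) _
    have hez : Measurable (e (x t ω)) := he.of_uncurry_left
    have hprob : IsProbabilityMeasure (μ.map fun ω => (a t ω, b t ω)) :=
      Measure.isProbabilityMeasure_map (hP.constr_measurable ht).aemeasurable
    simp only [h, W]
    rw [lintegral_const_mul _ (by fun_prop)]
    refine mul_le_of_le_one_right' ?_
    -- For `x_t = 0` the Gaussian would have variance zero, but then the factor is identically `1`.
    rcases eq_or_ne (x t ω).ofLp 0 with hz | hz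
    · have hq : q ω = 0 := by simp [q, hz, invForm]
      have hr : r ω = 0 := by simp [r, hz, invForm]
      simp [hq, hr]
    · have hsub := hP.lintegral_exp_le hD hGg ht (hxX t ht ω) i
      have hqpos : 0 < q ω := invForm_self_pos (gram_posDef hlam t) hz
      exact lintegral_exp_quadratic_le hez hsub hqpos (r ω)

/-- With probability at least `1 - δ`, the confidence ellipsoids of all rounds contain the mean
gradients of all constraints. -/
lemma exists_confidence (hD : 0 < D) (hGg : 0 < Gg) (hd : 2 ≤ d) (hn : 1 ≤ n) (hT : 0 < T)
    (hb : 0 < ⨅ i, limit μ a b i)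
    (hxm : ∀ t < T, Measurable[ℱ t ⊔ MeasurableSpace.comap (draw t) inferInstance] (x t))
    (hxX : ∀ t < T, ∀ ω, x t ω ∈ X) :
    ∃ B : Set Ω, MeasurableSet B ∧ μ.real B ≤ failProb D Gg (⨅ i, limit μ a b i) T ∧
      ∀ ω ∉ B, ∀ t ≤ T, ∀ (i : Fin n) (z : Vec d),
        |(estimate (params X (limit μ a b) D Gg F T).lam (fun s => x s ω)
          (fun s => feedback μ a b x s ω) t *ᵥ z.ofLp) i - inner ℝ (meanGrad μ a i) z| ≤
        (params X (limit μ a b) D Gg F T).beta t *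
          invNorm (gram (params X (limit μ a b) D Gg F T).lam (fun s => x s ω) t) z := by
  classical
  set I := params X (limit μ a b) D Gg F T with hI
  set δ := failProb D Gg (⨅ i, limit μ a b i) T with hδ
  have hδ0 : 0 < δ := failProb_pos hD hGg hb hT
  have hδ1 : δ ≤ 1 / 2 := min_le_left _ _
  have hn0 : (0 : ℝ) < n := by exact_mod_cast hn
  have hn1 : (1 : ℝ) ≤ n := by exact_mod_cast hn
  have hF := hP.F_nonneg hT
  have hlam1 : 1 ≤ I.lam := le_max_left _ _
  have hlam : 0 < I.lam := by linarith
  set ρ := (Gg * D + 4 * F) / 2 with hρ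
  have hρ0 : 0 < ρ := by positivity
  -- At the level `n / δ`, Ville's inequality leaves probability `δ / n` for each row, hence `δ` for
  -- their union.
  set c := (n : ℝ) / δ with hc
  have hc1 : 1 ≤ c := by rw [hc, le_div_iff₀ hδ0]; linarith
  let M : Fin n → ℕ → Ω → ENNReal := fun i t ω => ENNReal.ofReal (mixture I.lam (fun s => x s ω)
    (fun s => noise μ a b x i s ω / ρ) t)
  let B : Fin n → Set Ω := fun i => {ω | ∃ s ≤ T, ENNReal.ofReal c ≤ M i s ω}
  have hM : ∀ i, ∀ t ≤ T, Measurable[ℱ t] (M i t) := fun i t ht =>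
    (measurable_mixture (fun s hs => hP.measurable_play hxm hs ht)
      fun s hs => (hP.measurable_noise hxm hs ht i).div_const _).ennreal_ofReal
  have hBm : ∀ i, MeasurableSet (B i) := fun i => by
    have : B i = ⋃ s ∈ Set.Iic T, {ω | ENNReal.ofReal c ≤ M i s ω} := by ext ω; simp [B]
    rw [this]
    exact MeasurableSet.biUnion (Set.to_countable _) fun s hs =>
      ℱ.le _ _ (hM i s hs measurableSet_Ici)
  have hBμ : ∀ i, μ.real (B i) ≤ δ / n := fun i => by
    have h := measure_exists_le_of_supermartingale (hM i)
      (fun t ht B hB => hP.setLIntegral_mixture_le hD hGg hlam hxm hxX i ht hB)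
      (by simp [M, mixture_zero hlam]) (ENNReal.ofReal c)
    have h2 := ENNReal.toReal_mono ENNReal.one_ne_top h
    rw [ENNReal.toReal_mul, ENNReal.toReal_ofReal (by linarith), ENNReal.toReal_one] at h2
    have h3 : δ / n = 1 / c := by rw [hc, one_div_div]
    rw [h3, le_div_iff₀ (by linarith), mul_comm]
    exact h2
  refine ⟨⋃ i, B i, MeasurableSet.iUnion hBm, ?_, ?_⟩
  · calc μ.real (⋃ i, B i) ≤ ∑ i, μ.real (B i) := measureReal_iUnion_fintype_le _
      _ ≤ ∑ _i : Fin n, δ / n := Finset.sum_le_sum fun i _ => hBμ i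
      _ = δ := by simp; field_simp
  · intro ω hω t ht i z
    have hlt : mixture I.lam (fun s => x s ω) (fun s => noise μ a b x i s ω / ρ) t < c := by
      by_contra! h
      exact hω (Set.mem_iUnion.2 ⟨i, t, ht, ENNReal.ofReal_le_ofReal h⟩)
    have h1 := invForm_noiseSum_le_of_mixture_lt hlam hlt
    have h2 := logDet_le (x := fun s => x s ω) hlam (R := D / 2) (t := t)
      fun s hs => hP.norm_le _ (hxX s (by omega) ω)
    refine (abs_estimate_sub_le hlam (fun s _ => hP.feedback_apply hT s ω i) z).trans ?_
    refine mul_le_mul_of_nonneg_right ?_ (invNorm_nonneg _ _)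
    have hβ : I.beta t = ρ * √(d * Real.log ((1 + t * D ^ 2 / I.lam) / (δ / n))) +
      √I.lam * Gg := rfl
    rw [hβ]
    refine add_le_add ?_ (mul_le_mul_of_nonneg_left (hP.norm_meanGrad_le hT i) (Real.sqrt_nonneg _))
    have h3 : noiseSum (fun s => x s ω) (fun s => noise μ a b x i s ω) t =
        ρ • noiseSum (fun s => x s ω) (fun s => noise μ a b x i s ω / ρ) t := by
      rw [← noiseSum_const_mul]
      congr 1; ext s; field_simp
    rw [h3, invForm_smul_left, invForm_smul_right, ← mul_assoc,
      Real.sqrt_mul (mul_self_nonneg ρ), Real.sqrt_mul_self hρ0.le]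
    refine mul_le_mul_of_nonneg_left (Real.sqrt_le_sqrt (h1.trans ?_)) hρ0.le
    have hd' : (2 : ℝ) ≤ d := by exact_mod_cast hd
    have ht0 : (0 : ℝ) ≤ t := Nat.cast_nonneg t
    have h4 : Real.log (1 + t * (D / 2) ^ 2 / I.lam) ≤ Real.log (1 + t * D ^ 2 / I.lam) := by
      refine Real.log_le_log (by positivity) ?_
      gcongr
      linarith
    have h5 : Real.log ((1 + t * D ^ 2 / I.lam) / (δ / n)) =
        Real.log (1 + t * D ^ 2 / I.lam) + Real.log c := by
      rw [← Real.log_mul (by positivity) (by positivity), hc]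
      congr 1; field_simp
    -- Here `d ≥ 2` is used: it absorbs `2 log c` into `d log c`, as the form of `β_t` requires.
    rw [h5]
    nlinarith [Real.log_nonneg hc1]

end IsProblem

end Confidence

/-! ### Safety and regret decomposition along a run -/

section Core

set_option linter.unusedSectionVars false

variable {Ω Z : Type*} [mΩ : MeasurableSpace Ω] [MeasurableSpace Z] {μ : Measure Ω}
  [IsProbabilityMeasure μ] {ℱ : Filtration ℕ mΩ} {T : ℕ} {D G Gg F : ℝ} {X : Set (Vec d)}
  {f : ℕ → Ω → Vec d → ℝ} {a : ℕ → Ω → Fin n → Vec d} {b : ℕ → Ω → Vec n} {draw : ℕ → Ω → Z}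
  {x : ℕ → Ω → Vec d}

/-! ### The inputs of OSOCO -/

section Params

variable {bv : Fin n → ℝ}

lemma one_le_lam : 1 ≤ (params X bv D Gg F T).lam := le_max_left _ _

lemma sq_le_lam : D ^ 2 ≤ (params X bv D Gg F T).lam := le_max_right _ _

lemma lam_pos : 0 < (params X bv D Gg F T).lam := one_pos.trans_le one_le_lam

lemma beta_eq (t : ℕ) : (params X bv D Gg F T).beta t = (Gg * D + 4 * F) / 2 *
    √(d * Real.log ((1 + t * D ^ 2 / (params X bv D Gg F T).lam) /
      (failProb D Gg (⨅ i, bv i) T / n))) + √(params X bv D Gg F T).lam * Gg := rfl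

lemma beta_nonneg (hD : 0 < D) (hGg : 0 < Gg) (hF : 0 ≤ F) (t : ℕ) :
    0 ≤ (params X bv D Gg F T).beta t := by
  rw [beta_eq]; positivity

lemma beta_mono (hD : 0 < D) (hGg : 0 < Gg) (hF : 0 ≤ F) (hT : 0 < T) (hn : 1 ≤ n)
    (hb : 0 < ⨅ i, bv i) : Monotone (params X bv D Gg F T).beta := by
  intro s t hst
  have h1 := failProb_pos hD hGg hb hT
  have h2 := lam_pos (X := X) (bv := bv) (D := D) (Gg := Gg) (F := F) (T := T)
  have h3 : (0 : ℝ) < n := by exact_mod_cast hn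
  rw [beta_eq, beta_eq]
  have h4 : (0 : ℝ) < 1 + s * D ^ 2 / (params X bv D Gg F T).lam := by positivity
  gcongr

lemma iInf_le_apply (i : Fin n) : ⨅ i, bv i ≤ bv i := ciInf_le (Set.finite_range bv).bddBelow i

lemma kappa_eq : (params X bv D Gg F T).kappa = (⨅ i, bv i) / T := rfl

lemma kappa_le (hT : 0 < T) (hb : 0 < ⨅ i, bv i) (i : Fin n) :
    (params X bv D Gg F T).kappa ≤ (params X bv D Gg F T).b i := by
  have : (1 : ℝ) ≤ T := by exact_mod_cast hT
  exact (div_le_self hb.le this).trans (iInf_le_apply i)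

lemma half_le_sub_kappa (hT : 2 ≤ T) (hb : 0 < ⨅ i, bv i) (i : Fin n) :
    (⨅ i, bv i) / 2 ≤ (params X bv D Gg F T).b i - (params X bv D Gg F T).kappa := by
  have h1 : (2 : ℝ) ≤ T := by exact_mod_cast hT
  have h2 : (⨅ i, bv i) / T ≤ (⨅ i, bv i) / 2 := by gcongr
  have h3 : ⨅ i, bv i ≤ (params X bv D Gg F T).b i := iInf_le_apply i
  rw [kappa_eq]
  linarith

end Params

namespace IsProblem

variable (hP : IsProblem μ ℱ T D G Gg F X f a b draw)
include hP

/-! ### No expected violation -/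

/-- Independence turns the expected constraint value into the expectation of `meanConstr` at the
played point. Outside `B` the pessimistic constraint and the confidence bound give at most `-κ`. On
`B` the value is at most `G_g D / 2 - κ`, because `κ ≤ b_i`. The choice of `δ` makes the
contribution of `G_g D / 2` at most `κ / 4`. -/
lemma noExpectedViolation (hD : 0 < D) (hGg : 0 < Gg) (hd : 2 ≤ d) (hn : 1 ≤ n) (hT : 0 < T)
    (hb : 0 < ⨅ i, limit μ a b i)
    (hxm : ∀ t < T, Measurable[ℱ t ⊔ MeasurableSpace.comap (draw t) inferInstance] (x t))
    (hx : ∀ t < T, ∀ ω, x t ω ∈ pessSet (params X (limit μ a b) D Gg F T) (fun s => x s ω)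
      (fun s => feedback μ a b x s ω)
      (phaseStart (params X (limit μ a b) D Gg F T).lam (fun s => x s ω) t)) :
    NoExpectedViolation μ T a b x := by
  have hxX : ∀ t < T, ∀ ω, x t ω ∈ X := fun t ht ω => (hx t ht ω).1
  obtain ⟨B, hB, hBμ, hconf⟩ := hP.exists_confidence hD hGg hd hn hT hb hxm hxX
  intro t ht i
  have hmeas : Measurable fun ω => constr (a t ω) (b t ω) (x t ω) i :=
    (hP.measurable_constr_play hxm (Nat.lt_succ_self t) ht i).mono (ℱ.le _) le_rfl
  have hint : Integrable (fun ω => constr (a t ω) (b t ω) (x t ω) i) μ :=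
    Integrable.of_bound hmeas.aestronglyMeasurable (Gg * (D / 2) + F)
      ((hP.abs_constr_le ht).mono fun ω h => h _ (hxX t ht ω) i)
  refine ⟨hint, ?_⟩
  have hcm : Measurable (Function.uncurry fun (z : Vec d) (p : (Fin n → Vec d) × Vec n) =>
      constr p.1 p.2 z i) := by
    simp only [constr_apply]
    refine Measurable.sub (Measurable.inner ?_ measurable_fst) ?_
    · exact (measurable_pi_apply i).comp (measurable_fst.comp measurable_snd)
    · exact measurable_ofLp_apply (measurable_snd.comp measurable_snd) i
  have h1 := integral_eq_of_indep (μ := μ) ((hP.sup_comap_le ht).trans (ℱ.le _)) (hxm t ht)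
    (hP.constr_measurable ht) (hP.indep t ht) hcm hint
  simp only [hP.meanConstr_eq_integral_map hT ht] at h1
  rw [h1]
  set bmin := ⨅ i, limit μ a b i with hbmin
  have hT0 : (0 : ℝ) < T := by exact_mod_cast hT
  have hbound : ∀ ω, meanConstr μ a b (x t ω) i ≤
      -(bmin / T) + B.indicator (fun _ => Gg * (D / 2)) ω := by
    intro ω
    rw [hP.meanConstr_eq hT]
    have hk := kappa_le (X := X) (D := D) (Gg := Gg) (F := F) hT hb i
    rw [kappa_eq] at hk
    have hk : bmin / T ≤ limit μ a b i := hk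
    by_cases hω : ω ∈ B
    · rw [Set.indicator_of_mem hω]
      have h2 : inner ℝ (meanGrad μ a i) (x t ω) ≤ Gg * (D / 2) :=
        (real_inner_le_norm _ _).trans (mul_le_mul (hP.norm_meanGrad_le hT i)
          (hP.norm_le _ (hxX t ht ω)) (norm_nonneg _) hGg.le)
      linarith
    · rw [Set.indicator_of_notMem hω]
      have h2 := hconf ω hω (phaseStart (params X (limit μ a b) D Gg F T).lam (fun s => x s ω) t)
        ((phaseStart_le t).trans ht.le) i (x t ω)
      have h3 := (hx t ht ω).2 i
      have h4 : (params X (limit μ a b) D Gg F T).b i = limit μ a b i := rfl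
      rw [kappa_eq, h4] at h3
      have h5 := (abs_le.1 h2).1
      linarith
  have hintB : Integrable (fun ω => -(bmin / T) + B.indicator (fun _ => Gg * (D / 2)) ω) μ :=
    (integrable_const _).add ((integrable_const _).indicator hB)
  have hmc : Integrable (fun ω => meanConstr μ a b (x t ω) i) μ := by
    refine Integrable.of_bound (((hP.measurable_meanConstr hT i).comp
      ((hxm t ht).mono ((hP.sup_comap_le ht).trans (ℱ.le _)) le_rfl)).aestronglyMeasurable)
      (Gg * (D / 2) + |limit μ a b i|) (Filter.Eventually.of_forall fun ω => ?_)
    rw [hP.meanConstr_eq hT, Real.norm_eq_abs]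
    refine (abs_sub _ _).trans (add_le_add_left ?_ _)
    exact (abs_real_inner_le_norm _ _).trans (mul_le_mul (hP.norm_meanGrad_le hT i)
          (hP.norm_le _ (hxX t ht ω)) (norm_nonneg _) hGg.le)
  refine (integral_mono hmc hintB hbound).trans ?_
  rw [integral_add (integrable_const _) ((integrable_const _).indicator hB), integral_const,
    integral_indicator_const _ hB]
  simp only [probReal_univ, smul_eq_mul, one_mul]
  have h6 : μ.real B * (Gg * (D / 2)) ≤ bmin / (2 * Gg * D * T) * (Gg * (D / 2)) := by
    gcongr
    exact hBμ.trans (min_le_right _ _)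
  have h7 : bmin / (2 * Gg * D * T) * (Gg * (D / 2)) = bmin / T / 4 := by field_simp; norm_num
  have h8 : 0 < bmin / T := by positivity
  linarith

/-! ### The regret as a random variable -/

lemma measurable_cost_comp {t : ℕ} (ht : t < T) {w : Ω → Vec d} :
    ∀ {m : MeasurableSpace Ω}, ℱ t ≤ m → Measurable[m] w → (∀ ω, w ω ∈ X) →
      Measurable[m] fun ω => f t ω (w ω) := by
  have hc := hP.cost_measurable t ht
  intro m hm hw hwX
  have h : @Measurable Ω (Ω × X) m ((ℱ t).prod inferInstance) fun ω => (ω, ⟨w ω, hwX ω⟩) :=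
    @Measurable.prodMk _ _ _ (_) (ℱ t) _ _ _ (measurable_id'' hm) hw.subtype_mk
  exact hc.comp h

lemma abs_cost_sub_le (hG : 0 < G) {t : ℕ} (ht : t < T) (ω : Ω) {z w : Vec d} (hz : z ∈ X)
    (hw : w ∈ X) : |f t ω z - f t ω w| ≤ G * D := by
  refine ((hP.cost t ht ω).abs_sub_le hz hw).trans ?_
  have := norm_sub_le z w
  have h1 := hP.norm_le z hz
  have h2 := hP.norm_le w hw
  gcongr
  linarith

lemma isCompact_feasible (hT : 0 < T) :
    IsCompact {z ∈ X | ∀ i, meanConstr μ a b z i ≤ 0} := by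
  refine Metric.isCompact_of_isClosed_isBounded ?_ ?_
  · simp only [hP.meanConstr_eq hT]
    exact isClosed_sep_forall_le hP.closed fun i =>
      (continuous_const.inner continuous_id).sub continuous_const
  · exact isBounded_iff_forall_norm_le.2 ⟨D / 2, fun z hz => hP.norm_le z hz.1⟩

lemma zero_mem_feasible : (0 : Vec d) ∈ {z ∈ X | ∀ i, meanConstr μ a b z i ≤ 0} :=
  ⟨hP.zero_mem, fun i => (hP.slater i).le⟩

lemma continuousOn_sum_cost (ω : Ω) :
    ContinuousOn (fun z => ∑ t ∈ Finset.range T, f t ω z) X :=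
  continuousOn_finsetSum _ fun t ht => (hP.cost t (Finset.mem_range.1 ht) ω).continuousOn

lemma exists_comparator (hT : 0 < T) (ω : Ω) :
    ∃ u ∈ {z ∈ X | ∀ i, meanConstr μ a b z i ≤ 0},
      (∀ z ∈ {z ∈ X | ∀ i, meanConstr μ a b z i ≤ 0},
        ∑ t ∈ Finset.range T, f t ω u ≤ ∑ t ∈ Finset.range T, f t ω z) ∧
      sInf ((fun z => ∑ t ∈ Finset.range T, f t ω z) ''
        {z ∈ X | ∀ i, meanConstr μ a b z i ≤ 0}) = ∑ t ∈ Finset.range T, f t ω u := by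
  obtain ⟨u, hu, hmin⟩ := (hP.isCompact_feasible hT).exists_isMinOn ⟨0, hP.zero_mem_feasible⟩
    ((hP.continuousOn_sum_cost ω).mono fun z hz => hz.1)
  refine ⟨u, hu, fun z hz => hmin hz, ?_⟩
  exact IsLeast.csInf_eq ⟨⟨u, hu, rfl⟩, by rintro _ ⟨z, hz, rfl⟩; exact hmin hz⟩

lemma measurable_regret (hT : 0 < T)
    (hxm : ∀ t < T, Measurable[ℱ t ⊔ MeasurableSpace.comap (draw t) inferInstance] (x t))
    (hxX : ∀ t < T, ∀ ω, x t ω ∈ X) : Measurable (regret μ T X f a b x) := by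
  refine Measurable.sub (Finset.measurable_sum _ fun t ht => ?_) ?_
  · have ht := Finset.mem_range.1 ht
    exact hP.measurable_cost_comp ht (ℱ.le t)
      ((hxm t ht).mono ((hP.sup_comap_le ht).trans (ℱ.le _)) le_rfl) (hxX t ht)
  · set S := {z ∈ X | ∀ i, meanConstr μ a b z i ≤ 0} with hS
    have : Nonempty S := ⟨⟨0, hP.zero_mem_feasible⟩⟩
    -- The cumulative cost is continuous on the feasible set, so its minimum is an infimum over a
    -- countable dense subset, which is measurable in `ω`.
    let z : ℕ → S := TopologicalSpace.denseSeq S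
    have heq : ∀ ω, sInf ((fun z => ∑ t ∈ Finset.range T, f t ω z) '' S) =
        ⨅ k, ∑ t ∈ Finset.range T, f t ω (z k) := by
      intro ω
      obtain ⟨u, hu, hmin, hval⟩ := hP.exists_comparator hT ω
      rw [hval]
      refine le_antisymm (le_ciInf fun k => hmin _ (z k).2) (le_of_forall_pos_le_add fun ε hε => ?_)
      have hc : Continuous fun w : S => ∑ t ∈ Finset.range T, f t ω w :=
        continuousOn_iff_continuous_domRestrict.1
          ((hP.continuousOn_sum_cost ω).mono fun z hz => hz.1)
      have hopen : IsOpen {w : S | ∑ t ∈ Finset.range T, f t ω w <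
          ∑ t ∈ Finset.range T, f t ω u + ε} := isOpen_lt hc continuous_const
      obtain ⟨k, hk⟩ := (TopologicalSpace.denseRange_denseSeq S).exists_mem_open hopen
        ⟨⟨u, hu⟩, lt_add_of_pos_right _ hε⟩
      exact (ciInf_le ⟨_, by rintro _ ⟨k, rfl⟩; exact hmin _ (z k).2⟩ k).trans hk.le
    simp only [heq]
    refine Measurable.iInf fun k => Finset.measurable_sum _ fun t ht => ?_
    exact hP.measurable_cost_comp (Finset.mem_range.1 ht) (ℱ.le t) measurable_const
      fun _ => (z k).2.1

lemma integrable_regret (hG : 0 < G) (hT : 0 < T)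
    (hxm : ∀ t < T, Measurable[ℱ t ⊔ MeasurableSpace.comap (draw t) inferInstance] (x t))
    (hxX : ∀ t < T, ∀ ω, x t ω ∈ X) : Integrable (regret μ T X f a b x) μ := by
  refine Integrable.of_bound (hP.measurable_regret hT hxm hxX).aestronglyMeasurable (T * (G * D))
    (Filter.Eventually.of_forall fun ω => ?_)
  obtain ⟨u, hu, -, hval⟩ := hP.exists_comparator hT ω
  rw [regret, hval, ← Finset.sum_sub_distrib]
  refine (norm_sum_le _ _).trans ?_
  calc _ ≤ ∑ t ∈ Finset.range T, G * D := Finset.sum_le_sum fun t ht =>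
        hP.abs_cost_sub_le hG (Finset.mem_range.1 ht) ω
          (hxX t (Finset.mem_range.1 ht) ω) hu.1
    _ = _ := by simp

/-! ### The regret of OSOCO in terms of the regret of its online algorithm -/

/-- The cost of scaling the proposals `xt` into the pessimistic sets. -/
lemma sum_cost_play_sub_le (hD : 0 < D) (hG : 0 < G) (hGg : 0 < Gg) (hn : 1 ≤ n) (hT : 2 ≤ T)
    (hb : 0 < ⨅ i, limit μ a b i) {xt : ℕ → Ω → Vec d} {θ : ℝ} (hθ : 0 ≤ θ) {ω : Ω}
    (hxt : ∀ t < T, xt t ω ∈ X ∧ ∀ i, (estimate (params X (limit μ a b) D Gg F T).lam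
        (fun s => x s ω) (fun s => feedback μ a b x s ω)
        (phaseStart (params X (limit μ a b) D Gg F T).lam (fun s => x s ω) t) *ᵥ
          (xt t ω).ofLp) i -
      θ * ((params X (limit μ a b) D Gg F T).beta
          (phaseStart (params X (limit μ a b) D Gg F T).lam (fun s => x s ω) t) *
        invNorm (gram (params X (limit μ a b) D Gg F T).lam (fun s => x s ω)
          (phaseStart (params X (limit μ a b) D Gg F T).lam (fun s => x s ω) t)) (xt t ω)) ≤
      limit μ a b i - (params X (limit μ a b) D Gg F T).kappa)
    (hplay : ∀ t < T, x t ω = safeScale (pessSet (params X (limit μ a b) D Gg F T)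
      (fun s => x s ω) (fun s => feedback μ a b x s ω)
      (phaseStart (params X (limit μ a b) D Gg F T).lam (fun s => x s ω) t)) (xt t ω) • xt t ω)
    (hxX : ∀ t < T, x t ω ∈ X) :
    ∑ t ∈ Finset.range T, (f t ω (x t ω) - f t ω (xt t ω)) ≤
      G * (D / 2) * ((1 + θ) * (params X (limit μ a b) D Gg F T).beta T /
        ((⨅ i, limit μ a b i) / 2)) *
        √(T * (4 * logDet (params X (limit μ a b) D Gg F T).lam (fun s => x s ω) T)) := by
  set I := params X (limit μ a b) D Gg F T with hI
  set c := (⨅ i, limit μ a b i) / 2 with hc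
  have hc0 : 0 < c := by positivity
  have hF := hP.F_nonneg (by omega)
  have hβ0 := beta_nonneg (X := X) (bv := limit μ a b) (T := T) hD hGg hF
  have hβm := beta_mono (X := X) (bv := limit μ a b) hD hGg hF (by omega : 0 < T) hn hb
  -- The potential argument applies to the played points; `D² ≤ λ` supplies its norm condition.
  have hsum := sum_invNorm_phase_le (x := fun s => x s ω) (lam := I.lam) lam_pos (T := T)
    fun t ht => by
      have h1 := hP.norm_le _ (hxX t ht)
      have h2 : ‖x t ω‖ ^ 2 ≤ D ^ 2 := pow_le_pow_left₀ (norm_nonneg _) (by linarith) 2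
      exact h2.trans sq_le_lam
  refine le_trans ?_ (mul_le_mul_of_nonneg_left hsum (by have := hβ0 T; positivity))
  rw [Finset.mul_sum]
  refine Finset.sum_le_sum fun t ht => ?_
  have ht := Finset.mem_range.1 ht
  obtain ⟨hX, hopt⟩ := hxt t ht
  set t₀ := phaseStart I.lam (fun s => x s ω) t with ht₀
  have ht₀T : t₀ ≤ T := (phaseStart_le t).trans ht.le
  have hscale := one_sub_safeScale_le (I := I) (x := fun s => x s ω)
    (y := fun s => feedback μ a b x s ω) (t₀ := t₀) hP.convex hP.zero_mem hP.closed hθ (hβ0 t₀) hc0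
    (fun i => half_le_sub_kappa hT hb i) hX hopt
  have hmem := safeScale_mem (isClosed_pessSet (I := I) (x := fun s => x s ω)
    (y := fun s => feedback μ a b x s ω) (t₀ := t₀) hP.closed)
    (zero_mem_pessSet hP.zero_mem fun i => kappa_le (by omega) hb i) (xt t ω)
  have hplay := hplay t ht
  rw [← hplay] at hscale
  set γ := safeScale (pessSet I (fun s => x s ω) (fun s => feedback μ a b x s ω) t₀) (xt t ω)
  have h1 : ‖x t ω - xt t ω‖ = (1 - γ) * ‖xt t ω‖ := by
    rw [hplay, norm_sub_rev]
    have : xt t ω - γ • xt t ω = (1 - γ) • xt t ω := by module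
    rw [this, norm_smul, Real.norm_of_nonneg (by linarith [hmem.1.2])]
  calc f t ω (x t ω) - f t ω (xt t ω) ≤ G * ‖x t ω - xt t ω‖ :=
        (hP.cost t ht ω).sub_le (hxX t ht) hX
    _ ≤ G * ((1 - γ) * (D / 2)) := by
        rw [h1]
        have := hmem.1.2
        have h2 : 0 ≤ 1 - γ := by linarith
        gcongr
        exact hP.norm_le _ hX
    _ ≤ G * (((1 + θ) * I.beta T / c * invNorm (gram I.lam (fun s => x s ω) t₀) (x t ω)) *
        (D / 2)) := by
        have h3 := invNorm_nonneg (gram I.lam (fun s => x s ω) t₀) (x t ω)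
        have h4 := hβm ht₀T
        gcongr
        refine hscale.trans ?_
        gcongr
    _ = _ := by ring

/-- The regret of the proposals outside the failure event. -/
lemma sum_loss_sub_le (hD : 0 < D) (hG : 0 < G) (hT : 2 ≤ T)
    {lb : ℕ → ℝ} {C : ℝ} (hC : 0 ≤ C) {ω : Ω}
    (hconf : ∀ t ≤ T, ∀ (i : Fin n) (z : Vec d),
        |(estimate (params X (limit μ a b) D Gg F T).lam (fun s => x s ω)
          (fun s => feedback μ a b x s ω) t *ᵥ z.ofLp) i - inner ℝ (meanGrad μ a i) z| ≤
        (params X (limit μ a b) D Gg F T).beta t *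
          invNorm (gram (params X (limit μ a b) D Gg F T).lam (fun s => x s ω) t) z)
    (hphase : ∀ t < T, ∀ u ∈ optSet (params X (limit μ a b) D Gg F T) (fun s => x s ω)
        (fun s => feedback μ a b x s ω)
        (phaseStart (params X (limit μ a b) D Gg F T).lam (fun s => x s ω) t),
      ∑ s ∈ Finset.Ico (phaseStart (params X (limit μ a b) D Gg F T).lam (fun s => x s ω) t)
        (t + 1), (lb s - (f s ω u - f s ω 0)) ≤
      C * √((t + 1 - phaseStart (params X (limit μ a b) D Gg F T).lam
        (fun s => x s ω) t : ℕ) : ℝ))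
    {u : Vec d} (hu : u ∈ {z ∈ X | ∀ i, meanConstr μ a b z i ≤ 0}) :
    ∑ t ∈ Finset.range T, (lb t - (f t ω u - f t ω 0)) ≤
      C * √((1 + logDet (params X (limit μ a b) D Gg F T).lam (fun s => x s ω) T / Real.log 2) *
        T) + G * D / 2 := by
  set I := params X (limit μ a b) D Gg F T with hI
  have hT1 : (1 : ℝ) ≤ T := by exact_mod_cast (by omega : 1 ≤ T)
  have hT0 : (0 : ℝ) < T := by linarith
  have hTinv : (T : ℝ)⁻¹ ≤ 1 := inv_le_one_of_one_le₀ hT1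
  have hTinv0 : (0 : ℝ) < (T : ℝ)⁻¹ := by positivity
  -- Shrinking the comparator gains `b_i / T ≥ κ` in every constraint, so on the confidence event it
  -- lies in the optimistic set of every phase. It moves by at most `D / (2 T)`, which costs `G D /
  -- 2` over all rounds.
  set v := (1 - (T : ℝ)⁻¹) • u with hv
  have hvX : v ∈ X := by
    have := hP.convex hP.zero_mem hu.1 hTinv0.le (show 0 ≤ 1 - (T : ℝ)⁻¹ by linarith) (by ring)
    simpa using this
  have hvopt : ∀ t < T, v ∈ optSet I (fun s => x s ω) (fun s => feedback μ a b x s ω)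
      (phaseStart I.lam (fun s => x s ω) t) := fun t ht => by
    refine ⟨hvX, fun i => ?_⟩
    have h1 := (abs_le.1 (hconf (phaseStart I.lam (fun s => x s ω) t)
      ((phaseStart_le t).trans ht.le) i v)).2
    have h2 := hu.2 i
    rw [hP.meanConstr_eq (by omega)] at h2
    have h3 : inner ℝ (meanGrad μ a i) v = (1 - (T : ℝ)⁻¹) * inner ℝ (meanGrad μ a i) u := by
      rw [hv, inner_smul_right]
    have h4 : (1 - (T : ℝ)⁻¹) * inner ℝ (meanGrad μ a i) u ≤
        (1 - (T : ℝ)⁻¹) * limit μ a b i :=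
      mul_le_mul_of_nonneg_left (by linarith) (by linarith)
    have h5 : (T : ℝ)⁻¹ * (⨅ i, limit μ a b i) ≤ (T : ℝ)⁻¹ * limit μ a b i :=
      mul_le_mul_of_nonneg_left (iInf_le_apply i) hTinv0.le
    have h6 : I.kappa = (T : ℝ)⁻¹ * (⨅ i, limit μ a b i) := by
      rw [hI, kappa_eq, div_eq_inv_mul]
    have h7 : I.b i = limit μ a b i := rfl
    rw [h6, h7]
    linarith
  have hagg := sum_le_of_phase_le (x := fun s => x s ω) (lam := I.lam) lam_pos hC
    (r := fun s => lb s - (f s ω v - f s ω 0)) fun t ht => hphase t ht v (hvopt t ht)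
  have hcomp : ∑ t ∈ Finset.range T, (f t ω v - f t ω u) ≤ G * D / 2 := by
    calc _ ≤ ∑ t ∈ Finset.range T, G * ((T : ℝ)⁻¹ * (D / 2)) := by
          refine Finset.sum_le_sum fun t ht => ?_
          refine ((hP.cost t (Finset.mem_range.1 ht) ω).sub_le hvX hu.1).trans ?_
          have : v - u = (-(T : ℝ)⁻¹) • u := by rw [hv]; module
          rw [this, norm_smul, norm_neg, Real.norm_of_nonneg hTinv0.le]
          have := hP.norm_le u hu.1
          gcongr
      _ = _ := by
          simp only [Finset.sum_const, Finset.card_range, nsmul_eq_mul]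
          field_simp
  calc _ = ∑ t ∈ Finset.range T, (lb t - (f t ω v - f t ω 0)) +
        ∑ t ∈ Finset.range T, (f t ω v - f t ω u) := by
        rw [← Finset.sum_add_distrib]
        exact Finset.sum_congr rfl fun t _ => by ring
    _ ≤ _ := add_le_add hagg hcomp

end IsProblem

end Core

/-! ### Expected regret -/

section ExpectedRegret

set_option linter.unusedSectionVars false

variable {Ω Z : Type*} [mΩ : MeasurableSpace Ω] [MeasurableSpace Z] {μ : Measure Ω}
  [IsProbabilityMeasure μ] {ℱ : Filtration ℕ mΩ} {T : ℕ} {D G Gg F : ℝ} {X : Set (Vec d)}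
  {f : ℕ → Ω → Vec d → ℝ} {a : ℕ → Ω → Fin n → Vec d} {b : ℕ → Ω → Vec n} {draw : ℕ → Ω → Z}
  {x : ℕ → Ω → Vec d}

namespace IsProblem

variable (hP : IsProblem μ ℱ T D G Gg F X f a b draw)
include hP

/-- The expected regret of OSOCO when the proposals `xt` lie in the optimistic sets relaxed by a
factor `θ`, have conditional expected centred costs `lb`, and have regret `C` in every phase. -/
lemma integral_regret_le (hD : 0 < D) (hG : 0 < G) (hGg : 0 < Gg) (hd : 2 ≤ d) (hn : 1 ≤ n)
    (hT : 2 ≤ T) (hb : 0 < ⨅ i, limit μ a b i)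
    (hxm : ∀ t < T, Measurable[ℱ t ⊔ MeasurableSpace.comap (draw t) inferInstance] (x t))
    (hxX : ∀ t < T, ∀ ω, x t ω ∈ X)
    {xt : ℕ → Ω → Vec d} {lb : ℕ → Ω → ℝ} {θ C : ℝ} (hθ : 0 ≤ θ) (hC : 0 ≤ C)
    (hplay : ∀ t < T, ∀ ω, x t ω = safeScale (pessSet (params X (limit μ a b) D Gg F T)
      (fun s => x s ω) (fun s => feedback μ a b x s ω)
      (phaseStart (params X (limit μ a b) D Gg F T).lam (fun s => x s ω) t)) (xt t ω) • xt t ω)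
    (hxt : ∀ᵐ ω ∂μ, ∀ t < T, xt t ω ∈ X ∧
      ∀ i, (estimate (params X (limit μ a b) D Gg F T).lam
        (fun s => x s ω) (fun s => feedback μ a b x s ω)
        (phaseStart (params X (limit μ a b) D Gg F T).lam (fun s => x s ω) t) *ᵥ
          (xt t ω).ofLp) i -
      θ * ((params X (limit μ a b) D Gg F T).beta
          (phaseStart (params X (limit μ a b) D Gg F T).lam (fun s => x s ω) t) *
        invNorm (gram (params X (limit μ a b) D Gg F T).lam (fun s => x s ω)
          (phaseStart (params X (limit μ a b) D Gg F T).lam (fun s => x s ω) t)) (xt t ω)) ≤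
      limit μ a b i - (params X (limit μ a b) D Gg F T).kappa)
    (hexp : ∀ t < T, Integrable (fun ω => f t ω (xt t ω) - f t ω 0 - lb t ω) μ ∧
      ∫ ω, (f t ω (xt t ω) - f t ω 0 - lb t ω) ∂μ = 0)
    (hlb : ∀ᵐ ω ∂μ, ∀ t < T, lb t ω ≤ G * (D / 2))
    (hphase : ∀ᵐ ω ∂μ, ∀ t < T, ∀ u ∈ optSet (params X (limit μ a b) D Gg F T) (fun s => x s ω)
        (fun s => feedback μ a b x s ω)
        (phaseStart (params X (limit μ a b) D Gg F T).lam (fun s => x s ω) t),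
      ∑ s ∈ Finset.Ico (phaseStart (params X (limit μ a b) D Gg F T).lam (fun s => x s ω) t)
        (t + 1), (lb s ω - (f s ω u - f s ω 0)) ≤
      C * √((t + 1 - phaseStart (params X (limit μ a b) D Gg F T).lam
        (fun s => x s ω) t : ℕ) : ℝ)) :
    ∫ ω, regret μ T X f a b x ω ∂μ ≤
      G * (D / 2) * ((1 + θ) * (params X (limit μ a b) D Gg F T).beta T /
        ((⨅ i, limit μ a b i) / 2)) * √(T * (4 * (d * Real.log (1 + T)))) +
      C * √((1 + d * Real.log (1 + T) / Real.log 2) * T) + G * D / 2 +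
      failProb D Gg (⨅ i, limit μ a b i) T * (T * (G * D)) := by
  have hT0 : 0 < T := by omega
  obtain ⟨B, hB, hBμ, hconf⟩ := hP.exists_confidence hD hGg hd hn hT0 hb hxm hxX
  set I := params X (limit μ a b) D Gg F T with hI
  have hlog2 : 0 < Real.log 2 := Real.log_pos (by norm_num)
  have hlogDet : ∀ ω, logDet I.lam (fun s => x s ω) T ≤ d * Real.log (1 + T) := fun ω => by
    refine (logDet_le lam_pos (R := D / 2) fun s hs => hP.norm_le _ (hxX s hs ω)).trans ?_
    have h1 : 0 < I.lam := lam_pos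
    have h2 : D ^ 2 ≤ I.lam := sq_le_lam
    have h3 : T * (D / 2) ^ 2 / I.lam ≤ (T : ℝ) := by
      rw [div_le_iff₀ h1]
      gcongr
      nlinarith
    gcongr
  set A := G * (D / 2) * ((1 + θ) * I.beta T / ((⨅ i, limit μ a b i) / 2)) *
    √(T * (4 * (d * Real.log (1 + T)))) with hA
  set R := C * √((1 + d * Real.log (1 + T) / Real.log 2) * T) + G * D / 2 with hR
  have hR0 : 0 ≤ R := by positivity
  have hpt : ∀ᵐ ω ∂μ, regret μ T X f a b x ω ≤ (A + R) +
      ∑ t ∈ Finset.range T, (f t ω (xt t ω) - f t ω 0 - lb t ω) +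
      B.indicator (fun _ => T * (G * D)) ω := by
    filter_upwards [hxt, hlb, hphase] with ω h1 h2 h3
    obtain ⟨u, hu, -, hval⟩ := hP.exists_comparator hT0 ω
    have h4 := hP.sum_cost_play_sub_le hD hG hGg hn hT hb hθ h1 (fun t ht => hplay t ht ω)
      fun t ht => hxX t ht ω
    have h5 : ∑ t ∈ Finset.range T, (f t ω (x t ω) - f t ω (xt t ω)) ≤ A := by
      refine h4.trans (mul_le_mul_of_nonneg_left (Real.sqrt_le_sqrt ?_) ?_)
      · have := hlogDet ω
        gcongr
      · have := beta_nonneg (X := X) (bv := limit μ a b) (T := T) hD hGg (hP.F_nonneg hT0) T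
        positivity
    have h6 : ∑ t ∈ Finset.range T, (lb t ω - (f t ω u - f t ω 0)) ≤
        R + B.indicator (fun _ => T * (G * D)) ω := by
      -- On the failure event nothing is known about the optimistic sets, and every round is charged
      -- `G D`.
      by_cases hω : ω ∈ B
      · rw [Set.indicator_of_mem hω]
        have h7 : ∑ t ∈ Finset.range T, (lb t ω - (f t ω u - f t ω 0)) ≤
            ∑ t ∈ Finset.range T, G * D := by
          refine Finset.sum_le_sum fun t ht => ?_
          have ht := Finset.mem_range.1 ht
          have h8 := (hP.cost t ht ω).sub_le hP.zero_mem hu.1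
          have h9 : G * ‖(0 : Vec d) - u‖ ≤ G * (D / 2) := by
            rw [zero_sub, norm_neg]
            have := hP.norm_le u hu.1
            gcongr
          linarith [h2 t ht]
        simp only [Finset.sum_const, Finset.card_range, nsmul_eq_mul] at h7
        linarith
      · rw [Set.indicator_of_notMem hω, add_zero]
        refine (hP.sum_loss_sub_le hD hG hT hC (lb := fun t => lb t ω) (hconf ω hω) h3 hu).trans ?_
        have := hlogDet ω
        rw [hR]
        gcongr
    rw [regret, hval]
    -- Scaling loss, sampling noise of mean zero, and regret of the sampling distributions.
    have h10 : ∑ t ∈ Finset.range T, f t ω (x t ω) - ∑ t ∈ Finset.range T, f t ω u =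
        ∑ t ∈ Finset.range T, (f t ω (x t ω) - f t ω (xt t ω)) +
        ∑ t ∈ Finset.range T, (f t ω (xt t ω) - f t ω 0 - lb t ω) +
        ∑ t ∈ Finset.range T, (lb t ω - (f t ω u - f t ω 0)) := by
      rw [← Finset.sum_sub_distrib, ← Finset.sum_add_distrib, ← Finset.sum_add_distrib]
      exact Finset.sum_congr rfl fun t _ => by ring
    rw [h10]
    linarith
  have hi1 : Integrable (fun ω => ∑ t ∈ Finset.range T, (f t ω (xt t ω) - f t ω 0 - lb t ω)) μ :=
    integrable_finsetSum _ fun t ht => (hexp t (Finset.mem_range.1 ht)).1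
  have hi2 : Integrable (B.indicator fun _ : Ω => T * (G * D)) μ :=
    (integrable_const _).indicator hB
  have hi3 : Integrable (fun ω => (A + R) +
      ∑ t ∈ Finset.range T, (f t ω (xt t ω) - f t ω 0 - lb t ω)) μ :=
    (integrable_const _).add hi1
  refine (integral_mono_ae (hP.integrable_regret hG hT0 hxm hxX) (hi3.add hi2) hpt).trans ?_
  simp only [Pi.add_apply]
  rw [integral_add hi3 hi2, integral_add (integrable_const _) hi1, integral_const,
    integral_finsetSum _ fun t ht => (hexp t (Finset.mem_range.1 ht)).1,
    Finset.sum_eq_zero fun t ht => (hexp t (Finset.mem_range.1 ht)).2,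
    integral_indicator_const _ hB]
  simp only [probReal_univ, smul_eq_mul, one_mul, add_zero]
  have h11 : μ.real B * (T * (G * D)) ≤
      failProb D Gg (⨅ i, limit μ a b i) T * (T * (G * D)) := by gcongr
  linarith

end IsProblem

end ExpectedRegret

/-! ### Constants -/

section Constants

/-- The constant in the bound on the confidence radius. -/
noncomputable def betaConst (D Gg F bmin : ℝ) : ℝ :=
  (Gg * D + 4 * F) / 2 * √(Real.log (2 + 2 * Gg * D / bmin) + 3) + √(max 1 (D ^ 2)) * Gg

/-- The constant in the regret bound. -/
noncomputable def regretConst (D G Gg F bmin : ℝ) : ℝ :=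
  6 * G * D * betaConst D Gg F bmin / bmin + 3 + G * D / 2 + bmin * G / (2 * Gg)

/-- With `c = 2 + 2 G_g D / b_min` one has `1 / δ ≤ c T`, so the argument of the logarithm is at
most `c (n T)³`. The logarithm is then at most `(log c + 3) L`, because `L ≥ 1`. The bias term is
absorbed by `√d √L ≥ 1`. -/
lemma beta_le {D Gg F : ℝ} {T : ℕ} {X : Set (Vec d)} {bv : Fin n → ℝ} (hD : 0 < D) (hGg : 0 < Gg)
    (hF : 0 ≤ F) (hd : 2 ≤ d) (hn : 1 ≤ n) (hT : 3 ≤ T) (hb : 0 < ⨅ i, bv i)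
    (hL : 1 ≤ Real.log (n * T)) :
    (params X bv D Gg F T).beta T ≤
      betaConst D Gg F (⨅ i, bv i) * (√(d : ℝ) * √(Real.log (n * T))) := by
  set bmin := ⨅ i, bv i
  set L := Real.log (n * T)
  have hd1 : (1 : ℝ) ≤ d := by exact_mod_cast (by omega : 1 ≤ d)
  have hn1 : (1 : ℝ) ≤ n := by exact_mod_cast hn
  have hT3 : (3 : ℝ) ≤ T := by exact_mod_cast hT
  have hδ : 0 < failProb D Gg bmin T := failProb_pos hD hGg hb (by omega)
  have hlam : 0 < (params X bv D Gg F T).lam := lam_pos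
  set c := 2 + 2 * Gg * D / bmin with hc
  have hc2 : 2 ≤ c := by
    have : 0 ≤ 2 * Gg * D / bmin := by positivity
    linarith
  have hδinv : (failProb D Gg bmin T)⁻¹ ≤ c * T := by
    unfold failProb
    rcases min_choice (1 / 2 : ℝ) (bmin / (2 * Gg * D * T)) with h | h
    · rw [h]; norm_num; nlinarith
    · rw [h, inv_div, hc, add_mul]
      have : 2 * Gg * D * T / bmin = 2 * Gg * D / bmin * T := by ring
      rw [this]; linarith
  have hlog : Real.log ((1 + T * D ^ 2 / (params X bv D Gg F T).lam) /
      (failProb D Gg bmin T / n)) ≤ (Real.log c + 3) * L := by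
    have h1 : (1 + T * D ^ 2 / (params X bv D Gg F T).lam) / (failProb D Gg bmin T / n) ≤
        c * (n * T) ^ 3 := by
      have h2 : T * D ^ 2 / (params X bv D Gg F T).lam ≤ (T : ℝ) := by
        rw [div_le_iff₀ hlam]
        have : D ^ 2 ≤ (params X bv D Gg F T).lam := sq_le_lam
        gcongr
      have h3 : (1 : ℝ) + T ≤ T ^ 2 := by nlinarith
      rw [div_div_eq_mul_div, div_eq_mul_inv]
      calc _ ≤ (T : ℝ) ^ 2 * n * (c * T) := by
            gcongr
            linarith
        _ = c * (n * T ^ 3) := by ring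
        _ ≤ c * (n ^ 3 * T ^ 3) := by
            gcongr
            exact le_self_pow₀ hn1 (by norm_num)
        _ = _ := by ring
    have h4 : Real.log (c * (n * T) ^ 3) = Real.log c + 3 * L := by
      rw [Real.log_mul (by positivity) (by positivity), Real.log_pow]
      norm_num [L]
    refine (Real.log_le_log (by positivity) h1).trans ?_
    rw [h4]
    have := Real.log_nonneg (show (1 : ℝ) ≤ c by linarith)
    nlinarith
  rw [beta_eq, betaConst, add_mul]
  have hlc := Real.log_nonneg (show (1 : ℝ) ≤ c by linarith)
  refine add_le_add ?_ ?_
  · rw [mul_assoc]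
    refine mul_le_mul_of_nonneg_left ?_ (by positivity)
    rw [← Real.sqrt_mul (by positivity), ← Real.sqrt_mul (by positivity)]
    refine Real.sqrt_le_sqrt ?_
    calc _ ≤ (d : ℝ) * ((Real.log c + 3) * L) := by gcongr
      _ = _ := by ring
  · refine le_mul_of_one_le_right (by positivity) ?_
    exact one_le_mul_of_one_le_of_one_le (Real.one_le_sqrt.2 hd1) (Real.one_le_sqrt.2 hL)

lemma one_le_log_mul {n T : ℕ} (hn : 1 ≤ n) (hT : 3 ≤ T) : 1 ≤ Real.log (n * T) := by
  rw [Real.le_log_iff_exp_le (by positivity)]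
  have h1 : (1 : ℝ) ≤ n := by exact_mod_cast hn
  have h2 : (3 : ℝ) ≤ T := by exact_mod_cast hT
  have := Real.exp_one_lt_d9
  nlinarith

lemma betaConst_nonneg {D Gg F bmin : ℝ} (hD : 0 < D) (hGg : 0 < Gg) (hF : 0 ≤ F) :
    0 ≤ betaConst D Gg F bmin := by unfold betaConst; positivity

lemma regretConst_nonneg {D G Gg F bmin : ℝ} (hD : 0 < D) (hG : 0 < G) (hGg : 0 < Gg)
    (hF : 0 ≤ F) (hb : 0 < bmin) : 0 ≤ regretConst D G Gg F bmin := by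
  have := betaConst_nonneg (bmin := bmin) hD hGg hF
  unfold regretConst; positivity

/-- All terms are compared with `Q = θ d √T L ≥ 1` and `P = C √d √T L`. The factor `√d √L` of `β`
meets another one from the elliptic potential, which gives `Q`. The phase term gives `P`. The
comparator shift and the failure event cost only constants, the latter because `δ T` is bounded. -/
lemma regret_bound_le {D G Gg F : ℝ} {T : ℕ} {X : Set (Vec d)} {bv : Fin n → ℝ} (hD : 0 < D)
    (hG : 0 < G) (hGg : 0 < Gg) (hF : 0 ≤ F) (hd : 2 ≤ d) (hn : 1 ≤ n) (hT : 3 ≤ T)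
    (hb : 0 < ⨅ i, bv i) {θ C : ℝ} (hθ : 1 ≤ θ) (hC : 0 ≤ C) :
    G * (D / 2) * ((1 + θ) * (params X bv D Gg F T).beta T / ((⨅ i, bv i) / 2)) *
        √(T * (4 * (d * Real.log (1 + T)))) +
      C * √((1 + d * Real.log (1 + T) / Real.log 2) * T) + G * D / 2 +
      failProb D Gg (⨅ i, bv i) T * (T * (G * D)) ≤
    regretConst D G Gg F (⨅ i, bv i) * ((θ * d + C * √(d : ℝ)) * √(T : ℝ)) *
      Real.log (n * T) := by
  have hL := one_le_log_mul hn hT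
  have hβ := beta_le (X := X) hD hGg hF hd hn hT hb hL
  have hb1 := betaConst_nonneg (bmin := ⨅ i, bv i) hD hGg hF
  set bmin := ⨅ i, bv i
  set L := Real.log (n * T) with hLdef
  set b1 := betaConst D Gg F bmin
  have hd1 : (1 : ℝ) ≤ d := by exact_mod_cast (by omega : 1 ≤ d)
  have hn1 : (1 : ℝ) ≤ n := by exact_mod_cast hn
  have hT3 : (3 : ℝ) ≤ T := by exact_mod_cast hT
  have hlogT : Real.log (1 + T) ≤ 2 * L := by
    have h1 : (2 : ℝ) * L = Real.log ((n * T) ^ 2) := by rw [Real.log_pow]; norm_num [hLdef]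
    rw [h1]
    refine Real.log_le_log (by positivity) ?_
    have h2 : (T : ℝ) ≤ n * T := by nlinarith
    nlinarith
  have hlogT0 : 0 ≤ Real.log (1 + T) := Real.log_nonneg (by linarith)
  have hL0 : 0 < L := by linarith
  have e1 := Real.mul_self_sqrt (show (0 : ℝ) ≤ d by linarith)
  have e2 := Real.mul_self_sqrt hL0.le
  have hs1 : √(T * (4 * (d * Real.log (1 + T)))) ≤ 3 * (√(T : ℝ) * (√(d : ℝ) * √L)) := by
    rw [← Real.sqrt_mul (by positivity), ← Real.sqrt_mul (by positivity)]
    refine Real.sqrt_le_iff.2 ⟨by positivity, ?_⟩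
    rw [mul_pow, Real.sq_sqrt (by positivity)]
    calc _ ≤ T * (4 * (d * (2 * L))) := by gcongr
      _ ≤ _ := by
        have : 0 ≤ T * (d * L) := by positivity
        linarith
  -- Here `√L` is rounded up to `L`, so that both regret terms carry the same logarithmic factor.
  have hs2 : √((1 + d * Real.log (1 + T) / Real.log 2) * T) ≤
      3 * (√(T : ℝ) * (√(d : ℝ) * L)) := by
    have h1 : √(T : ℝ) * (√(d : ℝ) * √L) ≤ √(T : ℝ) * (√(d : ℝ) * L) := by
      gcongr
      exact Real.sqrt_le_iff.2 ⟨hL0.le, by nlinarith⟩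
    refine le_trans ?_ (mul_le_mul_of_nonneg_left h1 (by norm_num))
    rw [← Real.sqrt_mul (by positivity), ← Real.sqrt_mul (by positivity)]
    refine Real.sqrt_le_iff.2 ⟨by positivity, ?_⟩
    rw [mul_pow, Real.sq_sqrt (by positivity)]
    have hlog2 : 1 / 2 ≤ Real.log 2 := by linarith [Real.log_two_gt_d9]
    have h2 : d * Real.log (1 + T) / Real.log 2 ≤ 4 * (d * L) := by
      rw [div_le_iff₀ (by linarith)]
      have h3 : (d : ℝ) * Real.log (1 + T) ≤ d * (2 * L) := by gcongr
      have h4 : 0 ≤ (d : ℝ) * L := by positivity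
      nlinarith
    have h5 : 1 ≤ (d : ℝ) * L := one_le_mul_of_one_le_of_one_le hd1 hL
    calc _ ≤ (5 * (d * L)) * (T : ℝ) := by gcongr; linarith
      _ ≤ _ := by
        have : 0 ≤ (T : ℝ) * (d * L) := by positivity
        nlinarith
  have hsT : 1 ≤ √(T : ℝ) := Real.one_le_sqrt.2 (by linarith)
  set Q := θ * d * √(T : ℝ) * L with hQ
  have hQ1 : 1 ≤ Q :=
    one_le_mul_of_one_le_of_one_le (one_le_mul_of_one_le_of_one_le
      (one_le_mul_of_one_le_of_one_le hθ hd1) hsT) hL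
  set P := C * √(d : ℝ) * √(T : ℝ) * L with hPdef
  have hP0 : 0 ≤ P := by positivity
  have t1 : G * (D / 2) * ((1 + θ) * (params X bv D Gg F T).beta T / (bmin / 2)) *
      √(T * (4 * (d * Real.log (1 + T)))) ≤ 6 * G * D * b1 / bmin * Q := by
    calc _ ≤ G * (D / 2) * ((2 * θ) * (b1 * (√(d : ℝ) * √L)) / (bmin / 2)) *
          (3 * (√(T : ℝ) * (√(d : ℝ) * √L))) := by
          have := beta_nonneg (X := X) (bv := bv) (T := T) hD hGg hF T
          gcongr
          linarith
      _ = 6 * G * D * b1 / bmin * (θ * (√(d : ℝ) * √(d : ℝ)) * √(T : ℝ) * (√L * √L)) := by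
          field_simp; ring
      _ = _ := by rw [e1, e2]
  have t2 : C * √((1 + d * Real.log (1 + T) / Real.log 2) * T) ≤ 3 * P := by
    calc _ ≤ C * (3 * (√(T : ℝ) * (√(d : ℝ) * L))) := by gcongr
      _ = _ := by rw [hPdef]; ring
  have t3 : failProb D Gg bmin T * (T * (G * D)) ≤ bmin * G / (2 * Gg) := by
    calc _ ≤ bmin / (2 * Gg * D * T) * (T * (G * D)) := by
          gcongr
          exact min_le_right _ _
      _ = _ := by field_simp
  have k1 : 0 ≤ 6 * G * D * b1 / bmin := by positivity
  have k2 : 0 ≤ bmin * G / (2 * Gg) := by positivity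
  have k3 : 0 ≤ G * D / 2 := by positivity
  have hfin : regretConst D G Gg F bmin * ((θ * d + C * √(d : ℝ)) * √(T : ℝ)) * L =
      (6 * G * D * b1 / bmin + 3 + G * D / 2 + bmin * G / (2 * Gg)) * (Q + P) := by
    rw [hQ, hPdef, regretConst]; ring
  rw [hfin]
  nlinarith [mul_nonneg k1 hP0, mul_nonneg k2 hP0, mul_nonneg k3 hP0,
    mul_le_mul_of_nonneg_left hQ1 k2, mul_le_mul_of_nonneg_left hQ1 k3]

end Constants

/-! ### The efficient variant -/

section InvSqrt

open scoped MatrixOrder in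
lemma invSqrt_mul_self {V : Matrix (Fin d) (Fin d) ℝ} (hV : V.PosDef) :
    invSqrt V * invSqrt V = V⁻¹ :=
  CFC.sqrt_mul_sqrt_self _ (Matrix.nonneg_iff_posSemidef.2 hV.inv.posSemidef)

open scoped MatrixOrder in
lemma transpose_invSqrt (V : Matrix (Fin d) (Fin d) ℝ) : (invSqrt V)ᵀ = invSqrt V := by
  have h := (Matrix.nonneg_iff_posSemidef.1 (CFC.sqrt_nonneg V⁻¹)).isHermitian.eq
  rwa [conjTranspose_eq_transpose_of_trivial] at h

lemma sum_invSqrt_mulVec_sq {V : Matrix (Fin d) (Fin d) ℝ} (hV : V.PosDef) (z : Vec d) :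
    ∑ k, (invSqrt V *ᵥ z.ofLp) k ^ 2 = invNorm V z ^ 2 := by
  rw [invNorm_eq, Real.sq_sqrt (invForm_self_nonneg hV _), invForm, ← invSqrt_mul_self hV,
    ← mulVec_mulVec, dotProduct_mulVec, ← mulVec_transpose, transpose_invSqrt]
  simp [dotProduct, sq]

lemma abs_invSqrt_mulVec_le {V : Matrix (Fin d) (Fin d) ℝ} (hV : V.PosDef) (z : Vec d)
    (k : Fin d) : |(invSqrt V *ᵥ z.ofLp) k| ≤ invNorm V z := by
  refine abs_le_of_sq_le_sq ?_ (invNorm_nonneg _ _)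
  rw [← sum_invSqrt_mulVec_sq hV]
  exact Finset.single_le_sum (f := fun k => (invSqrt V *ᵥ z.ofLp) k ^ 2)
    (fun _ _ => sq_nonneg _) (Finset.mem_univ k)

lemma abs_sign (m : Label d) : |m.sign| = 1 := by
  unfold Label.sign; split_ifs <;> simp

lemma sign_mul_invSqrt_le {V : Matrix (Fin d) (Fin d) ℝ} (hV : V.PosDef) (z : Vec d)
    (m : Label d) : m.sign * (invSqrt V *ᵥ z.ofLp) m.1 ≤ invNorm V z := by
  refine (le_abs_self _).trans ?_
  rw [abs_mul, abs_sign, one_mul]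
  exact abs_invSqrt_mulVec_le hV z m.1

/-- The Euclidean norm is at most `√d` times the maximum norm; the label records the maximizing
coordinate of `V^{-1/2} z` and its sign. -/
lemma exists_invNorm_le (hd : 0 < d) {V : Matrix (Fin d) (Fin d) ℝ} (hV : V.PosDef) (z : Vec d) :
    ∃ m : Label d, invNorm V z ≤ √(d : ℝ) * (m.sign * (invSqrt V *ᵥ z.ofLp) m.1) := by
  have : Nonempty (Fin d) := ⟨⟨0, hd⟩⟩
  obtain ⟨k, hk⟩ := Finite.exists_max fun k => |(invSqrt V *ᵥ z.ofLp) k|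
  have h1 : invNorm V z ≤ √(d : ℝ) * |(invSqrt V *ᵥ z.ofLp) k| := by
    refine le_of_sq_le_sq ?_ (by positivity)
    rw [← sum_invSqrt_mulVec_sq hV, mul_pow, Real.sq_sqrt (Nat.cast_nonneg d)]
    calc _ ≤ ∑ _j : Fin d, |(invSqrt V *ᵥ z.ofLp) k| ^ 2 := by
          refine Finset.sum_le_sum fun j _ => ?_
          rw [← sq_abs]
          exact pow_le_pow_left₀ (abs_nonneg _) (hk j) 2
      _ = _ := by simp
  rcases le_total 0 ((invSqrt V *ᵥ z.ofLp) k) with h | h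
  · refine ⟨(k, true), ?_⟩
    rw [abs_of_nonneg h] at h1
    simpa [Label.sign] using h1
  · refine ⟨(k, false), ?_⟩
    rw [abs_of_nonpos h] at h1
    simpa [Label.sign] using h1

variable {I : Input n d} {x : ℕ → Vec d} {y : ℕ → Vec n} {t₀ : ℕ}

/-- The pieces cover the optimistic set, so regret against their union controls regret against every
optimistic comparator. -/
lemma exists_mem_optPiece (hd : 0 < d) (hlam : 0 < I.lam) (hβ : 0 ≤ I.beta t₀) {u : Vec d}
    (hu : u ∈ optSet I x y t₀) : ∃ m, u ∈ optPiece I x y t₀ m := by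
  obtain ⟨m, hm⟩ := exists_invNorm_le hd (gram_posDef (x := x) hlam t₀) u
  refine ⟨m, hu.1, fun i => (le_trans ?_ (hu.2 i))⟩
  have := mul_le_mul_of_nonneg_left hm hβ
  linarith

/-- Conversely, a signed coordinate never exceeds the norm, so a piece satisfies the optimistic
constraints relaxed by `θ = √d`. -/
lemma optPiece_le (hlam : 0 < I.lam) (hβ : 0 ≤ I.beta t₀) {m : Label d} {z : Vec d}
    (hz : z ∈ optPiece I x y t₀ m) (i : Fin n) :
    (estimate I.lam x y t₀ *ᵥ z.ofLp) i -
      √(d : ℝ) * (I.beta t₀ * invNorm (gram I.lam x t₀) z) ≤ I.b i - I.kappa := by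
  refine le_trans ?_ (hz.2 i)
  have h1 := mul_le_mul_of_nonneg_left (sign_mul_invSqrt_le (gram_posDef (x := x) hlam t₀) z m)
    (show 0 ≤ √(d : ℝ) * I.beta t₀ by positivity)
  linarith

end InvSqrt

/-! ### Regret of HedgeDescent within a phase -/

section HedgeDescent

variable {I : Input n d} {x : ℕ → Vec d} {y : ℕ → Vec n} {D G : ℝ} {T : ℕ}
  {f : ℕ → Vec d → ℝ} {gf : ℕ → Vec d → Vec d}

lemma expertPos_mem (hX : IsClosed I.X) (h0 : (0 : Vec d) ∈ I.X) (hb : ∀ i, I.kappa ≤ I.b i)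
    (t : ℕ) (m : Label d) :
    expertPos I D G gf x y t m ∈ optPiece I x y (phaseStart I.lam x t) m :=
  ogd_mem (isClosed_optPiece hX m) (zero_mem_optPiece h0 hb m) _ _ _

lemma expertProb_nonneg [Nonempty (Label d)] (t : ℕ) (m : Label d) :
    0 ≤ expertProb I D G f gf x y t m := by
  simp only [expertProb]
  exact hedge_nonneg _ _ _ _

lemma sum_expertProb [Nonempty (Label d)] (t : ℕ) : ∑ m, expertProb I D G f gf x y t m = 1 := by
  simp only [expertProb, sum_hedge]

lemma card_label : Fintype.card (Label d) = 2 * d := by simp [mul_comm]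

/-- The regret of HedgeDescent within a phase with respect to the union of the convex pieces. -/
lemma hedgeDescent_regret (hd : 2 ≤ d) (hD : 0 < D) (hG : 0 < G) (hXc : Convex ℝ I.X)
    (hX : IsClosed I.X) (h0 : (0 : Vec d) ∈ I.X) (hXD : ∀ z ∈ I.X, ‖z‖ ≤ D / 2)
    (hb : ∀ i, I.kappa ≤ I.b i) (hf : ∀ t < T, IsCost I.X G (f t))
    (hgf : ∀ t < T, ∀ z ∈ I.X, HasGradientWithinAt (f t) (gf t z) I.X z ∧ ‖gf t z‖ ≤ G)
    {t : ℕ} (ht : t < T) {m₀ : Label d} {u : Vec d}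
    (hu : u ∈ optPiece I x y (phaseStart I.lam x t) m₀) :
    ∑ s ∈ Finset.Ico (phaseStart I.lam x t) (t + 1),
      (∑ m, expertProb I D G f gf x y s m * (f s (expertPos I D G gf x y s m) - f s 0) -
        (f s u - f s 0)) ≤
      3 / 2 * (G * D) * (1 + √(Real.log (2 * d))) *
        √((t + 1 - phaseStart I.lam x t : ℕ) : ℝ) := by
  have : Nonempty (Label d) := ⟨m₀⟩
  set t₀ := phaseStart I.lam x t with ht₀
  have hle : t₀ ≤ t := phaseStart_le t
  set pos : ℕ → Label d → Vec d := fun r m =>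
    ogd (optPiece I x y t₀ m) (etaStep D G) (fun r => gf (t₀ + r)) r with hpos
  set loss : ℕ → Label d → ℝ := fun r m => f (t₀ + r) (pos r m) with hloss
  have hposX : ∀ r m, pos r m ∈ I.X := fun r m =>
    (ogd_mem (isClosed_optPiece hX m) (zero_mem_optPiece h0 hb m) _ _ _).1
  have hph : ∀ r < t + 1 - t₀, phaseStart I.lam x (t₀ + r) = t₀ := fun r hr =>
    phaseStart_eq_of_mem (by omega) (by omega)
  rw [Finset.sum_Ico_eq_sum_range]
  -- The regret splits into that of Hedge against expert `m₀` and that of gradient descent of `m₀`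
  -- against `u`. The reference cost at `0` cancels since the probabilities sum to one.
  have hterm : ∀ r ∈ Finset.range (t + 1 - t₀),
      (∑ m, expertProb I D G f gf x y (t₀ + r) m *
        (f (t₀ + r) (expertPos I D G gf x y (t₀ + r) m) - f (t₀ + r) 0) -
        (f (t₀ + r) u - f (t₀ + r) 0)) =
      (∑ m, hedge (zetaStep D G (Fintype.card (Label d))) loss r m * loss r m - loss r m₀) +
        (f (t₀ + r) (pos r m₀) - f (t₀ + r) u) := by
    intro r hr
    have h1 := hph r (Finset.mem_range.1 hr)
    have h2 : ∀ m, expertPos I D G gf x y (t₀ + r) m = pos r m := fun m => by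
      simp only [expertPos, h1, Nat.add_sub_cancel_left, hpos]
    have h3 : ∀ m, expertProb I D G f gf x y (t₀ + r) m =
        hedge (zetaStep D G (Fintype.card (Label d))) loss r m := fun m => by
      simp only [expertProb, h1, Nat.add_sub_cancel_left, card_label, hloss, hpos]
    simp only [h2, h3, mul_sub, Finset.sum_sub_distrib, ← Finset.sum_mul, sum_hedge, hloss]
    ring
  rw [Finset.sum_congr rfl hterm, Finset.sum_add_distrib]
  have hH := hedge_regret_zetaStep (M := Label d) hD hG (by rw [card_label]; omega)
    (loss := loss) (t := t + 1 - t₀) (fun r hr => by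
      obtain ⟨m, hm⟩ := Finite.exists_min (loss r)
      refine ⟨loss r m, fun m' => ⟨hm m', ?_⟩⟩
      have h1 := (hf (t₀ + r) (by omega)).sub_le (hposX r m') (hposX r m)
      have h2 := norm_sub_le (pos r m') (pos r m)
      have h3 := hXD _ (hposX r m')
      have h4 := hXD _ (hposX r m)
      have h5 : G * ‖pos r m' - pos r m‖ ≤ G * D := by gcongr; linarith
      simp only [hloss]
      linarith) m₀
  have hO := ogd_regret (K := optPiece I x y t₀ m₀) (f := fun r => f (t₀ + r))
    (gf := fun r => gf (t₀ + r)) hD hG (fun z hz => hz.1) hXD (isClosed_optPiece hX m₀)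
    (convex_optPiece hXc m₀) (zero_mem_optPiece h0 hb m₀) (t := t + 1 - t₀)
    (fun r hr => (hf (t₀ + r) (by omega)).1) (fun r hr => hgf (t₀ + r) (by omega)) hu
  have hc : (Fintype.card (Label d) : ℝ) = 2 * d := by rw [card_label]; push_cast; ring
  rw [hc] at hH
  linarith

end HedgeDescent

/-! ### Guarantee for the efficient variant -/

section Efficient

variable {Ω : Type*} [mΩ : MeasurableSpace Ω] {μ : Measure Ω}
  [IsProbabilityMeasure μ] {ℱ : Filtration ℕ mΩ} {T : ℕ} {D G Gg F : ℝ} {X : Set (Vec d)}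
  {f : ℕ → Ω → Vec d → ℝ} {a : ℕ → Ω → Fin n → Vec d} {b : ℕ → Ω → Vec n}
  {x : ℕ → Ω → Vec d} {gf : ℕ → Ω → Vec d → Vec d} {idx : ℕ → Ω → Label d}

/-- Averaging over a finitely valued draw with given conditional probabilities. -/
lemma integral_sum_draw {M : Type} [Fintype M] [MeasurableSpace M] [MeasurableSingletonClass M]
    {ix : Ω → M} (hix : Measurable ix) {𝒢 : MeasurableSpace Ω} (h𝒢 : 𝒢 ≤ mΩ)
    {p H : M → Ω → ℝ} {R : ℝ} (hH : ∀ m, StronglyMeasurable[𝒢] (H m)) (hHR : ∀ m ω, |H m ω| ≤ R)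
    (hp : ∀ m, μ[(ix ⁻¹' {m}).indicator (fun _ => (1 : ℝ)) | 𝒢] =ᵐ[μ] p m) :
    Integrable (fun ω => H (ix ω) ω - ∑ m, p m ω * H m ω) μ ∧
      ∫ ω, (H (ix ω) ω - ∑ m, p m ω * H m ω) ∂μ = 0 := by
  classical
  have hixm : ∀ m, MeasurableSet[mΩ] (ix ⁻¹' {m}) := fun m => hix (measurableSet_singleton m)
  have hind : ∀ m, Integrable ((ix ⁻¹' {m}).indicator fun _ => (1 : ℝ)) μ := fun m =>
    (integrable_const _).indicator (hixm m)
  have hHi : ∀ m (g : Ω → ℝ), Integrable g μ → Integrable (fun ω => g ω * H m ω) μ := fun m g hg =>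
    hg.mul_bdd ((hH m).mono h𝒢).aestronglyMeasurable
      (Filter.Eventually.of_forall fun ω => hHR m ω)
  have hpi : ∀ m, Integrable (p m) μ := fun m => (integrable_condExp).congr (hp m)
  have h1 : ∀ m, ∫ ω, (ix ⁻¹' {m}).indicator (fun _ => (1 : ℝ)) ω * H m ω ∂μ =
      ∫ ω, p m ω * H m ω ∂μ := fun m => by
    have h2 := condExp_mul_of_stronglyMeasurable_right (hH m) (hHi m _ (hind m)) (hind m)
    have h3 := integral_condExp (μ := μ) h𝒢
      (f := (ix ⁻¹' {m}).indicator (fun _ => (1 : ℝ)) * H m)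
    rw [integral_congr_ae h2] at h3
    rw [show (∫ ω, (ix ⁻¹' {m}).indicator (fun _ => (1 : ℝ)) ω * H m ω ∂μ) =
      ∫ ω, ((ix ⁻¹' {m}).indicator (fun _ => (1 : ℝ)) * H m) ω ∂μ from rfl, ← h3]
    refine integral_congr_ae ?_
    filter_upwards [hp m] with ω hω
    rw [Pi.mul_apply, hω]
  have h4 : ∀ ω, H (ix ω) ω = ∑ m, (ix ⁻¹' {m}).indicator (fun _ => (1 : ℝ)) ω * H m ω := by
    intro ω
    rw [Finset.sum_eq_single (ix ω)]
    · simp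
    · intro m _ hm
      rw [Set.indicator_of_notMem (by simpa using hm.symm), zero_mul]
    · simp
  simp only [h4, ← Finset.sum_sub_distrib]
  have hi : ∀ m, Integrable (fun ω => (ix ⁻¹' {m}).indicator (fun _ => (1 : ℝ)) ω * H m ω -
      p m ω * H m ω) μ := fun m => (hHi m _ (hind m)).sub (hHi m _ (hpi m))
  refine ⟨integrable_finsetSum _ fun m _ => hi m, ?_⟩
  rw [integral_finsetSum _ fun m _ => hi m]
  refine Finset.sum_eq_zero fun m _ => ?_
  rw [integral_sub (hHi m _ (hind m)) (hHi m _ (hpi m)), h1, sub_self]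

/-- The guarantee for the efficient variant. -/
lemma efficient_guarantee (hP : IsProblem μ ℱ T D G Gg F X f a b idx) (hD : 0 < D) (hG : 0 < G)
    (hGg : 0 < Gg) (hd : 2 ≤ d) (hn : 1 ≤ n) (hT : 3 ≤ T) (hb : 0 < ⨅ i, limit μ a b i)
    (hR : IsEfficientRun μ ℱ T (params X (limit μ a b) D Gg F T) D G f gf idx x
      (feedback μ a b x)) :
    NoExpectedViolation μ T a b x ∧ Integrable (regret μ T X f a b x) μ ∧
      ∫ ω, regret μ T X f a b x ω ∂μ ≤ regretConst D G Gg F (⨅ i, limit μ a b i) *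
        ((√(d : ℝ) * d + 3 / 2 * (G * D) * (1 + √(Real.log (2 * d))) * √(d : ℝ)) * √(T : ℝ)) *
          Real.log (n * T) := by
  have hF := hP.F_nonneg (by omega)
  have hd1 : (1 : ℝ) ≤ d := by exact_mod_cast (by omega : 1 ≤ d)
  set I := params X (limit μ a b) D Gg F T with hI
  have hκ : ∀ i, I.kappa ≤ I.b i := fun i => kappa_le (by omega) hb i
  have hβ0 : ∀ t, 0 ≤ I.beta t := beta_nonneg hD hGg hF
  have hlam : 0 < I.lam := lam_pos
  set pos : ℕ → Label d → Ω → Vec d := fun t m ω => expertPos I D G (fun s => gf s ω)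
    (fun s => x s ω) (fun s => feedback μ a b x s ω) t m with hpos
  have hposmem : ∀ t m ω, pos t m ω ∈ optPiece I (fun s => x s ω)
      (fun s => feedback μ a b x s ω) (phaseStart I.lam (fun s => x s ω) t) m := fun t m ω =>
    expertPos_mem hP.closed hP.zero_mem hκ t m
  have hpess : ∀ t < T, ∀ ω, x t ω ∈ pessSet I (fun s => x s ω)
      (fun s => feedback μ a b x s ω) (phaseStart I.lam (fun s => x s ω) t) := fun t ht ω => by
    have h1 := hR.play t ht ω
    rw [h1]
    exact (safeScale_mem (isClosed_pessSet hP.closed) (zero_mem_pessSet hP.zero_mem hκ) _).2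
  have hxX : ∀ t < T, ∀ ω, x t ω ∈ X := fun t ht ω => (hpess t ht ω).1
  have hxm := hR.x_measurable
  refine ⟨hP.noExpectedViolation hD hGg hd hn (by omega) hb hxm hpess,
    hP.integrable_regret hG (by omega) hxm hxX, ?_⟩
  set H : ℕ → Label d → Ω → ℝ := fun t m ω => f t ω (pos t m ω) - f t ω 0 with hH
  set p : ℕ → Label d → Ω → ℝ := fun t m ω => expertProb I D G (fun s => f s ω)
    (fun s => gf s ω) (fun s => x s ω) (fun s => feedback μ a b x s ω) t m with hp
  have hHle : ∀ t < T, ∀ m ω, |H t m ω| ≤ G * (D / 2) := fun t ht m ω => by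
    refine ((hP.cost t ht ω).abs_sub_le (hposmem t m ω).1 hP.zero_mem).trans ?_
    rw [sub_zero]
    have := hP.norm_le _ (hposmem t m ω).1
    gcongr
  have hHm : ∀ t < T, ∀ m, StronglyMeasurable[ℱ t] (H t m) := fun t ht m =>
    ((hP.measurable_cost_comp ht le_rfl (hR.expert_measurable t ht m)
      fun ω => (hposmem t m ω).1).sub
      (hP.measurable_cost_comp ht le_rfl measurable_const
        fun _ => hP.zero_mem)).stronglyMeasurable
  have : Nonempty (Label d) := ⟨⟨⟨0, by omega⟩, true⟩⟩
  -- The relaxation `√d` comes from `optPiece_le`, and `C` is the sum of the Hedge and gradient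
  -- descent constants.
  refine (hP.integral_regret_le hD hG hGg hd hn (by omega) hb hxm hxX
    (xt := fun t ω => pos t (idx t ω) ω) (lb := fun t ω => ∑ m, p t m ω * H t m ω)
    (θ := √(d : ℝ)) (C := 3 / 2 * (G * D) * (1 + √(Real.log (2 * d)))) (Real.sqrt_nonneg _)
    (by positivity) hR.play ?_ ?_ ?_ ?_).trans
    (regret_bound_le hD hG hGg hF hd hn hT hb (Real.one_le_sqrt.2 hd1) (by positivity))
  · exact Filter.Eventually.of_forall fun ω t ht =>
      ⟨(hposmem t _ ω).1, fun i => optPiece_le hlam (hβ0 _) (hposmem t _ ω) i⟩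
  · intro t ht
    exact integral_sum_draw ((hP.draw_past t ht).mono (ℱ.le _) le_rfl) (ℱ.le t) (hHm t ht)
      (hHle t ht) (hR.sample t ht)
  · refine Filter.Eventually.of_forall fun ω t ht => ?_
    calc ∑ m, p t m ω * H t m ω ≤ ∑ m, p t m ω * (G * (D / 2)) :=
          Finset.sum_le_sum fun m _ => mul_le_mul_of_nonneg_left
            ((le_abs_self _).trans (hHle t ht m ω))
              (expertProb_nonneg t m)
      _ = G * (D / 2) := by
          rw [← Finset.sum_mul]
          simp only [hp, sum_expertProb, one_mul]
  · refine Filter.Eventually.of_forall fun ω t ht u hu => ?_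
    obtain ⟨m, hm⟩ := exists_mem_optPiece (by omega) hlam (hβ0 _) hu
    exact hedgeDescent_regret hd hD hG hP.convex hP.closed hP.zero_mem hP.norm_le hκ
      (fun t ht => hP.cost t ht ω) (fun t ht => hR.grad t ht ω) ht hm

end Efficient

/-! ### Draws with prescribed conditional probabilities -/

section Draw

variable {Ω β E : Type*} {mΩ : MeasurableSpace Ω} {mβ : MeasurableSpace β} [MeasurableSpace E]
  [StandardBorelSpace E] [Nonempty E] {μ : Measure Ω} [IsProbabilityMeasure μ]
  {X : Ω → β} {Y : Ω → E} {q : Ω → Measure E}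

/-- The hypothesis has an exceptional null set for each `B`. A countable algebra that generates the
σ-algebra collects these into one null set, and two probability measures that agree on it are equal.
-/
lemma condDistrib_ae_eq_of_condExp (hX : Measurable X) (hY : Measurable Y)
    (hq : ∀ᵐ ω ∂μ, IsProbabilityMeasure (q ω))
    (h : ∀ B : Set E, MeasurableSet B →
      μ[(Y ⁻¹' B).indicator (fun _ => (1 : ℝ)) | mβ.comap X] =ᵐ[μ] fun ω => (q ω).real B) :
    ∀ᵐ ω ∂μ, condDistrib Y X μ (X ω) = q ω := by
  set 𝒜 := generateSetAlgebra (MeasurableSpace.countableGeneratingSet E) with h𝒜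
  have hgen : ‹MeasurableSpace E› = MeasurableSpace.generateFrom 𝒜 := by
    rw [h𝒜, generateFrom_generateSetAlgebra_eq,
      MeasurableSpace.generateFrom_countableGeneratingSet]
  have hcount : 𝒜.Countable :=
    countable_generateSetAlgebra MeasurableSpace.countable_countableGeneratingSet
  have hmeas : ∀ B ∈ 𝒜, MeasurableSet B := fun B hB => by
    rw [hgen]; exact MeasurableSpace.measurableSet_generateFrom hB
  have hall : ∀ᵐ ω ∂μ, ∀ B ∈ 𝒜, (condDistrib Y X μ (X ω)).real B = (q ω).real B :=
    (ae_ball_iff hcount).2 fun B hB =>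
      (condDistrib_ae_eq_condExp hX hY (hmeas B hB)).trans (h B (hmeas B hB))
  filter_upwards [hq, hall] with ω hω1 hω2
  refine ext_of_generate_finite 𝒜 hgen
    (fun s hs t ht _ => isSetAlgebra_generateSetAlgebra.inter_mem hs ht) (fun B hB => ?_) (by simp)
  exact (measureReal_eq_measureReal_iff).1 (hω2 B hB)

/-- The joint law of `X` and `Y` disintegrates along `condDistrib`, which agrees almost everywhere
with `q`; no measurability of `q` itself is assumed. -/
lemma ae_prodMk_mem_of_condExp (hX : Measurable X) (hY : Measurable Y)
    (hq : ∀ᵐ ω ∂μ, IsProbabilityMeasure (q ω))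
    (h : ∀ B : Set E, MeasurableSet B →
      μ[(Y ⁻¹' B).indicator (fun _ => (1 : ℝ)) | mβ.comap X] =ᵐ[μ] fun ω => (q ω).real B)
    {S : Set (β × E)} (hS : MeasurableSet S) (hqS : ∀ᵐ ω ∂μ, q ω {z | (X ω, z) ∉ S} = 0) :
    ∀ᵐ ω ∂μ, (X ω, Y ω) ∈ S := by
  have h1 : ∀ᵐ p ∂(μ.map fun ω => (X ω, Y ω)), p ∈ S := by
    rw [← compProd_map_condDistrib hY.aemeasurable]
    refine (Measure.ae_compProd_iff (p := fun p => p ∈ S) hS).2 ?_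
    refine (ae_map_iff hX.aemeasurable ?_).2 ?_
    · exact Kernel.measurable_kernel_prodMk_left (κ := condDistrib Y X μ) hS.compl
        (measurableSet_singleton 0)
    filter_upwards [hqS, condDistrib_ae_eq_of_condExp hX hY hq h] with ω h1 h2
    rw [h2, ae_iff]
    exact h1
  exact ae_of_ae_map (hX.prodMk hY).aemeasurable h1

/-- After identifying `q` with `condDistrib`, the subtracted integral is a conditional expectation.
This also provides its integrability. -/
lemma integral_prodMk_sub_of_condExp (hX : Measurable X) (hY : Measurable Y)
    (hq : ∀ᵐ ω ∂μ, IsProbabilityMeasure (q ω))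
    (h : ∀ B : Set E, MeasurableSet B →
      μ[(Y ⁻¹' B).indicator (fun _ => (1 : ℝ)) | mβ.comap X] =ᵐ[μ] fun ω => (q ω).real B)
    {H : β × E → ℝ} (hH : Measurable H) {R : ℝ} (hR : ∀ p, |H p| ≤ R) :
    Integrable (fun ω => H (X ω, Y ω) - ∫ z, H (X ω, z) ∂(q ω)) μ ∧
      ∫ ω, (H (X ω, Y ω) - ∫ z, H (X ω, z) ∂(q ω)) ∂μ = 0 := by
  have hq' := condDistrib_ae_eq_of_condExp hX hY hq h
  have hi : Integrable (fun ω => H (X ω, Y ω)) μ :=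
    Integrable.of_bound (hH.comp (hX.prodMk hY)).aestronglyMeasurable R
      (Filter.Eventually.of_forall fun ω => hR _)
  have hE := condExp_prod_ae_eq_integral_condDistrib hX hY.aemeasurable hH.stronglyMeasurable hi
  have hE' : μ[fun ω => H (X ω, Y ω) | mβ.comap X] =ᵐ[μ] fun ω => ∫ z, H (X ω, z) ∂(q ω) := by
    filter_upwards [hE, hq'] with ω h1 h2
    rw [h1, h2]
  have hi2 : Integrable (fun ω => ∫ z, H (X ω, z) ∂(q ω)) μ := integrable_condExp.congr hE'
  refine ⟨hi.sub hi2, ?_⟩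
  rw [integral_sub hi hi2, ← integral_congr_ae hE', integral_condExp hX.comap_le, sub_self]

/-- Conditioning on the σ-algebra `𝒢` is conditioning on the identity map into `Ω` equipped with
`𝒢`. -/
lemma ae_mem_of_condExp (hY : Measurable Y) {𝒢 : MeasurableSpace Ω} (h𝒢 : 𝒢 ≤ mΩ)
    (hq : ∀ᵐ ω ∂μ, IsProbabilityMeasure (q ω))
    (h : ∀ B : Set E, MeasurableSet B →
      μ[(Y ⁻¹' B).indicator (fun _ => (1 : ℝ)) | 𝒢] =ᵐ[μ] fun ω => (q ω).real B)
    {S : Ω → Set E} (hS : @MeasurableSet _ (𝒢.prod inferInstance) {p : Ω × E | p.2 ∈ S p.1})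
    (hqS : ∀ᵐ ω ∂μ, q ω (S ω)ᶜ = 0) :
    ∀ᵐ ω ∂μ, Y ω ∈ S ω :=
  ae_prodMk_mem_of_condExp (mβ := 𝒢) (X := id) (measurable_id'' h𝒢) hY hq
    (by rwa [MeasurableSpace.comap_id]) hS hqS

lemma integral_sub_of_condExp (hY : Measurable Y) {𝒢 : MeasurableSpace Ω} (h𝒢 : 𝒢 ≤ mΩ)
    (hq : ∀ᵐ ω ∂μ, IsProbabilityMeasure (q ω))
    (h : ∀ B : Set E, MeasurableSet B →
      μ[(Y ⁻¹' B).indicator (fun _ => (1 : ℝ)) | 𝒢] =ᵐ[μ] fun ω => (q ω).real B)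
    {H : Ω × E → ℝ} (hH : @Measurable _ _ (𝒢.prod inferInstance) _ H) {R : ℝ}
    (hR : ∀ p, |H p| ≤ R) :
    Integrable (fun ω => H (ω, Y ω) - ∫ z, H (ω, z) ∂(q ω)) μ ∧
      ∫ ω, (H (ω, Y ω) - ∫ z, H (ω, z) ∂(q ω)) ∂μ = 0 :=
  integral_prodMk_sub_of_condExp (mβ := 𝒢) (X := id) (measurable_id'' h𝒢) hY hq
    (by rwa [MeasurableSpace.comap_id]) hH hR

end Draw

/-! ### Online algorithms restarted within a phase -/

section OnlineAlgorithm

variable {X : Set (Vec d)} {G C : ℝ} {T : ℕ} {𝒜 : OnlineAlg d}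

lemma history_congr {z z' : ℕ → Vec d} {f f' : ℕ → Vec d → ℝ} {t : ℕ}
    (hz : ∀ s < t, z s = z' s) (hf : ∀ s < t, f s = f' s) : history z f t = history z' f' t :=
  List.map_congr_left fun s hs => by
    rw [hz s (List.mem_range.1 hs), hf s (List.mem_range.1 hs)]

lemma IsCost.integrable (hXc : IsCompact X) {f : Vec d → ℝ} (hf : IsCost X G f)
    {ν : Measure (Vec d)} [IsProbabilityMeasure ν] (hν : ν Xᶜ = 0) : Integrable f ν := by
  have h := hf.continuousOn.integrableOn_compact (μ := ν) hXc
  rwa [IntegrableOn, Measure.restrict_eq_self_of_ae_mem (ae_iff.2 hν)] at h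

/-- A regret constant controls the game that an algorithm plays on `Y` from round `t₀` on. -/
lemma HasRegretConstant.restart (hA : HasRegretConstant 𝒜 X G T C) (hXc : IsCompact X)
    {Y : Set (Vec d)} (hYX : Y ⊆ X) (hY : IsClosed Y) {f : ℕ → Vec d → ℝ}
    (hf : ∀ s < T, IsCost X G (f s)) {z : ℕ → Vec d} {t₀ t : ℕ} (ht₀ : t₀ ≤ t) (ht : t < T)
    (hz : ∀ s, t₀ ≤ s → s < t → z s ∈ Y) {u : Vec d} (hu : u ∈ Y) :
    (∀ s, t₀ ≤ s → s ≤ t →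
      IsProbabilityMeasure (𝒜 Y (history (fun r => z (t₀ + r)) (fun r => f (t₀ + r)) (s - t₀))) ∧
      𝒜 Y (history (fun r => z (t₀ + r)) (fun r => f (t₀ + r)) (s - t₀)) Yᶜ = 0) ∧
    ∑ s ∈ Finset.Ico t₀ (t + 1),
      ((∫ w, f s w ∂(𝒜 Y (history (fun r => z (t₀ + r)) (fun r => f (t₀ + r)) (s - t₀)))) -
        f s u) ≤ C * √((t + 1 - t₀ : ℕ) : ℝ) := by
  classical
  -- The regret constant speaks of infinite sequences with all actions in `Y` and all costs
  -- admissible, but the play is controlled only on an initial segment. Replacing the other entries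
  -- leaves the relevant histories unchanged.
  set z' : ℕ → Vec d := fun r => if z (t₀ + r) ∈ Y then z (t₀ + r) else u with hz'
  set f' : ℕ → Vec d → ℝ := fun r => if t₀ + r < T then f (t₀ + r) else f t with hf'
  have hhist : ∀ s ≤ t - t₀, history (fun r => z (t₀ + r)) (fun r => f (t₀ + r)) s =
      history z' f' s := fun s hs => history_congr
    (fun r hr => (if_pos (hz _ (by omega) (by omega))).symm)
    (fun r hr => (if_pos (show t₀ + r < T by omega)).symm)
  have hf'c : ∀ r, IsCost X G (f' r) := fun r => by
    simp only [hf']; split_ifs with h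
    · exact hf _ h
    · exact hf _ ht
  obtain ⟨h1, h2⟩ := hA Y hYX hY ⟨u, hu⟩ f' hf'c z' fun r => by
    simp only [hz']; split_ifs with h
    · exact h
    · exact hu
  refine ⟨fun s hs hst => ?_, ?_⟩
  · rw [hhist _ (by omega)]
    exact h1 _ (by omega)
  · have h3 := h2 (t + 1 - t₀) (by omega)
    have hbdd : BddBelow ((fun w => ∑ r ∈ Finset.range (t + 1 - t₀), f' r w) '' Y) :=
      ((hXc.of_isClosed_subset hY hYX).bddBelow_image
        (continuousOn_finsetSum _ fun r _ => ((hf'c r).continuousOn).mono hYX))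
    have h4 := csInf_le hbdd (Set.mem_image_of_mem _ hu)
    rw [Finset.sum_Ico_eq_sum_range, Finset.sum_sub_distrib]
    refine le_trans (sub_le_sub (le_of_eq ?_) (h4.trans (le_of_eq ?_))) h3
    · refine Finset.sum_congr rfl fun r hr => ?_
      have := Finset.mem_range.1 hr
      rw [Nat.add_sub_cancel_left, hhist r (by omega)]
      simp only [hf', if_pos (show t₀ + r < T by omega)]
    · refine Finset.sum_congr rfl fun r hr => ?_
      have := Finset.mem_range.1 hr
      simp only [hf', if_pos (show t₀ + r < T by omega)]

end OnlineAlgorithm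

/-! ### Measurability of the optimistic sets -/

section Measurability

variable {Ω : Type*} {m : MeasurableSpace Ω} {I : Input n d} {x : ℕ → Ω → Vec d}
  {y : ℕ → Ω → Vec n} {w : Ω → Vec d} {t : ℕ}

lemma measurableSet_mem_optSet (hX : MeasurableSet I.X) (hx : ∀ s < t, Measurable[m] (x s))
    (hy : ∀ s < t, Measurable[m] (y s)) (hw : Measurable[m] w) :
    MeasurableSet[m] {ω | w ω ∈ optSet I (fun s => x s ω) (fun s => y s ω) t} := by
  have h : {ω | w ω ∈ optSet I (fun s => x s ω) (fun s => y s ω) t} =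
      w ⁻¹' I.X ∩ ⋂ i : Fin n, {ω | (estimate I.lam (fun s => x s ω) (fun s => y s ω) t *ᵥ
        (w ω).ofLp) i - I.beta t * invNorm (gram I.lam (fun s => x s ω) t) (w ω) ≤
          I.b i - I.kappa} := by
    ext ω; simp [optSet]
  rw [h]
  refine (hw hX).inter (MeasurableSet.iInter fun i => measurableSet_le ?_ measurable_const)
  exact (measurable_mulVec_apply (measurable_estimate hx hy) (measurable_ofLp_apply hw) i).sub
    ((measurable_invForm (measurable_gram hx) (measurable_ofLp_apply hw)
      (measurable_ofLp_apply hw)).sqrt.const_mul _)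

lemma measurableSet_mem_optSet_phaseStart (hX : MeasurableSet I.X)
    (hx : ∀ s < t, Measurable[m] (x s)) (hy : ∀ s < t, Measurable[m] (y s))
    (hw : Measurable[m] w) :
    MeasurableSet[m] {ω | w ω ∈ optSet I (fun s => x s ω) (fun s => y s ω)
      (phaseStart I.lam (fun s => x s ω) t)} := by
  have h : {ω | w ω ∈ optSet I (fun s => x s ω) (fun s => y s ω)
      (phaseStart I.lam (fun s => x s ω) t)} =
      ⋃ k ∈ Set.Iic t, ({ω | phaseStart I.lam (fun s => x s ω) t = k} ∩
        {ω | w ω ∈ optSet I (fun s => x s ω) (fun s => y s ω) k}) := by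
    ext ω
    simp [phaseStart_le]
  rw [h]
  refine MeasurableSet.biUnion (Set.to_countable _) fun k hk =>
    (measurable_phaseStart hx (measurableSet_singleton k)).inter
      (measurableSet_mem_optSet hX (fun s hs => hx s ?_) (fun s hs => hy s ?_) hw) <;>
  · have : k ≤ t := hk
    omega

end Measurability

/-! ### Guarantee for an arbitrary online algorithm -/

section Kernel

variable {Ω : Type*} [mΩ : MeasurableSpace Ω] {μ : Measure Ω}
  [IsProbabilityMeasure μ] {ℱ : Filtration ℕ mΩ} {T : ℕ} {D G Gg F C : ℝ} {X : Set (Vec d)}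
  {f : ℕ → Ω → Vec d → ℝ} {a : ℕ → Ω → Fin n → Vec d} {b : ℕ → Ω → Vec n}
  {xt x : ℕ → Ω → Vec d} {𝒜 : OnlineAlg d}

lemma IsProblem.measurableSet_optSet {Z : Type*} [MeasurableSpace Z] {draw : ℕ → Ω → Z}
    (hP : IsProblem μ ℱ T D G Gg F X f a b draw)
    (hxm : ∀ t < T, Measurable[ℱ t ⊔ MeasurableSpace.comap (draw t) inferInstance] (x t))
    {t : ℕ} (ht : t < T) :
    @MeasurableSet _ ((ℱ t).prod inferInstance) {p : Ω × Vec d | p.2 ∈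
      optSet (params X (limit μ a b) D Gg F T) (fun s => x s p.1)
        (fun s => feedback μ a b x s p.1)
        (phaseStart (params X (limit μ a b) D Gg F T).lam (fun s => x s p.1) t)} := by
  have hfst : @Measurable (Ω × Vec d) Ω ((ℱ t).prod inferInstance) (ℱ t) Prod.fst :=
    @measurable_fst _ _ (ℱ t) _
  have hx : ∀ s < t, @Measurable (Ω × Vec d) (Vec d) ((ℱ t).prod inferInstance) _
      fun p => x s p.1 := fun s hs => (hP.measurable_play hxm hs ht.le).comp hfst
  have hy : ∀ s < t, @Measurable (Ω × Vec d) (Vec n) ((ℱ t).prod inferInstance) _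
      fun p => feedback μ a b x s p.1 := fun s hs =>
    (hP.measurable_feedback hxm hs ht.le).comp hfst
  have hsnd : @Measurable (Ω × Vec d) (Vec d) ((ℱ t).prod inferInstance) _ Prod.snd :=
    @measurable_snd _ _ (ℱ t) _
  have hX : MeasurableSet (params X (limit μ a b) D Gg F T).X := hP.closed.measurableSet
  exact measurableSet_mem_optSet_phaseStart hX hx hy hsnd

open scoped Classical in
/-- The guarantee for OSOCO with an arbitrary online algorithm. -/
lemma guarantee (hP : IsProblem μ ℱ T D G Gg F X f a b xt) (hD : 0 < D) (hG : 0 < G)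
    (hGg : 0 < Gg) (hd : 2 ≤ d) (hn : 1 ≤ n) (hT : 3 ≤ T) (hb : 0 < ⨅ i, limit μ a b i)
    (hC : 0 ≤ C) (hA : HasRegretConstant 𝒜 X G T C)
    (hR : IsRun μ ℱ T (params X (limit μ a b) D Gg F T) 𝒜 f xt x (feedback μ a b x)) :
    NoExpectedViolation μ T a b x ∧ Integrable (regret μ T X f a b x) μ ∧
      ∫ ω, regret μ T X f a b x ω ∂μ ≤ regretConst D G Gg F (⨅ i, limit μ a b i) *
        ((1 * d + C * √(d : ℝ)) * √(T : ℝ)) * Real.log (n * T) := by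
  have hF := hP.F_nonneg (by omega)
  set I := params X (limit μ a b) D Gg F T with hI
  have hκ : ∀ i, I.kappa ≤ I.b i := fun i => kappa_le (by omega) hb i
  have hXc : IsCompact X := (isCompact_closedBall (0 : Vec d) (D / 2)).of_isClosed_subset hP.closed
    fun z hz => by simpa using hP.norm_le z hz
  have hpess : ∀ t < T, ∀ ω, x t ω ∈ pessSet I (fun s => x s ω)
      (fun s => feedback μ a b x s ω) (phaseStart I.lam (fun s => x s ω) t) := fun t ht ω => by
    have h1 := hR.play t ht ω
    rw [h1]
    exact (safeScale_mem (isClosed_pessSet hP.closed) (zero_mem_pessSet hP.zero_mem hκ) _).2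
  have hxX : ∀ t < T, ∀ ω, x t ω ∈ X := fun t ht ω => (hpess t ht ω).1
  have hxm := hR.x_measurable
  refine ⟨hP.noExpectedViolation hD hGg hd hn (by omega) hb hxm hpess,
    hP.integrable_regret hG (by omega) hxm hxX, ?_⟩
  set ps : ℕ → Ω → ℕ := fun t ω => phaseStart I.lam (fun s => x s ω) t with hps
  set Y : ℕ → Ω → Set (Vec d) := fun t ω => optSet I (fun s => x s ω)
    (fun s => feedback μ a b x s ω) t with hY
  set q : ℕ → Ω → Measure (Vec d) := fun t ω => 𝒜 (Y (ps t ω) ω)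
    (history (fun s => xt (ps t ω + s) ω) (fun s => f (ps t ω + s) ω) (t - ps t ω)) with hq
  have hYX : ∀ t ω, Y t ω ⊆ X := fun t ω z hz => hz.1
  have hYc : ∀ t ω, IsClosed (Y t ω) := fun t ω => isClosed_optSet hP.closed
  have hY0 : ∀ {t} ω, (0 : Vec d) ∈ Y t ω := fun {t} ω => zero_mem_optSet hP.zero_mem hκ
  have hpsle : ∀ t ω, ps t ω ≤ t := fun t ω => phaseStart_le t
  have hpseq : ∀ s t ω, ps t ω ≤ s → s ≤ t → ps s ω = ps t ω := fun s t ω h1 h2 =>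
    phaseStart_eq_of_mem h1 h2
  have hgame : ∀ ω, ∀ t < T, (∀ s < t, xt s ω ∈ Y (ps s ω) ω) → ∀ u ∈ Y (ps t ω) ω,
      (IsProbabilityMeasure (q t ω) ∧ q t ω (Y (ps t ω) ω)ᶜ = 0) ∧
      ∑ s ∈ Finset.Ico (ps t ω) (t + 1), ((∫ w, f s ω w ∂(q s ω)) - f s ω u) ≤
        C * √((t + 1 - ps t ω : ℕ) : ℝ) := fun ω t ht hz u hu => by
    obtain ⟨h1, h2⟩ := hA.restart hXc (hYX (ps t ω) ω) (hYc (ps t ω) ω)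
      (f := fun s => f s ω) (fun s hs => hP.cost s hs ω) (z := fun s => xt s ω) (hpsle t ω) ht
      (fun s hs hst => by rw [← hpseq s t ω hs hst.le]; exact hz s hst) hu
    refine ⟨h1 t (hpsle t ω) le_rfl, le_trans (le_of_eq ?_) h2⟩
    refine Finset.sum_congr rfl fun s hs => ?_
    have hs' := Finset.mem_Ico.1 hs
    simp only [hq, hpseq s t ω hs'.1 (by omega)]
  have hxtm : ∀ t < T, Measurable (xt t) := fun t ht => (hP.draw_past t ht).mono (ℱ.le _) le_rfl
  -- The algorithm is guaranteed to sample from its action set only if its earlier samples were in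
  -- that set. Almost sure membership is therefore proved round by round.
  have hmem : ∀ t ≤ T, ∀ᵐ ω ∂μ, ∀ s < t, xt s ω ∈ Y (ps s ω) ω := by
    intro t
    induction t with
    | zero => exact fun _ => Filter.Eventually.of_forall fun ω s hs => by omega
    | succ t ih =>
      intro ht
      have ih := ih (by omega)
      have hgame0 : ∀ᵐ ω ∂μ, IsProbabilityMeasure (q t ω) ∧ q t ω (Y (ps t ω) ω)ᶜ = 0 :=
        ih.mono fun ω h => (hgame ω t (by omega) h 0 (hY0 ω)).1
      have h1 : ∀ᵐ ω ∂μ, xt t ω ∈ Y (ps t ω) ω :=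
        ae_mem_of_condExp (hxtm t (by omega)) (ℱ.le t) (hgame0.mono fun ω h => h.1)
          (hR.sample t (by omega)) (hP.measurableSet_optSet hxm (by omega))
          (hgame0.mono fun ω h => h.2)
      filter_upwards [ih, h1] with ω h2 h3 s hs
      rcases Nat.lt_succ_iff_lt_or_eq.1 hs with h | rfl
      · exact h2 s h
      · exact h3
  have hmem := hmem T le_rfl
  have hprob : ∀ᵐ ω ∂μ, ∀ t < T, IsProbabilityMeasure (q t ω) ∧ q t ω Xᶜ = 0 := by
    filter_upwards [hmem] with ω h t ht
    have h1 := (hgame ω t ht (fun s hs => h s (by omega)) 0 (hY0 ω)).1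
    exact ⟨h1.1, measure_mono_null (Set.compl_subset_compl.2 (hYX _ _)) h1.2⟩
  -- Costs are jointly measurable and bounded relative to `0` only on `X`. Sending the complement of
  -- `X` to `0` extends them to all points without affecting the samples almost surely.
  set π : Vec d → Vec d := fun z => if z ∈ X then z else 0 with hπ
  have hπX : ∀ z, π z ∈ X := fun z => by
    simp only [hπ]; split_ifs with h
    · exact h
    · exact hP.zero_mem
  have hπm : Measurable π :=
    Measurable.ite hP.closed.measurableSet measurable_id measurable_const
  set H : ℕ → Ω × Vec d → ℝ := fun t p => f t p.1 (π p.2) - f t p.1 0 with hH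
  have hHle : ∀ t < T, ∀ p, |H t p| ≤ G * (D / 2) := fun t ht p => by
    refine ((hP.cost t ht p.1).abs_sub_le (hπX p.2) hP.zero_mem).trans ?_
    rw [sub_zero]
    have := hP.norm_le _ (hπX p.2)
    gcongr
  have hHm : ∀ t < T, @Measurable _ _ ((ℱ t).prod inferInstance) _ (H t) := fun t ht => by
    have hc := hP.cost_measurable t ht
    have hfst : @Measurable (Ω × Vec d) Ω ((ℱ t).prod inferInstance) (ℱ t) Prod.fst :=
      @measurable_fst _ _ (ℱ t) _
    have hsnd : @Measurable (Ω × Vec d) (Vec d) ((ℱ t).prod inferInstance) _ Prod.snd :=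
      @measurable_snd _ _ (ℱ t) _
    have h1 : @Measurable (Ω × Vec d) (Ω × X) ((ℱ t).prod inferInstance)
        ((ℱ t).prod inferInstance) fun p => (p.1, ⟨π p.2, hπX p.2⟩) :=
      @Measurable.prodMk _ _ _ (_) (ℱ t) _ _ _ hfst (hπm.comp hsnd).subtype_mk
    have h2 : @Measurable (Ω × Vec d) (Ω × X) ((ℱ t).prod inferInstance)
        ((ℱ t).prod inferInstance) fun p => (p.1, ⟨0, hP.zero_mem⟩) :=
      @Measurable.prodMk _ _ _ (_) (ℱ t) _ _ _ hfst measurable_const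
    exact (hc.comp h1).sub (hc.comp h2)
  have hint : ∀ᵐ ω ∂μ, ∀ t < T, ∫ z, H t (ω, z) ∂(q t ω) = (∫ z, f t ω z ∂(q t ω)) - f t ω 0 := by
    filter_upwards [hprob] with ω h t ht
    obtain ⟨h1, h2⟩ := h t ht
    have h3 : (fun z => H t (ω, z)) =ᵐ[q t ω] fun z => f t ω z - f t ω 0 := by
      have h4 : ∀ᵐ z ∂(q t ω), z ∈ X := ae_iff.2 h2
      filter_upwards [h4] with z hz
      simp only [hH, hπ, if_pos hz]
    rw [integral_congr_ae h3, integral_sub ((hP.cost t ht ω).integrable hXc h2)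
      (integrable_const _)]
    simp
  refine (hP.integral_regret_le hD hG hGg hd hn (by omega) hb hxm hxX
    (xt := xt) (lb := fun t ω => ∫ z, H t (ω, z) ∂(q t ω))
    (θ := 1) (C := C) zero_le_one hC hR.play ?_ ?_ ?_ ?_).trans
    (regret_bound_le hD hG hGg hF hd hn hT hb le_rfl hC)
  · filter_upwards [hmem] with ω h t ht
    refine ⟨(h t ht).1, fun i => ?_⟩
    rw [one_mul]
    exact (h t ht).2 i
  · intro t ht
    have h1 := integral_sub_of_condExp (hxtm t ht) (ℱ.le t)
      (hprob.mono fun ω h => (h t ht).1) (hR.sample t ht) (hHm t ht) (hHle t ht)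
    have h2 : (fun ω => f t ω (xt t ω) - f t ω 0 - ∫ z, H t (ω, z) ∂(q t ω)) =ᵐ[μ]
        fun ω => H t (ω, xt t ω) - ∫ z, H t (ω, z) ∂(q t ω) := by
      filter_upwards [hmem] with ω h
      have hX : xt t ω ∈ X := (h t ht).1
      simp only [hH, hπ, if_pos hX]
    exact ⟨h1.1.congr h2.symm, (integral_congr_ae h2).trans h1.2⟩
  · filter_upwards [hprob] with ω h t ht
    have := (h t ht).1
    have h1 := norm_integral_le_of_norm_le_const (μ := q t ω) (f := fun z => H t (ω, z))
      (Filter.Eventually.of_forall fun z => hHle t ht (ω, z))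
    rw [probReal_univ, mul_one] at h1
    exact (le_abs_self _).trans h1
  · filter_upwards [hmem, hint] with ω h hi t ht u hu
    refine le_trans (le_of_eq ?_) (hgame ω t ht (fun s hs => h s (by omega)) u hu).2
    refine Finset.sum_congr rfl fun s hs => ?_
    have hs' := Finset.mem_Ico.1 hs
    rw [hi s (by omega)]
    ring

end Kernel

end OSOCO

/-- The constants `K` and `k` depend on the problem constants `D, G, G_g, F, b_min` only, neither on
the horizon `T`, the dimensions `d, n` or the online algorithm, nor on anything else. -/
theorem corollary4 (D G Gg F bmin : ℝ) (hD : 0 < D) (hG : 0 < G) (hGg : 0 < Gg)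
    (hbmin : 0 < bmin) :
    ∃ (K : ℝ) (k : ℕ), ∀ (d n T : ℕ), 2 ≤ d → 1 ≤ n → 3 ≤ T →
      ∀ (Ω : Type*) [mΩ : MeasurableSpace Ω] (μ : MeasureTheory.Measure Ω)
        [MeasureTheory.IsProbabilityMeasure μ] (ℱ : MeasureTheory.Filtration ℕ mΩ)
        (X : Set (OSOCO.Vec d)) (f : ℕ → Ω → OSOCO.Vec d → ℝ)
        (a : ℕ → Ω → Fin n → OSOCO.Vec d) (b : ℕ → Ω → OSOCO.Vec n),
        ⨅ i, OSOCO.limit μ a b i = bmin →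
        -- OSOCO with an arbitrary online algorithm `𝒜` with regret constant `C`
        (∀ (𝒜 : OSOCO.OnlineAlg d) (C : ℝ) (xt x : ℕ → Ω → OSOCO.Vec d),
          0 ≤ C → OSOCO.HasRegretConstant 𝒜 X G T C →
          OSOCO.IsProblem μ ℱ T D G Gg F X f a b xt →
          OSOCO.IsRun μ ℱ T (OSOCO.params X (OSOCO.limit μ a b) D Gg F T) 𝒜 f xt x
            (OSOCO.feedback μ a b x) →
          OSOCO.NoExpectedViolation μ T a b x ∧
          MeasureTheory.Integrable (OSOCO.regret μ T X f a b x) μ ∧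
          ∫ ω, OSOCO.regret μ T X f a b x ω ∂μ ≤
            K * ((d + C * √(d : ℝ)) * √(T : ℝ)) * Real.log (n * T) ^ k) ∧
        -- the efficient variant
        (∀ (gf : ℕ → Ω → OSOCO.Vec d → OSOCO.Vec d) (idx : ℕ → Ω → OSOCO.Label d)
          (x : ℕ → Ω → OSOCO.Vec d),
          OSOCO.IsProblem μ ℱ T D G Gg F X f a b idx →
          OSOCO.IsEfficientRun μ ℱ T (OSOCO.params X (OSOCO.limit μ a b) D Gg F T) D G f gf idx x
            (OSOCO.feedback μ a b x) →
          OSOCO.NoExpectedViolation μ T a b x ∧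
          MeasureTheory.Integrable (OSOCO.regret μ T X f a b x) μ ∧
          ∫ ω, OSOCO.regret μ T X f a b x ω ∂μ ≤
            K * ((d : ℝ) ^ (3 / 2 : ℝ) * √(T : ℝ)) * Real.log (n * d * T) ^ k) := by
  -- The constants are fixed before the problem is given, and `0 ≤ F` follows only from the problem,
  -- hence `|F|`. The factor `1 + 9 / 2 * (G * D)` serves the efficient variant, where `1 + √(log (2
  -- d))` is bounded crudely by `3 d`.
  refine ⟨OSOCO.regretConst D G Gg |F| bmin * (1 + 9 / 2 * (G * D)), 1, ?_⟩
  intro d n T hd hn hT Ω mΩ μ _ ℱ X f a b hlim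
  have hK : 0 ≤ OSOCO.regretConst D G Gg |F| bmin :=
    OSOCO.regretConst_nonneg hD hG hGg (abs_nonneg F) hbmin
  have hL := OSOCO.one_le_log_mul hn hT
  have hb : 0 < ⨅ i, OSOCO.limit μ a b i := hlim ▸ hbmin
  refine ⟨fun 𝒜 C xt x hC hA hP hR => ?_, fun gf idx x hP hR => ?_⟩
  · obtain ⟨h1, h2, h3⟩ := OSOCO.guarantee hP hD hG hGg hd hn hT hb hC hA hR
    refine ⟨h1, h2, h3.trans ?_⟩
    rw [hlim, pow_one, one_mul]
    nth_rewrite 1 [← abs_of_nonneg (hP.F_nonneg (by omega))]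
    gcongr
    exact le_mul_of_one_le_right hK (le_add_of_nonneg_right (by positivity))
  · obtain ⟨h1, h2, h3⟩ := OSOCO.efficient_guarantee hP hD hG hGg hd hn hT hb hR
    refine ⟨h1, h2, h3.trans ?_⟩
    rw [hlim, pow_one, mul_assoc (OSOCO.regretConst D G Gg |F| bmin) (1 + _)]
    nth_rewrite 1 [← abs_of_nonneg (hP.F_nonneg (by omega))]
    have hd1 : (1 : ℝ) ≤ d := by exact_mod_cast (by omega : 1 ≤ d)
    have hn1 : (1 : ℝ) ≤ n := by exact_mod_cast hn
    have hT1 : (0 : ℝ) < T := by exact_mod_cast (by omega : 0 < T)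
    have hlog : Real.log (n * T) ≤ Real.log (n * d * T) := by
      refine Real.log_le_log (by positivity) ?_
      gcongr
      exact le_mul_of_one_le_right (by positivity) hd1
    have hpow : (d : ℝ) ^ (3 / 2 : ℝ) = √(d : ℝ) * d := by
      rw [show (3 / 2 : ℝ) = 1 / 2 + 1 by norm_num, Real.rpow_add (by positivity),
        Real.rpow_one, Real.sqrt_eq_rpow]
    have hsqrt : 1 + √(Real.log (2 * d)) ≤ 3 * d := by
      have h4 : √(Real.log (2 * d)) ≤ 2 * d := by
        refine Real.sqrt_le_iff.2 ⟨by positivity, ?_⟩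
        have := Real.log_le_self (x := 2 * (d : ℝ)) (by positivity)
        nlinarith
      linarith
    have hmain : √(d : ℝ) * d + 3 / 2 * (G * D) * (1 + √(Real.log (2 * d))) * √(d : ℝ) ≤
        (1 + 9 / 2 * (G * D)) * (√(d : ℝ) * d) :=
      calc _ ≤ √(d : ℝ) * d + 3 / 2 * (G * D) * (3 * d) * √(d : ℝ) := by gcongr
        _ = _ := by ring
    rw [hpow, ← mul_assoc (1 + _)]
    gcongr
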